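/- **Setting.** Let $M_x,M_y,K,T\in\mathbb N$, $M=M_xM_y$, $u=2\pi d/\lambda$ with $d,\lambda>0$. The antenna with index $m=(m_y-1)M_x+m_x$ ($1\le m_x\le M_x$, $1\le m_y\le M_y$) of a uniform rectangular array has response $$[\mathbf a(\theta,\phi)]_m=\exp\!\big(iu\sin\phi\,[(m_x-1)\cos\theta+(m_y-1)\sin\theta]\big).$$ Put $p_m(\theta)=(m_x-1)\cos\theta+(m_y-1)\sin\theta$ and $q_m(\theta)=-(m_x-1)\sin\theta+(m_y-1)\cos\theta$. For antennas $m,n$ put $\delta_x=m_x-n_x$, $\delta_y=m_y-n_y$, $p_{mn}=p_m-p_n$, $q_{mn}=q_m-q_n$. The parameter vector is $\boldsymbol\xi=(\mathbf u,\mathbf v)$ with $\mathbf u=(\bar\theta_k;\bar\phi_k;\sigma_{\theta_k};\sigma_{\phi_k})_{k\le K}\in\mathbb R^{4K}$ and $\mathbf v=(\sigma_1^2,\dots,\sigma_K^2,\sigma_n^2)\in\mathbb R^{K+1}$. The parameter space $\Theta$ is $0\le\bar\theta_k<\pi$, $0\le\bar\phi_k<\pi/2$, $\sigma_{\theta_k},\sigma_{\phi_k},\sigma_k^2,\sigma_n^2>0$.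 Let $\boldsymbol\xi\in\Theta$. Let $\mathbf D_k=\mathrm{diag}(\mathbf a(\bar\theta_k,\bar\phi_k))$, $$[\mathbf B_k]_{mn}=\exp\!\Big(-\tfrac{u^2}{2}\big(\sigma_{\phi_k}^2\cos^2\bar\phi_k\,p_{mn}(\bar\theta_k)^2+\sigma_{\theta_k}^2\sin^2\bar\phi_k\,q_{mn}(\bar\theta_k)^2\big)\Big),\qquad \mathbf R=\sum_{k}\sigma_k^2\mathbf D_k\mathbf B_k\mathbf D_k^H+\sigma_n^2\mathbf I .$$ **(1) Approximation of the manifold.** Expanding the phase to first order, let $$[\tilde{\mathbf a}_k(\tilde\theta,\tilde\phi)]_m=[\mathbf a(\bar\theta_k,\bar\phi_k)]_m\exp\!\big(iu\tilde\phi\cos\bar\phi_k\,p_m(\bar\theta_k)\big)\exp\!\big(iu\tilde\theta\sin\bar\phi_k\,q_m(\bar\theta_k)\big).$$ Then $\mathbf a(\bar\theta_k+\tilde\theta,\bar\phi_k+\tilde\phi)-\tilde{\mathbf a}_k(\tilde\theta,\tilde\phi)=O(\tilde\theta^2+\tilde\phi^2)$ as $(\tilde\theta,\tilde\phi)\to0$.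 **(2) Received signal.** Let $\mathbf x(t)=\sum_k s_k(t)\sum_{j\le N_k}\gamma_{k,j}(t)\,\tilde{\mathbf a}_k(\tilde\theta_{k,j}(t),\tilde\phi_{k,j}(t))+\mathbf n(t)$, $t=1,\dots,T$. Here $s_k(t)$ is deterministic with $|s_k(t)|^2=S_k$, and $\gamma_{k,j}(t)=g_{k,j}(t)/\sqrt{N_k}$, where for each $k$ the $g_{k,j}(t)$ are identically distributed complex variables, with law not depending on the numbers of paths, satisfying $\mathbb E g=0$, $\mathbb E|g|^2=\sigma_{\gamma_k}^2$, $\mathbb E g^2=0$. Moreover $\tilde\theta_{k,j}(t)\sim N(0,\sigma_{\theta_k}^2)$, $\tilde\phi_{k,j}(t)\sim N(0,\sigma_{\phi_k}^2)$, $\mathbf n(t)\sim\mathcal{CN}(0,\sigma_n^2\mathbf I)$, all these variables are independent, and $\sigma_k^2=S_k\sigma_{\gamma_k}^2$. For all $N_1,\dots,N_K\ge1$, $\mathbf x(t)$ is square integrable, $\mathbb E\,\mathbf x(t)=0$, $\mathbb E\,\mathbf x(t)\mathbf x(t')^H=\mathbf R$ if $t=t'$ and $0$ otherwise, and $\mathbb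 E\,\mathbf x(t)\mathbf x(t')^T=0$. As all $N_k\to\infty$, $(\mathbf x(1),\dots,\mathbf x(T))$ converges in law to $T$ independent vectors with the zero-mean circularly symmetric complex Gaussian law $\mathcal{CN}(0,\mathbf R)$, whose density is $e^{-\mathbf x^H\mathbf R^{-1}\mathbf x}/(\pi^M\det\mathbf R)$; here $\mathbf R$ is positive definite. **(3) Partial derivatives.** With $\odot$ the Hadamard product, the partial derivatives of $\mathbf R$ are $$\begin{aligned} \partial_{\bar\theta_k}\mathbf R&=\sigma_k^2\big(\mathbf D_{\bar\theta_k}\mathbf D_k\mathbf B_k\mathbf D_k^H-\mathbf D_k\mathbf B_k\mathbf D_k^H\mathbf D_{\bar\theta_k}+\mathbf D_k(\mathbf B_k\odot\mathbf B_{\bar\theta_k})\mathbf D_k^H\big),\\ \partial_{\bar\phi_k}\mathbf R&=\sigma_k^2\big(\mathbf D_{\bar\phi_k}\mathbf D_k\mathbf B_k\mathbf D_k^H-\mathbf D_k\mathbf B_k\mathbf D_k^H\mathbf D_{\bar\phi_k}+\mathbf D_k(\mathbf B_k\odot\mathbf B_{\bar\phi_k})\mathbf D_k^H\big),\\ \partial_{\sigma_{\theta_k}}\mathbf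 R&=\sigma_k^2\mathbf D_k(\mathbf B_k\odot\mathbf B_{\sigma_\theta,k})\mathbf D_k^H,\qquad \partial_{\sigma_{\phi_k}}\mathbf R=\sigma_k^2\mathbf D_k(\mathbf B_k\odot\mathbf B_{\sigma_\phi,k})\mathbf D_k^H,\\ \partial_{\sigma_k^2}\mathbf R&=\mathbf D_k\mathbf B_k\mathbf D_k^H,\qquad \partial_{\sigma_n^2}\mathbf R=\mathbf I, \end{aligned}$$ where $\mathbf D_{\bar\theta_k}=\mathrm{diag}_m\big(iu\sin\bar\phi_k\,q_m(\bar\theta_k)\big)$, $\mathbf D_{\bar\phi_k}=\mathrm{diag}_m\big(iu\cos\bar\phi_k\,p_m(\bar\theta_k)\big)$, and $$\begin{aligned} [\mathbf B_{\bar\theta_k}]_{mn}&=-\tfrac{u^2}{2}\big(-\sigma_{\phi_k}^2\cos^2\bar\phi_k+\sigma_{\theta_k}^2\sin^2\bar\phi_k\big)\big((\delta_x^2-\delta_y^2)\sin2\bar\theta_k-2\delta_x\delta_y\cos2\bar\theta_k\big),\\ [\mathbf B_{\bar\phi_k}]_{mn}&=-\tfrac{u^2}{2}\sin2\bar\phi_k\big(-\sigma_{\phi_k}^2p_{mn}(\bar\theta_k)^2+\sigma_{\theta_k}^2q_{mn}(\bar\theta_k)^2\big),\\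 [\mathbf B_{\sigma_\theta,k}]_{mn}&=-u^2\sigma_{\theta_k}\sin^2\bar\phi_k\,q_{mn}(\bar\theta_k)^2,\qquad [\mathbf B_{\sigma_\phi,k}]_{mn}=-u^2\sigma_{\phi_k}\cos^2\bar\phi_k\,p_{mn}(\bar\theta_k)^2 . \end{aligned}$$ **(4) Fisher information.** For $T$ independent $\mathcal{CN}(0,\mathbf R(\boldsymbol\xi))$ snapshots with joint density $p(\cdot;\boldsymbol\xi)$, the Fisher information matrix $[\mathbf J]_{qq'}=\mathbb E\big[\partial_{\xi_q}\log p\;\partial_{\xi_{q'}}\log p\big]$ exists and $$[\mathbf J]_{qq'}=T\,\mathrm{tr}\big(\mathbf R^{-1}\,\partial_{\xi_q}\mathbf R\;\mathbf R^{-1}\,\partial_{\xi_{q'}}\mathbf R\big).$$ **(5) Cramér–Rao bound.** Assume that $\mathbf J=\begin{pmatrix}\mathbf J_{uu}&\mathbf J_{uv}\\ \mathbf J_{uv}^T&\mathbf J_{vv}\end{pmatrix}$ is invertible at $\boldsymbol\xi$. Then $\mathbf J_{vv}$ and $\mathbf J_{uu}-\mathbf J_{uv}\mathbf J_{vv}^{-1}\mathbf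 J_{uv}^T$ are invertible, and $$\mathbf C=\big(\mathbf J_{uu}-\mathbf J_{uv}\mathbf J_{vv}^{-1}\mathbf J_{uv}^T\big)^{-1}$$ is the upper left $4K\times4K$ block of $\mathbf J^{-1}$. Every estimator $\hat{\mathbf u}$ of $\mathbf u$ from the $T$ snapshots that has finite second moments at $\boldsymbol\xi$ and is unbiased on $\Theta$ satisfies $$\mathbb E\{(\hat{\mathbf u}-\mathbf u)(\hat{\mathbf u}-\mathbf u)^T\}\ \ge\ \mathbf C,$$ where $\ge$ means that the difference is positive semidefinite. The same bound holds for every estimator with finite second moments at $\boldsymbol\xi$ that is only locally unbiased at $\boldsymbol\xi$, i.e. $\mathbb E_{\boldsymbol\xi'}\hat{\mathbf u}-\mathbf u'=o(\|\boldsymbol\xi'-\boldsymbol\xi\|)$ as $\boldsymbol\xi'\to\boldsymbol\xi$ in $\Theta$, where $\mathbf u'$ denotes the angular part of $\boldsymbol\xi'$. -/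

import Mathlib

open MeasureTheory ProbabilityTheory Filter Topology Asymptotics Matrix
open scoped BigOperators ComplexConjugate ComplexOrder BoundedContinuousFunction

noncomputable section

namespace ArrayCRB

/-! ### Uniform rectangular array -/

/-- Antennas of an `Mx × My` rectangular array, listed as `(m_y - 1, m_x - 1)`; the lexicographic
position of an antenna (counted from `1`) is `m = (m_y - 1) Mx + m_x`. -/
abbrev Antenna (Mx My : ℕ) : Type := Fin My × Fin Mx

/-- `m_x - 1` -/
def posX {Mx My : ℕ} (m : Antenna Mx My) : ℝ := ((m.2 : ℕ) : ℝ)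

/-- `m_y - 1` -/
def posY {Mx My : ℕ} (m : Antenna Mx My) : ℝ := ((m.1 : ℕ) : ℝ)

/-- `u = 2 π d / λ`. -/
def waveFactor (d lam : ℝ) : ℝ := 2 * Real.pi * d / lam

/-- `(m_x - 1) cos θ + (m_y - 1) sin θ`, for coordinates `(a, b) = (m_x - 1, m_y - 1)`. It is also
used with the coordinate differences `(δ_x, δ_y)` of two antennas. -/
def axial (θ a b : ℝ) : ℝ := a * Real.cos θ + b * Real.sin θ

/-- `-(m_x - 1) sin θ + (m_y - 1) cos θ`, the derivative of `axial` in `θ`. -/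
def transverse (θ a b : ℝ) : ℝ := -a * Real.sin θ + b * Real.cos θ

/-- The array manifold `a(θ, φ)`. -/
def manifold {Mx My : ℕ} (κ θ φ : ℝ) (m : Antenna Mx My) : ℂ :=
  Complex.exp (Complex.I * ((κ * Real.sin φ * axial θ (posX m) (posY m) : ℝ) : ℂ))

/-- The approximation of `a(θ + dθ, φ + dφ)` obtained by expanding the phase of each entry to first
order in the deviations `dθ`, `dφ`. -/
def manifoldApprox {Mx My : ℕ} (κ θ φ dθ dφ : ℝ) (m : Antenna Mx My) : ℂ :=
  Complex.exp (Complex.I * ((κ * Real.sin φ * axial θ (posX m) (posY m) : ℝ) : ℂ)) *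
  Complex.exp (Complex.I * ((κ * dφ * Real.cos φ * axial θ (posX m) (posY m) : ℝ) : ℂ)) *
  Complex.exp (Complex.I * ((κ * dθ * Real.sin φ * transverse θ (posX m) (posY m) : ℝ) : ℂ))

/-! ### Parameters -/

/-- Index set of `𝐮 = (θ̄₁,…,θ̄_K, φ̄₁,…,φ̄_K, σ_θ₁,…,σ_θK, σ_φ₁,…,σ_φK)`. -/
abbrev AngIdx (K : ℕ) : Type := Fin K ⊕ Fin K ⊕ Fin K ⊕ Fin K

/-- Index set of `𝐯 = (σ₁²,…,σ_K², σ_n²)`. -/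
abbrev NuisIdx (K : ℕ) : Type := Fin K ⊕ Unit

/-- Index set of `ξ = (𝐮, 𝐯)`. -/
abbrev ParamIdx (K : ℕ) : Type := AngIdx K ⊕ NuisIdx K

/-- The parameter vector `ξ`. -/
abbrev Param (K : ℕ) : Type := ParamIdx K → ℝ

section Accessors
variable {K : ℕ} (ξ : Param K)

/-- nominal azimuth `θ̄_k` -/
def azim (k : Fin K) : ℝ := ξ (Sum.inl (Sum.inl k))
/-- nominal elevation `φ̄_k` -/
def elev (k : Fin K) : ℝ := ξ (Sum.inl (Sum.inr (Sum.inl k)))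
/-- azimuth spread `σ_θk` -/
def azimSpread (k : Fin K) : ℝ := ξ (Sum.inl (Sum.inr (Sum.inr (Sum.inl k))))
/-- elevation spread `σ_φk` -/
def elevSpread (k : Fin K) : ℝ := ξ (Sum.inl (Sum.inr (Sum.inr (Sum.inr k))))
/-- received power `σ_k²` -/
def power (k : Fin K) : ℝ := ξ (Sum.inr (Sum.inl k))
/-- noise power `σ_n²` -/
def noisePower : ℝ := ξ (Sum.inr (Sum.inr ()))

end Accessors

/-- The parameter space. -/
def paramSpace (K : ℕ) : Set (Param K) :=
  {ξ | (∀ k, 0 ≤ azim ξ k ∧ azim ξ k < Real.pi) ∧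
       (∀ k, 0 ≤ elev ξ k ∧ elev ξ k < Real.pi / 2) ∧
       (∀ k, 0 < azimSpread ξ k) ∧ (∀ k, 0 < elevSpread ξ k) ∧
       (∀ k, 0 < power ξ k) ∧ 0 < noisePower ξ}

/-! ### The covariance matrix and its partial derivatives -/

section Covariance
variable {Mx My K : ℕ} (κ : ℝ) (ξ : Param K)

/-- `δ_x cos θ + δ_y sin θ` for the pair of antennas `m, n`. -/
def axialDiff (θ : ℝ) (m n : Antenna Mx My) : ℝ :=
  axial θ (posX m - posX n) (posY m - posY n)

/-- `-δ_x sin θ + δ_y cos θ` for the pair of antennas `m, n`. -/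
def transverseDiff (θ : ℝ) (m n : Antenna Mx My) : ℝ :=
  transverse θ (posX m - posX n) (posY m - posY n)

/-- `𝐃_k = diag(a(θ̄_k, φ̄_k))`. -/
def matD (k : Fin K) : Matrix (Antenna Mx My) (Antenna Mx My) ℂ :=
  Matrix.diagonal (manifold κ (azim ξ k) (elev ξ k))

/-- `𝐁_k`. -/
def matB (k : Fin K) : Matrix (Antenna Mx My) (Antenna Mx My) ℂ :=
  Matrix.of fun m n => ((Real.exp (-(
      elevSpread ξ k ^ 2 * Real.cos (elev ξ k) ^ 2 * axialDiff (azim ξ k) m n ^ 2 +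
      azimSpread ξ k ^ 2 * Real.sin (elev ξ k) ^ 2 * transverseDiff (azim ξ k) m n ^ 2)
    * (1 / 2 * κ ^ 2)) : ℝ) : ℂ)

/-- `𝐑_x = ∑_k σ_k² 𝐃_k 𝐁_k 𝐃_kᴴ + σ_n² 𝐈`. -/
def covR : Matrix (Antenna Mx My) (Antenna Mx My) ℂ :=
  ∑ k, ((power ξ k : ℝ) : ℂ) • (matD κ ξ k * matB κ ξ k * (matD κ ξ k)ᴴ) +
    ((noisePower ξ : ℝ) : ℂ) • (1 : Matrix (Antenna Mx My) (Antenna Mx My) ℂ)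

/-- `𝐃_{θ̄_k}` -/
def matDAzim (k : Fin K) : Matrix (Antenna Mx My) (Antenna Mx My) ℂ :=
  Matrix.diagonal fun m => Complex.I *
    ((κ * Real.sin (elev ξ k) * transverse (azim ξ k) (posX m) (posY m) : ℝ) : ℂ)

/-- `𝐃_{φ̄_k}` -/
def matDElev (k : Fin K) : Matrix (Antenna Mx My) (Antenna Mx My) ℂ :=
  Matrix.diagonal fun m => Complex.I *
    ((κ * Real.cos (elev ξ k) * axial (azim ξ k) (posX m) (posY m) : ℝ) : ℂ)

/-- `𝐁_{θ̄_k}` -/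
def matBAzim (k : Fin K) : Matrix (Antenna Mx My) (Antenna Mx My) ℂ :=
  Matrix.of fun m n => ((-(1 / 2) * κ ^ 2 *
    (-(elevSpread ξ k ^ 2) * Real.cos (elev ξ k) ^ 2 +
      azimSpread ξ k ^ 2 * Real.sin (elev ξ k) ^ 2) *
    (((posX m - posX n) ^ 2 - (posY m - posY n) ^ 2) * Real.sin (2 * azim ξ k) -
      2 * (posX m - posX n) * (posY m - posY n) * Real.cos (2 * azim ξ k)) : ℝ) : ℂ)

/-- `𝐁_{φ̄_k}` -/
def matBElev (k : Fin K) : Matrix (Antenna Mx My) (Antenna Mx My) ℂ :=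
  Matrix.of fun m n => ((-(1 / 2) * κ ^ 2 * Real.sin (2 * elev ξ k) *
    (-(elevSpread ξ k ^ 2) * axialDiff (azim ξ k) m n ^ 2 +
      azimSpread ξ k ^ 2 * transverseDiff (azim ξ k) m n ^ 2) : ℝ) : ℂ)

/-- `𝐁_{σ_θ, k}` -/
def matBAzimSpread (k : Fin K) : Matrix (Antenna Mx My) (Antenna Mx My) ℂ :=
  Matrix.of fun m n => ((-(κ ^ 2) * azimSpread ξ k * Real.sin (elev ξ k) ^ 2 *
    transverseDiff (azim ξ k) m n ^ 2 : ℝ) : ℂ)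

/-- `𝐁_{σ_φ, k}` -/
def matBElevSpread (k : Fin K) : Matrix (Antenna Mx My) (Antenna Mx My) ℂ :=
  Matrix.of fun m n => ((-(κ ^ 2) * elevSpread ξ k * Real.cos (elev ξ k) ^ 2 *
    axialDiff (azim ξ k) m n ^ 2 : ℝ) : ℂ)

/-- The explicit formulas for `∂𝐑_x / ∂[ξ]_q` (`⊙` is the Hadamard product). -/
def covPartial : ParamIdx K → Matrix (Antenna Mx My) (Antenna Mx My) ℂ
  | Sum.inl (Sum.inl k) => ((power ξ k : ℝ) : ℂ) •
      (matDAzim κ ξ k * matD κ ξ k * matB κ ξ k * (matD κ ξ k)ᴴ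
        - matD κ ξ k * matB κ ξ k * (matD κ ξ k)ᴴ * matDAzim κ ξ k
        + matD κ ξ k * (matB κ ξ k ⊙ matBAzim κ ξ k) * (matD κ ξ k)ᴴ)
  | Sum.inl (Sum.inr (Sum.inl k)) => ((power ξ k : ℝ) : ℂ) •
      (matDElev κ ξ k * matD κ ξ k * matB κ ξ k * (matD κ ξ k)ᴴ
        - matD κ ξ k * matB κ ξ k * (matD κ ξ k)ᴴ * matDElev κ ξ k
        + matD κ ξ k * (matB κ ξ k ⊙ matBElev κ ξ k) * (matD κ ξ k)ᴴ)
  | Sum.inl (Sum.inr (Sum.inr (Sum.inl k))) => ((power ξ k : ℝ) : ℂ) •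
      (matD κ ξ k * (matB κ ξ k ⊙ matBAzimSpread κ ξ k) * (matD κ ξ k)ᴴ)
  | Sum.inl (Sum.inr (Sum.inr (Sum.inr k))) => ((power ξ k : ℝ) : ℂ) •
      (matD κ ξ k * (matB κ ξ k ⊙ matBElevSpread κ ξ k) * (matD κ ξ k)ᴴ)
  | Sum.inr (Sum.inl k) => matD κ ξ k * matB κ ξ k * (matD κ ξ k)ᴴ
  | Sum.inr (Sum.inr _) => 1

end Covariance

/-! ### Circular complex Gaussian vectors and the law of the snapshots -/

/-- Density of the zero-mean circularly symmetric complex Gaussian vector with positive definite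
covariance `R = E[x xᴴ]`, namely `exp(-xᴴ R⁻¹ x) / (π^M det R)`. -/
def cgDensity {ι : Type*} [Fintype ι] [DecidableEq ι] (R : Matrix ι ι ℂ) (x : ι → ℂ) : ℝ :=
  Real.exp (-(star x ⬝ᵥ (R⁻¹ *ᵥ x)).re) / (Real.pi ^ Fintype.card ι * R.det.re)

/-- The zero-mean circularly symmetric complex Gaussian law with covariance `R`. -/
def complexGaussian {ι : Type*} [Fintype ι] [DecidableEq ι] (R : Matrix ι ι ℂ) :
    Measure (ι → ℂ) :=
  volume.withDensity fun x => ENNReal.ofReal (cgDensity R x)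

/-- A record of `T` snapshots. -/
abbrev Data (Mx My T : ℕ) : Type := Fin T → Antenna Mx My → ℂ

section Statistics
variable {Mx My K T : ℕ} (κ : ℝ)

/-- Likelihood of `T` independent snapshots distributed as `CN(0, 𝐑_x(ξ))`. -/
def likelihood (ξ : Param K) (x : Data Mx My T) : ℝ := ∏ t, cgDensity (covR κ ξ) (x t)

/-- Law of `T` independent snapshots distributed as `CN(0, 𝐑_x(ξ))`. -/
def snapshotLaw (ξ : Param K) : Measure (Data Mx My T) :=
  Measure.pi fun _ => complexGaussian (covR κ ξ)

/-- The log-likelihood as a function of the `q`-th parameter, the others being those of `ξ`. -/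
def logLikAlong (ξ : Param K) (q : ParamIdx K) (x : Data Mx My T) (s : ℝ) : ℝ :=
  Real.log (likelihood κ (Function.update ξ q s) x)

/-- The score `∂ log p(x; ξ) / ∂[ξ]_q`. -/
def score (ξ : Param K) (q : ParamIdx K) (x : Data Mx My T) : ℝ :=
  deriv (logLikAlong κ ξ q x) (ξ q)

variable (Mx My T) in
/-- The Fisher information matrix `𝐉_{ξ,ξ}` of the `T` snapshots,
`E[(∂ log p / ∂[ξ]_q) (∂ log p / ∂[ξ]_q')]`. -/
def fisherInformation (ξ : Param K) : Matrix (ParamIdx K) (ParamIdx K) ℝ :=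
  Matrix.of fun q q' =>
    ∫ x : Data Mx My T, score κ ξ q x * score κ ξ q' x ∂(snapshotLaw κ ξ)

/-- `uHat` is an unbiased estimator of `𝐮`. -/
def IsUnbiased (uHat : Data Mx My T → AngIdx K → ℝ) : Prop :=
  Measurable uHat ∧ ∀ ξ ∈ paramSpace K, ∀ i,
    Integrable (fun x => uHat x i) (snapshotLaw κ ξ) ∧
    ∫ x, uHat x i ∂(snapshotLaw κ ξ) = ξ (Sum.inl i)

/-- `uHat` is locally unbiased at `ξ₀`: its bias vanishes at `ξ₀` to first order, that is, the bias
at `ξ` is `o(‖ξ - ξ₀‖)` as `ξ → ξ₀` in the parameter space (in particular it is `0` at `ξ₀`). -/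
def IsLocallyUnbiasedAt (uHat : Data Mx My T → AngIdx K → ℝ) (ξ₀ : Param K) : Prop :=
  Measurable uHat ∧ ∀ i,
    (fun ξ : Param K => (∫ x, uHat x i ∂(snapshotLaw κ ξ)) - ξ (Sum.inl i))
      =o[𝓝[paramSpace K] ξ₀] (fun ξ => ξ - ξ₀)

/-- The error covariance `E[(uHat - 𝐮)(uHat - 𝐮)ᵀ]` at `ξ`. -/
def errorCov (uHat : Data Mx My T → AngIdx K → ℝ) (ξ : Param K) :
    Matrix (AngIdx K) (AngIdx K) ℝ :=
  Matrix.of fun i j => ∫ x, (uHat x i - ξ (Sum.inl i)) * (uHat x j - ξ (Sum.inl j))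
    ∂(snapshotLaw κ ξ)

end Statistics

/-- The Schur complement `𝐉_uu - 𝐉_uv 𝐉_vv⁻¹ 𝐉_uvᵀ`. -/
def schurCompl {K : ℕ} (J : Matrix (ParamIdx K) (ParamIdx K) ℝ) :
    Matrix (AngIdx K) (AngIdx K) ℝ :=
  J.toBlocks₁₁ - J.toBlocks₁₂ * (J.toBlocks₂₂)⁻¹ * (J.toBlocks₁₂)ᵀ

/-- The bound `𝐂 = (𝐉_uu - 𝐉_uv 𝐉_vv⁻¹ 𝐉_uvᵀ)⁻¹`. -/
def crb {K : ℕ} (J : Matrix (ParamIdx K) (ParamIdx K) ℝ) : Matrix (AngIdx K) (AngIdx K) ℝ :=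
  (schurCompl J)⁻¹

/-! ### The received signal -/

section Signal
variable {Mx My K T : ℕ} {Ω : Type*}

/-- The received signal
`x(t) = ∑_k s_k(t) ∑_{j < N_k} γ_{k,j}(t) a_k(θ̃_{k,j}(t), φ̃_{k,j}(t)) + n(t)`
with path gains `γ_{k,j}(t) = g_{k,j}(t) / √N_k`, where `resp k dθ dφ` is the array response to user
`k` at deviations `dθ, dφ` from its nominal directions. -/
def receivedSignal (resp : Fin K → ℝ → ℝ → Antenna Mx My → ℂ) (s : Fin K → Fin T → ℂ)
    (g : Fin K → ℕ → Fin T → Ω → ℂ) (dθ dφ : Fin K → ℕ → Fin T → Ω → ℝ)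
    (noise : Fin T → Ω → Antenna Mx My → ℂ) (N : Fin K → ℕ)
    (t : Fin T) (ω : Ω) (m : Antenna Mx My) : ℂ :=
  (∑ k, s k t * ∑ j ∈ Finset.range (N k),
    (g k j t ω / ((Real.sqrt (N k) : ℝ) : ℂ)) * resp k (dθ k j t ω) (dφ k j t ω) m)
  + noise t ω m

/-- The standing assumptions on transmitted signals, path gains, angular deviations and noise, for
the parameter vector `ξ`, transmitted powers `S k` and path-gain standard deviations `σγ k`. -/
structure IsScatteringModel [MeasurableSpace Ω] (P : Measure Ω) (ξ : Param K)
    (S σγ : Fin K → ℝ) (s : Fin K → Fin T → ℂ)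
    (g : Fin K → ℕ → Fin T → Ω → ℂ) (dθ dφ : Fin K → ℕ → Fin T → Ω → ℝ)
    (noise : Fin T → Ω → Antenna Mx My → ℂ) : Prop where
  /-- deterministic signals of constant modulus -/
  signal : ∀ k t, ‖s k t‖ ^ 2 = S k
  /-- `σ_k² = S_k σ_γk²` -/
  power_eq : ∀ k, power ξ k = S k * σγ k ^ 2
  measurable_gain : ∀ k j t, Measurable (g k j t)
  measurable_azim : ∀ k j t, Measurable (dθ k j t)
  measurable_elev : ∀ k j t, Measurable (dφ k j t)
  measurable_noise : ∀ t, Measurable (noise t)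
  /-- the gains of one user are identically distributed over paths and snapshots -/
  gain_ident : ∀ k j t j' t', IdentDistrib (g k j t) (g k j' t') P P
  gain_memLp : ∀ k j t, MemLp (g k j t) 2 P
  gain_mean : ∀ k j t, ∫ ω, g k j t ω ∂P = 0
  gain_var : ∀ k j t, ∫ ω, ‖g k j t ω‖ ^ 2 ∂P = σγ k ^ 2
  /-- second-order circularity of the gains -/
  gain_circular : ∀ k j t, ∫ ω, g k j t ω ^ 2 ∂P = 0
  /-- on each path, gain, azimuth deviation and elevation deviation are independent, and the
  deviations are `N(0, σ_θk²)` and `N(0, σ_φk²)` -/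
  path_law : ∀ k j t, P.map (fun ω => (g k j t ω, dθ k j t ω, dφ k j t ω)) =
    (P.map (g k j t)).prod
      ((gaussianReal 0 (Real.toNNReal (azimSpread ξ k ^ 2))).prod
        (gaussianReal 0 (Real.toNNReal (elevSpread ξ k ^ 2))))
  /-- independence over users, paths and snapshots -/
  path_indep : iIndepFun (fun (p : Fin K × ℕ × Fin T) ω =>
    (g p.1 p.2.1 p.2.2 ω, dθ p.1 p.2.1 p.2.2 ω, dφ p.1 p.2.1 p.2.2 ω)) P
  /-- white circular Gaussian noise, independent over snapshots -/
  noise_law : ∀ t, P.map (noise t) =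
    complexGaussian (((noisePower ξ : ℝ) : ℂ) •
      (1 : Matrix (Antenna Mx My) (Antenna Mx My) ℂ))
  noise_indep : iIndepFun noise P
  /-- noise and paths are independent -/
  path_noise_indep : IndepFun
    (fun ω (p : Fin K × ℕ × Fin T) =>
      (g p.1 p.2.1 p.2.2 ω, dθ p.1 p.2.1 p.2.2 ω, dφ p.1 p.2.1 p.2.2 ω))
    (fun ω t => noise t ω) P

end Signal

end ArrayCRB

end

open ArrayCRB

/-! Gaussian part. A positive definite `R` factors as `L * Lᴴ`, and `complexGaussian_factor` shows
that `CN(0, R)` is the image under `L` of independent standard complex Gaussian coordinates. Moments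
and characteristic functions follow by substitution. For a Hermitian form `xᴴ A x`, the spectral
theorem and the unitary invariance of the standard law give mean `tr(A R)` and variance `tr(A R A
R)` (`quadForm_complexGaussian`).

Received signal. A path gain is centered, circular and independent of the angular deviations, so the
second moments of a path are the gain variance times the average of the rank-one matrices `ã ãᴴ`.
The linearized phase is linear in the Gaussian deviations, so this average is a product of Gaussian
characteristic functions, which is exactly `𝐃_k 𝐁_k 𝐃_kᴴ` (`integral_response_mul_conj`). For many
paths the characteristic function of the record factors into `N_k`-th powers, each governed by the
one-dimensional central limit theorem, and Lévy's theorem concludes.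

Fisher information. Jacobi's formula and the derivative of the inverse identify the score as a sum
over snapshots of the centered Hermitian form with matrix `𝐑⁻¹ (∂_q 𝐑) 𝐑⁻¹` (`score_eq`). Polarizing
the variance formula gives the trace formula (`fisherInformation_eq`).

Cramér–Rao bound. Difference quotients of the likelihood ratio are dominated by the exponential of a
small multiple of the squared data norm, which is square integrable. Hence the expectation of any
estimator with finite second moments can be differentiated under the integral
(`tendsto_slope_expectation`), and local unbiasedness makes the cross-covariance of error and score
the block row `[I 0]`. The Gram matrix of errors and scores is positive semidefinite, and its Schur
complement with respect to `J` is the error covariance minus the upper left block of `J⁻¹`. -/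

noncomputable section

namespace ArrayCRB

/-! ### The standard complex Gaussian law -/

/-- Density of the standard complex Gaussian law on `ℂ`. -/
def stdDensity (z : ℂ) : ℝ := Real.exp (-‖z‖ ^ 2) / Real.pi

/-- The standard complex Gaussian law on `ℂ`. -/
def stdComplex : Measure ℂ := volume.withDensity fun z => ENNReal.ofReal (stdDensity z)

lemma stdDensity_nonneg (z : ℂ) : 0 ≤ stdDensity z := by unfold stdDensity; positivity

@[fun_prop]
lemma continuous_stdDensity : Continuous stdDensity := by unfold stdDensity; fun_prop

lemma integral_stdComplex {E : Type*} [NormedAddCommGroup E] [NormedSpace ℝ E] (f : ℂ → E) :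
    ∫ z, f z ∂stdComplex = ∫ z, stdDensity z • f z := by
  unfold stdComplex
  rw [integral_withDensity_eq_integral_toReal_smul
    (continuous_stdDensity.measurable.ennreal_ofReal) (by simp)]
  simp [stdDensity_nonneg]

lemma integrable_stdComplex_iff {E : Type*} [NormedAddCommGroup E] [NormedSpace ℝ E]
    {f : ℂ → E} : Integrable f stdComplex ↔ Integrable (fun z => stdDensity z • f z) := by
  unfold stdComplex
  rw [integrable_withDensity_iff_integrable_smul'
    (continuous_stdDensity.measurable.ennreal_ofReal) (by simp)]
  simp [stdDensity_nonneg]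

/-- In polar coordinates this is a Gamma integral. The cases `n = 0, 1, 2` provide the total mass,
the variance and the fourth moment. -/
lemma integral_norm_pow_exp (n : ℕ) :
    ∫ z : ℂ, stdDensity z * ‖z‖ ^ (2 * n) = n.factorial := by
  have h := Complex.integral_rpow_mul_exp_neg_rpow (p := 2) (q := ((2 * n : ℕ) : ℝ)) (by norm_num)
    (by have : (0:ℝ) ≤ ((2 * n : ℕ) : ℝ) := by positivity
        linarith)
  rw [show (((2 * n : ℕ) : ℝ) + 2) / 2 = (n : ℝ) + 1 by push_cast; ring,
    Real.Gamma_nat_eq_factorial] at h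
  have : ∀ z : ℂ, stdDensity z * ‖z‖ ^ (2 * n) =
      Real.pi⁻¹ * (‖z‖ ^ ((2 * n : ℕ) : ℝ) * Real.exp (-‖z‖ ^ (2 : ℝ))) := by
    intro z
    rw [Real.rpow_natCast, Real.rpow_two, stdDensity]
    ring
  simp_rw [this]
  rw [integral_const_mul, h]
  have := Real.pi_ne_zero
  field_simp

lemma integral_stdComplex_norm_pow (n : ℕ) : ∫ z, ‖z‖ ^ (2 * n) ∂stdComplex = n.factorial := by
  rw [integral_stdComplex]
  simpa using integral_norm_pow_exp n

lemma integrable_stdComplex_norm_pow (n : ℕ) :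
    Integrable (fun z : ℂ => ‖z‖ ^ (2 * n)) stdComplex := by
  -- The integral of a non-integrable function is `0` by convention, so a nonzero value already
  -- proves integrability.
  by_contra h
  have := integral_stdComplex_norm_pow n
  rw [integral_undef h] at this
  exact (Nat.factorial_ne_zero n) (by exact_mod_cast this.symm)

instance : IsProbabilityMeasure stdComplex := by
  have h := integral_stdComplex_norm_pow 0
  have hi := integrable_stdComplex_norm_pow 0
  simp only [mul_zero, pow_zero, Nat.factorial_zero, Nat.cast_one] at h hi
  have : IsFiniteMeasure stdComplex := by
    simpa [integrable_const_iff] using hi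
  constructor
  simpa [measureReal_def, ENNReal.toReal_eq_one_iff] using h

lemma memLp_id_stdComplex : MemLp (fun z : ℂ => z) 2 stdComplex := by
  rw [memLp_two_iff_integrable_sq_norm (by fun_prop)]
  simpa using integrable_stdComplex_norm_pow 1

lemma memLp_normSq_stdComplex : MemLp (fun z : ℂ => ‖z‖ ^ 2) 2 stdComplex := by
  rw [memLp_two_iff_integrable_sq (by fun_prop)]
  simpa [← pow_mul] using integrable_stdComplex_norm_pow 2

/-- The density depends on `‖z‖` only and rotations preserve Lebesgue measure. Choosing `u = -1` and
`u = i` makes the first moment and the second non-conjugate moment equal to their negatives. -/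
lemma integral_stdComplex_mul_unit {E : Type*} [NormedAddCommGroup E] [NormedSpace ℝ E]
    (u : Circle) (f : ℂ → E) : ∫ z, f (u * z) ∂stdComplex = ∫ z, f z ∂stdComplex := by
  rw [integral_stdComplex, integral_stdComplex]
  have h := ((rotation u).measurePreserving).integral_comp
    (rotation u).toHomeomorph.measurableEmbedding (fun z => stdDensity z • f z)
  simp only [rotation_apply, stdDensity, norm_mul, Circle.norm_coe, one_mul] at h
  exact h

lemma integral_stdComplex_id : ∫ z, z ∂stdComplex = 0 := by
  have h := integral_stdComplex_mul_unit (-1) (fun z => z)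
  simp only [Circle.coe_neg, Circle.coe_one, neg_mul, one_mul] at h
  rw [integral_neg] at h
  linear_combination (-1 / 2) * h

lemma integral_stdComplex_sq : ∫ z, z ^ 2 ∂stdComplex = 0 := by
  have h := integral_stdComplex_mul_unit (Circle.exp (Real.pi / 2)) (fun z => z ^ 2)
  simp only [Circle.coe_exp, mul_pow, integral_const_mul, ← Complex.exp_nat_mul] at h
  have e : Complex.exp (((2 : ℕ) : ℂ) * (((Real.pi / 2 : ℝ) : ℂ) * Complex.I)) = -1 := by
    rw [← Complex.exp_pi_mul_I]; congr 1; push_cast; ring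
  rw [e] at h
  linear_combination (-1 / 2) * h

lemma integral_stdComplex_mul_conj : ∫ z, z * conj z ∂stdComplex = 1 := by
  have h := integral_stdComplex_norm_pow 1
  have : ∀ z : ℂ, z * conj z = ((‖z‖ ^ (2 * 1) : ℝ) : ℂ) := by
    intro z; rw [Complex.mul_conj, Complex.normSq_eq_norm_sq]
  simp_rw [this]
  rw [integral_complex_ofReal, h]; norm_num

lemma variance_normSq_stdComplex : Var[fun z : ℂ => ‖z‖ ^ 2; stdComplex] = 1 := by
  rw [variance_eq_sub memLp_normSq_stdComplex]
  have h1 := integral_stdComplex_norm_pow 1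
  have h2 := integral_stdComplex_norm_pow 2
  have e : ((fun z : ℂ => ‖z‖ ^ 2) ^ 2) = fun z => ‖z‖ ^ (2 * 2) := by
    funext z; simp [← pow_mul]
  rw [e, h2]
  simp only [mul_one] at h1
  rw [h1]; norm_num [Nat.factorial]

lemma integrable_exp_normSq_stdComplex {ε : ℝ} (hε : ε < 1) :
    Integrable (fun z : ℂ => Real.exp (ε * ‖z‖ ^ 2)) stdComplex := by
  rw [integrable_stdComplex_iff]
  have h := GaussianFourier.integral_rexp_neg_mul_sq_norm (V := ℂ) (b := 1 - ε) (by linarith)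
  -- Integrability is again read off from the known positive value of the integral.
  have hi : Integrable (fun z : ℂ => Real.exp (-(1 - ε) * ‖z‖ ^ 2)) := by
    by_contra hc
    rw [integral_undef hc] at h
    have : 0 < Real.pi / (1 - ε) := div_pos Real.pi_pos (by linarith)
    exact (Real.rpow_pos_of_pos this _).ne h
  refine (hi.const_mul Real.pi⁻¹).congr (ae_of_all _ fun z => ?_)
  simp only [stdDensity, smul_eq_mul]
  rw [div_mul_eq_mul_div, ← Real.exp_add, div_eq_inv_mul]
  congr 2; ring

/-- The characteristic function of the standard complex Gaussian law. -/
lemma charFun_stdComplex (w : ℂ) :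
    ∫ z, Complex.exp (Complex.I * ((conj w * z).re : ℝ)) ∂stdComplex =
      Complex.exp (-((‖w‖ ^ 2 / 4 : ℝ) : ℂ)) := by
  rw [integral_stdComplex]
  have h := GaussianFourier.integral_cexp_neg_mul_sq_norm_add (V := ℂ) (b := 1) (by simp)
    Complex.I w
  have e : ∀ z : ℂ, stdDensity z • Complex.exp (Complex.I * ((conj w * z).re : ℝ)) =
      ((Real.pi⁻¹ : ℝ) : ℂ) *
        Complex.exp (-1 * (‖z‖ : ℂ) ^ 2 + Complex.I * ((inner ℝ w z : ℝ) : ℂ)) := by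
    intro z
    rw [Complex.exp_add, Complex.inner, Complex.real_smul, stdDensity]
    push_cast
    rw [neg_one_mul]
    ring_nf
  simp_rw [e]
  rw [integral_const_mul, h, Complex.finrank_real_complex]
  have : (Real.pi : ℂ) ≠ 0 := by exact_mod_cast Real.pi_ne_zero
  push_cast
  rw [Complex.I_sq]
  norm_num
  rw [neg_div]

/-- The law of independent standard complex Gaussian coordinates. -/
def stdPi (ι : Type*) [Fintype ι] : Measure (ι → ℂ) := Measure.pi fun _ => stdComplex

instance (ι : Type*) [Fintype ι] : IsProbabilityMeasure (stdPi ι) := by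
  unfold stdPi; infer_instance

lemma integrable_stdDensity : Integrable stdDensity := by
  simpa using integrable_stdComplex_iff.1 (integrable_const (μ := stdComplex) (1 : ℝ))

/-- A product of measures with densities has the product density. -/
lemma pi_withDensity_ofReal {ι E : Type*} [Fintype ι] [MeasurableSpace E] {μ : Measure E}
    [SigmaFinite μ] {f : E → ℝ} (hf : Integrable f μ) (h0 : ∀ x, 0 ≤ f x) :
    (Measure.pi fun _ : ι => μ.withDensity fun z => ENNReal.ofReal (f z)) =
      (Measure.pi fun _ => μ).withDensity fun x => ENNReal.ofReal (∏ i, f (x i)) := by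
  -- Integrability of `f` makes each factor finite; uniqueness of the product measure needs σ-finite
  -- factors.
  have : IsFiniteMeasure (μ.withDensity fun z => ENNReal.ofReal (f z)) :=
    isFiniteMeasure_withDensity_ofReal hf.2
  refine Measure.pi_eq fun s hs => ?_
  rw [withDensity_apply _ (MeasurableSet.univ_pi hs), Measure.restrict_pi_pi]
  have h1 : ∀ i, μ.withDensity (fun z => ENNReal.ofReal (f z)) (s i) =
      ENNReal.ofReal (∫ z in s i, f z ∂μ) := by
    intro i
    rw [withDensity_apply _ (hs i), ofReal_integral_eq_lintegral_ofReal
      hf.restrict (ae_of_all _ h0)]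
  simp_rw [h1]
  rw [← ENNReal.ofReal_prod_of_nonneg (fun i _ => integral_nonneg h0),
    ← integral_fintype_prod_eq_prod (fun _ => f), ofReal_integral_eq_lintegral_ofReal]
  · exact Integrable.fintype_prod (fun i => hf.restrict)
  · exact ae_of_all _ fun x => Finset.prod_nonneg fun i _ => h0 _

lemma stdPi_eq_withDensity (ι : Type*) [Fintype ι] :
    stdPi ι = volume.withDensity fun x => ENNReal.ofReal (∏ i, stdDensity (x i)) :=
  pi_withDensity_ofReal integrable_stdDensity stdDensity_nonneg

end ArrayCRB

end

/-! ### Factorization of a positive definite matrix -/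

noncomputable section

namespace ArrayCRB

section
open scoped MatrixOrder Matrix.Norms.L2Operator

/-- In the C*-algebra of matrices a nonnegative element has the form `star B * B`, and `L = Bᴴ`
inherits invertibility from the determinant of the product. -/
lemma exists_factor_of_posDef {ι : Type*} [Fintype ι] [DecidableEq ι] {R : Matrix ι ι ℂ}
    (hR : R.PosDef) : ∃ L : Matrix ι ι ℂ, IsUnit L.det ∧ R = L * Lᴴ := by
  obtain ⟨B, hB⟩ := CStarAlgebra.nonneg_iff_eq_star_mul_self.mp hR.posSemidef.nonneg
  refine ⟨Bᴴ, ?_, by simpa [star_eq_conjTranspose] using hB⟩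
  have := (Matrix.isUnit_iff_isUnit_det _).1 hR.isUnit
  rw [hB, Matrix.det_mul] at this
  exact isUnit_of_mul_isUnit_left this

end

variable {ι : Type*} [Fintype ι]

/-! ### Complex Gaussian vectors as linear images of standard ones -/

lemma star_dotProduct_self_re (x : ι → ℂ) : (star x ⬝ᵥ x).re = ∑ i, ‖x i‖ ^ 2 := by
  simp [dotProduct, Complex.re_sum, ← Complex.normSq_eq_norm_sq, Complex.normSq_apply]

lemma star_mulVec_dotProduct (L M : Matrix ι ι ℂ) (x y : ι → ℂ) :
    star (L *ᵥ x) ⬝ᵥ (M *ᵥ y) = star x ⬝ᵥ ((Lᴴ * M) *ᵥ y) := by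
  rw [star_mulVec, ← dotProduct_mulVec, mulVec_mulVec]

@[fun_prop]
lemma continuous_mulVec_const (L : Matrix ι ι ℂ) : Continuous fun z : ι → ℂ => L *ᵥ z :=
  continuous_const.matrix_mulVec continuous_id

lemma measurePreserving_eval_stdPi (a : ι) :
    MeasurePreserving (Function.eval a) (stdPi ι) stdComplex :=
  measurePreserving_eval (fun _ => stdComplex) a

lemma memLp_eval_stdPi (a : ι) : MemLp (fun z : ι → ℂ => z a) 2 (stdPi ι) :=
  memLp_id_stdComplex.comp_measurePreserving (measurePreserving_eval_stdPi a)

lemma integral_eval_stdPi {E : Type*} [NormedAddCommGroup E] [NormedSpace ℝ E] (a : ι)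
    {f : ℂ → E} (hf : Continuous f) :
    ∫ z, f (z a) ∂(stdPi ι) = ∫ z, f z ∂stdComplex :=
  integral_comp_eval (μ := fun _ : ι => stdComplex) hf.aestronglyMeasurable

lemma indepFun_eval_stdPi {a b : ι} (hab : a ≠ b) {f g : ℂ → ℂ} (hf : Continuous f)
    (hg : Continuous g) : ∫ z, f (z a) * g (z b) ∂(stdPi ι) =
      (∫ z, f z ∂stdComplex) * ∫ z, g z ∂stdComplex := by
  have h := (iIndepFun_pi (μ := fun _ : ι => stdComplex) (X := fun _ z => z)
    (fun _ => aemeasurable_id)).indepFun hab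
  have h2 := h.integral_fun_comp_mul_comp (f := f) (g := g)
    (measurable_pi_apply a).aemeasurable (measurable_pi_apply b).aemeasurable
    hf.aestronglyMeasurable hg.aestronglyMeasurable
  rw [stdPi, h2, ← integral_eval_stdPi a hf, ← integral_eval_stdPi b hg]
  rfl

lemma integral_mul_stdPi (a b : ι) : ∫ z, z a * z b ∂(stdPi ι) = 0 := by
  by_cases h : a = b
  · subst h
    rw [integral_eval_stdPi a (f := fun z => z * z) (by fun_prop)]
    simpa [sq] using integral_stdComplex_sq
  · rw [indepFun_eval_stdPi h (f := fun z => z) (g := fun z => z) (by fun_prop) (by fun_prop),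
      integral_stdComplex_id, zero_mul]

lemma integral_exp_stdPi (w : ι → ℂ) :
    ∫ z, Complex.exp (Complex.I * ((star w ⬝ᵥ z).re : ℝ)) ∂(stdPi ι) =
      Complex.exp (-(((star w ⬝ᵥ w).re / 4 : ℝ) : ℂ)) := by
  have h : ∀ z : ι → ℂ, Complex.exp (Complex.I * ((star w ⬝ᵥ z).re : ℝ)) =
      ∏ i, Complex.exp (Complex.I * ((conj (w i) * z i).re : ℝ)) := by
    intro z
    rw [← Complex.exp_sum, ← Finset.mul_sum, ← Complex.ofReal_sum, ← Complex.re_sum]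
    rfl
  simp_rw [h, stdPi]
  rw [integral_fintype_prod_eq_prod (fun i z => Complex.exp (Complex.I * ((conj (w i) * z).re : ℝ)))]
  simp_rw [charFun_stdComplex]
  rw [← Complex.exp_sum, star_dotProduct_self_re, Finset.sum_div]
  push_cast
  rw [Finset.sum_neg_distrib]

variable [DecidableEq ι]

/-- Substituting `x = L z` turns `xᴴ R⁻¹ x` into `‖z‖²`, and `det R` is `|det L|²`, which is also
the real Jacobian of `L`. -/
lemma cgDensity_factor {L : Matrix ι ι ℂ} (hL : IsUnit L.det) (z : ι → ℂ) :
    cgDensity (L * Lᴴ) (L *ᵥ z) = (Complex.normSq L.det)⁻¹ * ∏ i, stdDensity (z i) := by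
  have h1 : star (L *ᵥ z) ⬝ᵥ ((L * Lᴴ)⁻¹ *ᵥ (L *ᵥ z)) = star z ⬝ᵥ z := by
    have hL' : IsUnit (Lᴴ).det := by rw [det_conjTranspose]; exact hL.star
    rw [mulVec_mulVec, star_mulVec_dotProduct, Matrix.mul_inv_rev, ← Matrix.mul_assoc,
      ← Matrix.mul_assoc, Matrix.mul_nonsing_inv _ hL', Matrix.one_mul,
      Matrix.nonsing_inv_mul _ hL, Matrix.one_mulVec]
  have h2 : (L * Lᴴ).det.re = Complex.normSq L.det := by
    rw [det_mul, det_conjTranspose]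
    change (L.det * conj L.det).re = _
    rw [Complex.mul_conj, Complex.ofReal_re]
  rw [cgDensity, h1, h2, star_dotProduct_self_re]
  simp only [stdDensity]
  rw [Finset.prod_div_distrib, ← Real.exp_sum, Finset.sum_neg_distrib]
  simp
  field_simp

@[fun_prop]
lemma continuous_cgDensity (R : Matrix ι ι ℂ) : Continuous (cgDensity R) := by
  unfold cgDensity
  have : Continuous fun x : ι → ℂ => star x ⬝ᵥ (R⁻¹ *ᵥ x) :=
    continuous_star.dotProduct (continuous_const.matrix_mulVec continuous_id)
  fun_prop

/-- Seen as a real linear map, `L` has determinant equal to the norm from `ℂ` to `ℝ` of its complex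
determinant, hence `|det L|²`. -/
lemma map_mulVec_volume {L : Matrix ι ι ℂ} (hL : IsUnit L.det) :
    (volume : Measure (ι → ℂ)).map (L *ᵥ ·) =
      ENNReal.ofReal (Complex.normSq L.det)⁻¹ • volume := by
  have hdet : LinearMap.det ((Matrix.toLin' L).restrictScalars ℝ) = Complex.normSq L.det := by
    rw [LinearMap.det_restrictScalars, Algebra.norm_complex_apply, LinearMap.det_toLin']
  have hne : Complex.normSq L.det ≠ 0 := by simpa using hL.ne_zero
  have := Measure.map_linearMap_addHaar_eq_smul_addHaar (volume : Measure (ι → ℂ))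
    (f := (Matrix.toLin' L).restrictScalars ℝ) (by rw [hdet]; exact hne)
  rw [hdet, abs_of_nonneg (inv_nonneg.2 (Complex.normSq_nonneg _))] at this
  exact this

/-- The bridge used for every property of `CN(0, R)`: the Jacobian of `L` cancels the determinant in
the density. -/
lemma complexGaussian_factor {L : Matrix ι ι ℂ} (hL : IsUnit L.det) :
    complexGaussian (L * Lᴴ) = (stdPi ι).map (L *ᵥ ·) := by
  have hpos : 0 < Complex.normSq L.det := Complex.normSq_pos.2 hL.ne_zero
  have hm : Measurable fun z : ι → ℂ => L *ᵥ z := (continuous_mulVec_const L).measurable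
  have hvol : (volume : Measure (ι → ℂ)) =
      ENNReal.ofReal (Complex.normSq L.det) • (volume : Measure (ι → ℂ)).map (L *ᵥ ·) := by
    rw [map_mulVec_volume hL, smul_smul, ← ENNReal.ofReal_mul hpos.le, mul_inv_cancel₀ hpos.ne']
    simp
  ext s hs
  rw [complexGaussian, withDensity_apply _ hs, Measure.map_apply hm hs, stdPi_eq_withDensity,
    withDensity_apply _ (hm hs)]
  conv_lhs => rw [hvol]
  rw [Measure.restrict_smul, lintegral_smul_measure,
    setLIntegral_map hs (by fun_prop) hm, smul_eq_mul, ← lintegral_const_mul']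
  · refine lintegral_congr fun z => ?_
    rw [cgDensity_factor hL, ← ENNReal.ofReal_mul hpos.le, ← mul_assoc,
      mul_inv_cancel₀ hpos.ne', one_mul]
  · simp

lemma isProbabilityMeasure_complexGaussian {R : Matrix ι ι ℂ} (hR : R.PosDef) :
    IsProbabilityMeasure (complexGaussian R) := by
  obtain ⟨L, hL, rfl⟩ := exists_factor_of_posDef hR
  rw [complexGaussian_factor hL]
  exact Measure.isProbabilityMeasure_map (by fun_prop)

/-! ### Characteristic function -/

/-- The factor `1/4` arises because circularity gives `Re (wᴴ x)` only half of the variance `wᴴ R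
w`, and a Gaussian characteristic function halves it again. -/
lemma integral_exp_complexGaussian {R : Matrix ι ι ℂ} (hR : R.PosDef) (w : ι → ℂ) :
    ∫ x, Complex.exp (Complex.I * ((star w ⬝ᵥ x).re : ℝ)) ∂(complexGaussian R) =
      Complex.exp (-(((star w ⬝ᵥ (R *ᵥ w)).re / 4 : ℝ) : ℂ)) := by
  obtain ⟨L, hL, rfl⟩ := exists_factor_of_posDef hR
  rw [complexGaussian_factor hL, integral_map (by fun_prop)]
  · have h : ∀ z, star w ⬝ᵥ (L *ᵥ z) = star (Lᴴ *ᵥ w) ⬝ᵥ z := by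
      intro z
      rw [star_mulVec, ← dotProduct_mulVec, conjTranspose_conjTranspose]
    simp_rw [h]
    rw [integral_exp_stdPi, star_mulVec_dotProduct, conjTranspose_conjTranspose]
  · have : Continuous fun x : ι → ℂ => star w ⬝ᵥ x := continuous_const.dotProduct continuous_id
    exact (by fun_prop : Continuous _).aestronglyMeasurable

/-! ### Second moments -/

lemma integral_mul_conj_stdPi (a b : ι) :
    ∫ z, z a * conj (z b) ∂(stdPi ι) = if a = b then 1 else 0 := by
  split_ifs with h
  · subst h
    rw [integral_eval_stdPi a (f := fun z => z * conj z) (by fun_prop), integral_stdComplex_mul_conj]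
  · rw [indepFun_eval_stdPi h (f := fun z => z) (g := fun z => conj z) (by fun_prop) (by fun_prop),
      integral_stdComplex_id, zero_mul]

section Moments
variable {R : Matrix ι ι ℂ} (hR : R.PosDef)
include hR

lemma memLp_eval_complexGaussian (m : ι) : MemLp (fun x : ι → ℂ => x m) 2 (complexGaussian R) := by
  obtain ⟨L, hL, rfl⟩ := exists_factor_of_posDef hR
  rw [complexGaussian_factor hL, memLp_map_measure_iff
    (by exact (continuous_apply m).aestronglyMeasurable) (by fun_prop)]
  simp only [Function.comp_def, mulVec, dotProduct]
  exact memLp_finsetSum _ fun a _ => (memLp_eval_stdPi a).const_mul _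

lemma integral_eval_complexGaussian (m : ι) : ∫ x, x m ∂(complexGaussian R) = 0 := by
  obtain ⟨L, hL, rfl⟩ := exists_factor_of_posDef hR
  rw [complexGaussian_factor hL, integral_map (by fun_prop)
    (by exact (continuous_apply m).aestronglyMeasurable)]
  simp only [mulVec, dotProduct]
  rw [integral_finsetSum _
    fun a _ => ((memLp_eval_stdPi a).integrable (by norm_num)).const_mul _]
  refine Finset.sum_eq_zero fun a _ => ?_
  rw [integral_const_mul, integral_eval_stdPi a (f := fun z => z) (by fun_prop),
    integral_stdComplex_id, mul_zero]

lemma integral_mul_conj_complexGaussian (m n : ι) :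
    ∫ x, x m * conj (x n) ∂(complexGaussian R) = R m n := by
  obtain ⟨L, hL, rfl⟩ := exists_factor_of_posDef hR
  rw [complexGaussian_factor hL, integral_map (by fun_prop)
    (by exact (by fun_prop : Continuous _).aestronglyMeasurable)]
  have hi : ∀ a b, Integrable (fun z : ι → ℂ => z a * conj (z b)) (stdPi ι) := fun a b =>
    (memLp_eval_stdPi a).integrable_mul (memLp_eval_stdPi b).star
  have e : ∀ z : ι → ℂ, (L *ᵥ z) m * conj ((L *ᵥ z) n) =
      ∑ a, ∑ b, L m a * conj (L n b) * (z a * conj (z b)) := by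
    intro z
    simp only [mulVec, dotProduct, map_sum, map_mul, Finset.sum_mul_sum]
    exact Finset.sum_congr rfl fun a _ => Finset.sum_congr rfl fun b _ => by ring
  simp_rw [e]
  rw [integral_finsetSum _ fun a _ => integrable_finsetSum _ fun b _ => (hi a b).const_mul _]
  simp_rw [integral_finsetSum _ fun b _ => (hi _ b).const_mul _, integral_const_mul,
    integral_mul_conj_stdPi]
  simp [Matrix.mul_apply]

lemma integral_mul_complexGaussian (m n : ι) :
    ∫ x, x m * x n ∂(complexGaussian R) = 0 := by
  obtain ⟨L, hL, rfl⟩ := exists_factor_of_posDef hR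
  rw [complexGaussian_factor hL, integral_map (by fun_prop)
    (by exact (by fun_prop : Continuous _).aestronglyMeasurable)]
  have hi : ∀ a b, Integrable (fun z : ι → ℂ => z a * z b) (stdPi ι) := fun a b =>
    (memLp_eval_stdPi a).integrable_mul (memLp_eval_stdPi b)
  have e : ∀ z : ι → ℂ, (L *ᵥ z) m * (L *ᵥ z) n =
      ∑ a, ∑ b, L m a * L n b * (z a * z b) := by
    intro z
    simp only [mulVec, dotProduct, Finset.sum_mul_sum]
    exact Finset.sum_congr rfl fun a _ => Finset.sum_congr rfl fun b _ => by ring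
  simp_rw [e]
  rw [integral_finsetSum _ fun a _ => integrable_finsetSum _ fun b _ => (hi a b).const_mul _]
  simp_rw [integral_finsetSum _ fun b _ => (hi _ b).const_mul _, integral_const_mul,
    integral_mul_stdPi]
  simp

end Moments

end ArrayCRB

end

noncomputable section

namespace ArrayCRB

/-! ### Hermitian quadratic forms of complex Gaussian vectors -/

section QuadForm
variable {ι : Type*} [Fintype ι]

/-- The real part of `xᴴ A x`. -/
def quadForm (A : Matrix ι ι ℂ) (x : ι → ℂ) : ℝ := (star x ⬝ᵥ (A *ᵥ x)).re

@[fun_prop]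
lemma continuous_quadForm (A : Matrix ι ι ℂ) : Continuous (quadForm A) := by
  unfold quadForm
  have : Continuous fun x : ι → ℂ => star x ⬝ᵥ (A *ᵥ x) :=
    continuous_star.dotProduct (continuous_mulVec_const A)
  fun_prop

lemma quadForm_mulVec (A L : Matrix ι ι ℂ) (z : ι → ℂ) :
    quadForm A (L *ᵥ z) = quadForm (Lᴴ * A * L) z := by
  rw [quadForm, quadForm, mulVec_mulVec, star_mulVec_dotProduct, Matrix.mul_assoc]

lemma quadForm_add (A B : Matrix ι ι ℂ) (x : ι → ℂ) :
    quadForm (A + B) x = quadForm A x + quadForm B x := by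
  simp [quadForm, add_mulVec, dotProduct_add]

variable [DecidableEq ι]

lemma quadForm_diagonal (c : ι → ℝ) (z : ι → ℂ) :
    quadForm (diagonal fun i => (c i : ℂ)) z = ∑ i, c i * ‖z i‖ ^ 2 := by
  simp only [quadForm, dotProduct, mulVec_diagonal, Complex.re_sum]
  refine Finset.sum_congr rfl fun i _ => ?_
  rw [← Complex.normSq_eq_norm_sq, Complex.normSq_apply]
  simp
  ring

/-- Both `U` and `1` factor the identity covariance, so the two images of the standard law are the
same Gaussian law. -/
lemma map_unitary_stdPi {U : Matrix ι ι ℂ} (hU : U * Uᴴ = 1) :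
    (stdPi ι).map (U *ᵥ ·) = stdPi ι := by
  have hd : IsUnit U.det := by
    have := congrArg Matrix.det hU
    rw [det_mul, det_one] at this
    exact IsUnit.of_mul_eq_one _ this
  rw [← complexGaussian_factor hd, hU]
  have := complexGaussian_factor (ι := ι) (L := 1) (by simp)
  simpa using this

lemma quadForm_stdPi_diagonal (c : ι → ℝ) :
    MemLp (quadForm (diagonal fun i => (c i : ℂ))) 2 (stdPi ι) ∧
    ∫ z, quadForm (diagonal fun i => (c i : ℂ)) z ∂(stdPi ι) = ∑ i, c i ∧
    Var[quadForm (diagonal fun i => (c i : ℂ)); stdPi ι] = ∑ i, c i ^ 2 := by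
  have e : quadForm (diagonal fun i => (c i : ℂ)) =
      ∑ i, fun z : ι → ℂ => c i * ‖z i‖ ^ 2 := by
    funext z; rw [quadForm_diagonal, Finset.sum_apply]
  have hm : ∀ i, MemLp (fun z : ℂ => c i * ‖z‖ ^ 2) 2 stdComplex :=
    fun i => memLp_normSq_stdComplex.const_mul _
  have hm' : ∀ i, MemLp (fun z : ι → ℂ => c i * ‖z i‖ ^ 2) 2 (stdPi ι) := fun i =>
    (hm i).comp_measurePreserving (measurePreserving_eval_stdPi i)
  rw [e]
  refine ⟨memLp_finsetSum' _ fun i _ => hm' i, ?_, ?_⟩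
  · simp only [Finset.sum_apply]
    rw [integral_finsetSum _ fun i _ => (hm' i).integrable (by norm_num)]
    refine Finset.sum_congr rfl fun i _ => ?_
    rw [integral_eval_stdPi i (f := fun z => c i * ‖z‖ ^ 2) (by fun_prop), integral_const_mul]
    have := integral_stdComplex_norm_pow 1
    simp only [mul_one] at this
    rw [this]; simp
  · rw [stdPi, variance_sum_pi (X := fun i (z : ℂ) => c i * ‖z‖ ^ 2) hm]
    refine Finset.sum_congr rfl fun i _ => ?_
    rw [variance_const_mul, variance_normSq_stdComplex, mul_one]

/-- A unitary change of coordinates preserves the law and diagonalizes `H`. What remains is a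
weighted sum of independent variables `‖z_i‖²` of mean and variance `1`, so the moments are the sum
of the eigenvalues and the sum of their squares. -/
lemma quadForm_stdPi {H : Matrix ι ι ℂ} (hH : H.IsHermitian) :
    MemLp (quadForm H) 2 (stdPi ι) ∧
    ∫ z, quadForm H z ∂(stdPi ι) = H.trace.re ∧
    Var[quadForm H; stdPi ι] = (H * H).trace.re := by
  obtain ⟨U, c, hU, hU', hs⟩ : ∃ (U : Matrix ι ι ℂ) (c : ι → ℝ), U * Uᴴ = 1 ∧ Uᴴ * U = 1 ∧
      H = U * diagonal (fun i => (c i : ℂ)) * Uᴴ :=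
    ⟨hH.eigenvectorUnitary.1, hH.eigenvalues,
      Unitary.mul_star_self_of_mem hH.eigenvectorUnitary.2,
      Unitary.star_mul_self_of_mem hH.eigenvectorUnitary.2, hH.spectral_theorem⟩
  set D : Matrix ι ι ℂ := diagonal (fun i => (c i : ℂ)) with hD
  have hD' : Uᴴ * H * U = D := by
    rw [hs]
    calc Uᴴ * (U * D * Uᴴ) * U = (Uᴴ * U) * D * (Uᴴ * U) := by simp only [Matrix.mul_assoc]
      _ = D := by rw [hU']; simp
  have hcomp : quadForm H ∘ (U *ᵥ ·) = quadForm D := by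
    funext z; rw [Function.comp_apply, quadForm_mulVec, hD']
  have ht : H.trace = ∑ i, (c i : ℂ) := by
    rw [hs, Matrix.trace_mul_comm, ← Matrix.mul_assoc, hU', Matrix.one_mul, hD, trace_diagonal]
  have ht2 : (H * H).trace = ∑ i, (c i : ℂ) ^ 2 := by
    have : H * H = U * (D * D) * Uᴴ := by
      rw [hs]
      calc U * D * Uᴴ * (U * D * Uᴴ) = U * D * (Uᴴ * U) * D * Uᴴ := by simp only [Matrix.mul_assoc]
        _ = _ := by rw [hU']; simp [Matrix.mul_assoc]
    rw [this, Matrix.trace_mul_comm, ← Matrix.mul_assoc, hU', Matrix.one_mul, hD,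
      diagonal_mul_diagonal, trace_diagonal]
    simp [sq]
  obtain ⟨h1, h2, h3⟩ := quadForm_stdPi_diagonal c
  have hmp : MeasurePreserving (U *ᵥ ·) (stdPi ι) (stdPi ι) :=
    ⟨(continuous_mulVec_const U).measurable, map_unitary_stdPi hU⟩
  refine ⟨?_, ?_, ?_⟩
  · rw [← map_unitary_stdPi hU, memLp_map_measure_iff
      (continuous_quadForm H).aestronglyMeasurable (by fun_prop), hcomp]
    exact h1
  · conv_lhs => rw [← map_unitary_stdPi hU]
    rw [integral_map (by fun_prop) (continuous_quadForm H).aestronglyMeasurable]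
    change ∫ z, (quadForm H ∘ (U *ᵥ ·)) z ∂_ = _
    rw [hcomp, h2, ht, ← Complex.ofReal_sum, Complex.ofReal_re]
  · conv_lhs => rw [← map_unitary_stdPi hU]
    rw [variance_map (continuous_quadForm H).aemeasurable (by fun_prop), hcomp, h3, ht2]
    norm_cast

/-- Mean and variance of a Hermitian form of a complex Gaussian vector. -/
lemma quadForm_complexGaussian {R A : Matrix ι ι ℂ} (hR : R.PosDef) (hA : A.IsHermitian) :
    MemLp (quadForm A) 2 (complexGaussian R) ∧
    ∫ x, quadForm A x ∂(complexGaussian R) = (A * R).trace.re ∧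
    Var[quadForm A; complexGaussian R] = (A * R * A * R).trace.re := by
  obtain ⟨L, hL, rfl⟩ := exists_factor_of_posDef hR
  rw [complexGaussian_factor hL]
  obtain ⟨h1, h2, h3⟩ := quadForm_stdPi (H := Lᴴ * A * L) (isHermitian_conjTranspose_mul_mul L hA)
  have hcomp : quadForm A ∘ (L *ᵥ ·) = quadForm (Lᴴ * A * L) := by
    funext z; rw [Function.comp_apply, quadForm_mulVec]
  refine ⟨?_, ?_, ?_⟩
  · rw [memLp_map_measure_iff (continuous_quadForm A).aestronglyMeasurable (by fun_prop), hcomp]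
    exact h1
  · rw [integral_map (by fun_prop) (continuous_quadForm A).aestronglyMeasurable]
    change ∫ z, (quadForm A ∘ (L *ᵥ ·)) z ∂_ = _
    rw [hcomp, h2, Matrix.mul_assoc, Matrix.trace_mul_comm, Matrix.mul_assoc]
  · rw [variance_map (continuous_quadForm A).aemeasurable (by fun_prop), hcomp, h3]
    congr 1
    rw [show Lᴴ * A * L * (Lᴴ * A * L) = Lᴴ * (A * L * (Lᴴ * A * L)) by
      simp only [Matrix.mul_assoc], Matrix.trace_mul_comm]
    simp only [Matrix.mul_assoc]

/-- This small exponential moment later dominates the likelihood ratios of nearby parameters. -/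
lemma integrable_exp_complexGaussian {R : Matrix ι ι ℂ} (hR : R.PosDef) :
    ∃ ε > 0, Integrable (fun x : ι → ℂ => Real.exp (ε * ∑ i, ‖x i‖ ^ 2)) (complexGaussian R) := by
  obtain ⟨L, hL, rfl⟩ := exists_factor_of_posDef hR
  rw [complexGaussian_factor hL]
  obtain ⟨C, hC, hbound⟩ : ∃ C > 0, ∀ z : ι → ℂ, ∑ i, ‖(L *ᵥ z) i‖ ^ 2 ≤ C * ∑ i, ‖z i‖ ^ 2 := by
    refine ⟨∑ i, ∑ j, ‖L i j‖ ^ 2 + 1, by positivity, fun z => ?_⟩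
    have : ∀ i, ‖(L *ᵥ z) i‖ ^ 2 ≤ (∑ j, ‖L i j‖ ^ 2) * ∑ j, ‖z j‖ ^ 2 := by
      intro i
      have h1 : ‖(L *ᵥ z) i‖ ≤ ∑ j, ‖L i j‖ * ‖z j‖ := by
        refine (norm_sum_le _ _).trans (le_of_eq ?_)
        simp
      exact (pow_le_pow_left₀ (norm_nonneg _) h1 2).trans (Finset.sum_mul_sq_le_sq_mul_sq _ _ _)
    refine (Finset.sum_le_sum fun i _ => this i).trans ?_
    rw [← Finset.sum_mul]
    gcongr
    linarith
  -- With this choice the exponent is at most `‖z‖² / 2`, and `1/2 < 1` is in the range of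
  -- integrability for the standard law.
  refine ⟨1 / (2 * C), by positivity, ?_⟩
  have hc : Continuous fun x : ι → ℂ => Real.exp (1 / (2 * C) * ∑ i, ‖x i‖ ^ 2) := by fun_prop
  rw [integrable_map_measure hc.aestronglyMeasurable (by fun_prop)]
  have hi : Integrable (fun z : ι → ℂ => ∏ i, Real.exp (1 / 2 * ‖z i‖ ^ 2)) (stdPi ι) :=
    Integrable.fintype_prod fun i => integrable_exp_normSq_stdComplex (by norm_num)
  refine hi.mono' (hc.comp (continuous_mulVec_const L)).aestronglyMeasurable
    (ae_of_all _ fun z => ?_)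
  rw [← Real.exp_sum, ← Finset.mul_sum, Function.comp_apply, Real.norm_eq_abs, Real.abs_exp]
  refine Real.exp_le_exp.2 ?_
  calc 1 / (2 * C) * ∑ i, ‖(L *ᵥ z) i‖ ^ 2 ≤ 1 / (2 * C) * (C * ∑ i, ‖z i‖ ^ 2) := by
        gcongr; exact hbound z
    _ = 1 / 2 * ∑ i, ‖z i‖ ^ 2 := by field_simp

end QuadForm

end ArrayCRB

end

noncomputable section

namespace ArrayCRB

/-! ### First-order expansion of the manifold -/

lemma axial_add (θ t a b : ℝ) :
    axial (θ + t) a b = axial θ a b * Real.cos t + transverse θ a b * Real.sin t := by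
  simp only [axial, transverse, Real.cos_add, Real.sin_add]; ring

lemma isBigO_cos_sub_one : (fun x : ℝ => Real.cos x - 1) =O[𝓝 0] fun x => x ^ 2 := by
  refine IsBigO.of_bound 1 (Eventually.of_forall fun x => ?_)
  have h1 := Real.one_sub_sq_div_two_le_cos (x := x)
  have h2 := Real.cos_le_one x
  rw [Real.norm_eq_abs, abs_of_nonpos (by linarith), Real.norm_eq_abs, abs_of_nonneg (sq_nonneg x)]
  nlinarith [sq_nonneg x]

lemma isBigO_sin_sub_self : (fun x : ℝ => Real.sin x - x) =O[𝓝 0] fun x => x ^ 2 := by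
  refine IsBigO.of_bound 1 ?_
  have : ∀ᶠ x : ℝ in 𝓝 0, |x| < 1 := by
    have := Metric.ball_mem_nhds (0 : ℝ) one_pos
    filter_upwards [this] with x hx
    simpa using hx
  filter_upwards [this] with x hx
  have h := Real.sin_bound hx.le
  have h3 : |x - x ^ 3 / 6 - x| = |x| ^ 3 / 6 := by
    rw [show x - x ^ 3 / 6 - x = -(x ^ 3 / 6) by ring, abs_neg, abs_div, abs_pow]
    norm_num
  have h4 : |x| ^ 5 ≤ |x| ^ 2 := pow_le_pow_of_le_one (abs_nonneg x) hx.le (by norm_num)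
  have h4' : |x| ^ 3 ≤ |x| ^ 2 := pow_le_pow_of_le_one (abs_nonneg x) hx.le (by norm_num)
  have h5 := abs_add_le (Real.sin x - (x - x ^ 3 / 6)) (x - x ^ 3 / 6 - x)
  rw [show Real.sin x - (x - x ^ 3 / 6) + (x - x ^ 3 / 6 - x) = Real.sin x - x by ring] at h5
  have h6 : 0 ≤ |x| ^ 2 := by positivity
  rw [Real.norm_eq_abs, Real.norm_eq_abs, abs_pow]
  linarith

/-- By the addition formulas the error is a combination of `cos s cos t - 1`, `cos s sin t - t`,
`sin s cos t - s` and `sin s sin t`, with `(t, s)` the deviations. Each is of second order; these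
are `e1` to `e4`. -/
lemma isBigO_phase (κ θ φ a b : ℝ) :
    (fun δ : ℝ × ℝ => κ * Real.sin (φ + δ.2) * axial (θ + δ.1) a b -
      (κ * Real.sin φ * axial θ a b + κ * δ.2 * Real.cos φ * axial θ a b +
        κ * δ.1 * Real.sin φ * transverse θ a b)) =O[𝓝 0] fun δ => ‖δ‖ ^ 2 := by
  have t1 : Tendsto (fun δ : ℝ × ℝ => δ.1) (𝓝 0) (𝓝 0) := continuous_fst.tendsto' _ _ rfl
  have t2 : Tendsto (fun δ : ℝ × ℝ => δ.2) (𝓝 0) (𝓝 0) := continuous_snd.tendsto' _ _ rfl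
  have b1 : (fun δ : ℝ × ℝ => δ.1) =O[𝓝 0] fun δ => ‖δ‖ :=
    IsBigO.of_bound 1 (Eventually.of_forall fun δ => by simpa using norm_fst_le δ)
  have b2 : (fun δ : ℝ × ℝ => δ.2) =O[𝓝 0] fun δ => ‖δ‖ :=
    IsBigO.of_bound 1 (Eventually.of_forall fun δ => by simpa using norm_snd_le δ)
  have c1 := (isBigO_cos_sub_one.comp_tendsto t1).trans (b1.pow 2)
  have c2 := (isBigO_cos_sub_one.comp_tendsto t2).trans (b2.pow 2)
  have s1 := (isBigO_sin_sub_self.comp_tendsto t1).trans (b1.pow 2)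
  have s2 := (isBigO_sin_sub_self.comp_tendsto t2).trans (b2.pow 2)
  have bdd : ∀ f : ℝ × ℝ → ℝ, (∀ δ, |f δ| ≤ 1) → f =O[𝓝 0] fun _ => (1 : ℝ) := fun f hf =>
    IsBigO.of_bound 1 (Eventually.of_forall fun δ => by simpa using hf δ)
  have hC := bdd (fun δ => Real.cos δ.1) fun δ => Real.abs_cos_le_one _
  have hS := bdd (fun δ => Real.sin δ.1) fun δ => Real.abs_sin_le_one _
  have hs := bdd (fun δ => Real.sin δ.2) fun δ => Real.abs_sin_le_one _
  have bs1 : (fun δ : ℝ × ℝ => Real.sin δ.1) =O[𝓝 0] fun δ => ‖δ‖ :=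
    IsBigO.of_bound 1 (Eventually.of_forall fun δ => by
      simpa using (Real.abs_sin_le_abs).trans (norm_fst_le δ))
  have bs2 : (fun δ : ℝ × ℝ => Real.sin δ.2) =O[𝓝 0] fun δ => ‖δ‖ :=
    IsBigO.of_bound 1 (Eventually.of_forall fun δ => by
      simpa using (Real.abs_sin_le_abs).trans (norm_snd_le δ))
  have e1 := ((c2.mul hC).trans (by simpa using isBigO_refl _ _)).add c1
  have e2 := ((c2.mul hS).trans (by simpa using isBigO_refl _ _)).add s1
  have e3 := ((c1.mul hs).trans (by simpa using isBigO_refl _ _)).add s2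
  have e4 : (fun δ : ℝ × ℝ => Real.sin δ.2 * Real.sin δ.1) =O[𝓝 0] fun δ => ‖δ‖ ^ 2 := by
    simpa [sq] using bs2.mul bs1
  have := (((e1.const_mul_left (κ * Real.sin φ * axial θ a b)).add
    (e2.const_mul_left (κ * Real.sin φ * transverse θ a b))).add
    (e3.const_mul_left (κ * Real.cos φ * axial θ a b))).add
    (e4.const_mul_left (κ * Real.cos φ * transverse θ a b))
  refine this.congr_left fun δ => ?_
  simp only [Function.comp_apply, axial_add, Real.sin_add]
  ring

lemma isBigO_manifold_sub_approx {Mx My : ℕ} (κ θ φ : ℝ) (m : Antenna Mx My) :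
    (fun δ : ℝ × ℝ => manifold κ (θ + δ.1) (φ + δ.2) m - manifoldApprox κ θ φ δ.1 δ.2 m)
      =O[𝓝 0] (fun δ => ‖δ‖ ^ 2) := by
  refine IsBigO.trans (IsBigO.of_bound 1 (Eventually.of_forall fun δ => ?_))
    (isBigO_phase κ θ φ (posX m) (posY m))
  rw [manifold, manifoldApprox, ← Complex.exp_add, ← Complex.exp_add, ← mul_add, ← mul_add,
    ← Complex.ofReal_add, ← Complex.ofReal_add]
  set x := κ * Real.sin (φ + δ.2) * axial (θ + δ.1) (posX m) (posY m)
  set y := κ * Real.sin φ * axial θ (posX m) (posY m) +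
    κ * δ.2 * Real.cos φ * axial θ (posX m) (posY m) +
    κ * δ.1 * Real.sin φ * transverse θ (posX m) (posY m)
  -- Factoring out a unimodular number reduces the claim to `|exp(i r) - 1| ≤ |r|`, so the error of
  -- the response is at most that of the phase.
  have : Complex.exp (Complex.I * (x : ℂ)) - Complex.exp (Complex.I * (y : ℂ)) =
      Complex.exp (Complex.I * (y : ℂ)) * (Complex.exp (Complex.I * ((x - y : ℝ) : ℂ)) - 1) := by
    rw [mul_sub, ← Complex.exp_add]; push_cast; ring_nf
  rw [this, norm_mul, mul_comm Complex.I (y : ℂ), Complex.norm_exp_ofReal_mul_I]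
  exact mul_le_mul_of_nonneg_left Real.norm_exp_I_mul_ofReal_sub_one_le zero_le_one

/-! ### Second moments of the approximate response -/

section Response
variable {Mx My K : ℕ} (κ : ℝ) (ξ : Param K)

/-- Law of the angular deviations of a path of user `k`. -/
def devLaw (k : Fin K) : Measure (ℝ × ℝ) :=
  (gaussianReal 0 (Real.toNNReal (azimSpread ξ k ^ 2))).prod
    (gaussianReal 0 (Real.toNNReal (elevSpread ξ k ^ 2)))

instance (k : Fin K) : IsProbabilityMeasure (devLaw ξ k) := by unfold devLaw; infer_instance

/-- Approximate array response to user `k` at deviations `p`. -/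
def response (k : Fin K) (m : Antenna Mx My) (p : ℝ × ℝ) : ℂ :=
  manifoldApprox κ (azim ξ k) (elev ξ k) p.1 p.2 m

@[fun_prop]
lemma continuous_response (k : Fin K) (m : Antenna Mx My) : Continuous (response κ ξ k m) := by
  unfold response manifoldApprox; fun_prop

lemma norm_response (k : Fin K) (m : Antenna Mx My) (p : ℝ × ℝ) : ‖response κ ξ k m p‖ = 1 := by
  simp only [response, manifoldApprox, norm_mul, mul_comm Complex.I, Complex.norm_exp_ofReal_mul_I,
    mul_one]

/-- Covariance contribution `𝐃_k 𝐁_k 𝐃_kᴴ` of a user of unit power. -/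
def userCov (k : Fin K) : Matrix (Antenna Mx My) (Antenna Mx My) ℂ :=
  matD κ ξ k * matB κ ξ k * (matD κ ξ k)ᴴ

lemma userCov_apply (k : Fin K) (m n : Antenna Mx My) :
    userCov κ ξ k m n =
      manifold κ (azim ξ k) (elev ξ k) m * matB κ ξ k m n *
        conj (manifold κ (azim ξ k) (elev ξ k) n) := by
  rw [userCov, matD, diagonal_conjTranspose, mul_diagonal, diagonal_mul]; rfl

lemma integral_exp_gaussianReal (σ t : ℝ) :
    ∫ x, Complex.exp (Complex.I * ((x * t : ℝ) : ℂ)) ∂(gaussianReal 0 (Real.toNNReal (σ ^ 2))) =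
      ((Real.exp (-(σ ^ 2 * t ^ 2 / 2)) : ℝ) : ℂ) := by
  have h := charFun_gaussianReal (μ := 0) (v := Real.toNNReal (σ ^ 2)) t
  rw [charFun_apply_real] at h
  rw [Complex.ofReal_exp]
  convert h using 2
  · funext x; congr 1; push_cast; ring
  · rw [Real.coe_toNNReal _ (sq_nonneg σ)]; push_cast; ring

/-- The reason for linearizing the phase: the phase difference of two antennas is then linear in the
independent Gaussian deviations, so its expectation is a product of two Gaussian characteristic
functions, and this product is the entry of `𝐁_k`. -/
lemma integral_response_mul_conj (k : Fin K) (m n : Antenna Mx My) :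
    ∫ p, response κ ξ k m p * conj (response κ ξ k n p) ∂(devLaw ξ k) =
      userCov κ ξ k m n := by
  have e : ∀ p : ℝ × ℝ, response κ ξ k m p * conj (response κ ξ k n p) =
      manifold κ (azim ξ k) (elev ξ k) m * conj (manifold κ (azim ξ k) (elev ξ k) n) *
      (Complex.exp (Complex.I * ((p.1 * (κ * Real.sin (elev ξ k) *
        transverseDiff (azim ξ k) m n) : ℝ) : ℂ)) *
      Complex.exp (Complex.I * ((p.2 * (κ * Real.cos (elev ξ k) *
        axialDiff (azim ξ k) m n) : ℝ) : ℂ))) := by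
    intro p
    simp only [response, manifoldApprox, manifold, map_mul, map_add, ← Complex.exp_conj,
      Complex.conj_I, Complex.conj_ofReal, ← Complex.exp_add]
    congr 1
    simp only [transverseDiff, axialDiff, transverse, axial]
    push_cast
    ring
  simp_rw [e]
  rw [integral_const_mul, devLaw, integral_prod_mul
    (fun x : ℝ => Complex.exp (Complex.I * ((x * (κ * Real.sin (elev ξ k) *
        transverseDiff (azim ξ k) m n) : ℝ) : ℂ)))
    (fun x : ℝ => Complex.exp (Complex.I * ((x * (κ * Real.cos (elev ξ k) *
        axialDiff (azim ξ k) m n) : ℝ) : ℂ))),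
    integral_exp_gaussianReal, integral_exp_gaussianReal, userCov_apply, ← Complex.ofReal_mul,
    ← Real.exp_add, matB, Matrix.of_apply]
  rw [mul_right_comm]
  congr 4
  ring

/-- As an average of rank-one matrices `ã ãᴴ`, it has quadratic form `E |xᴴ ã|² ≥ 0`. -/
lemma posSemidef_userCov (k : Fin K) :
    (userCov κ ξ k : Matrix (Antenna Mx My) (Antenna Mx My) ℂ).PosSemidef := by
  have hi : ∀ m n : Antenna Mx My, Integrable
      (fun p => response κ ξ k m p * conj (response κ ξ k n p)) (devLaw ξ k) := fun m n =>
    Integrable.of_bound (by fun_prop) 1 (ae_of_all _ fun p => by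
      simp [norm_response])
  refine Matrix.PosSemidef.of_dotProduct_mulVec_nonneg ?_ fun x => ?_
  · ext m n
    rw [conjTranspose_apply, ← integral_response_mul_conj, ← integral_response_mul_conj]
    change conj _ = _
    rw [← integral_conj]
    simp [mul_comm]
  · have : star x ⬝ᵥ (userCov κ ξ k *ᵥ x) =
        ∫ p, ((‖∑ m, conj (x m) * response κ ξ k m p‖ ^ 2 : ℝ) : ℂ) ∂(devLaw ξ k) := by
      have e : ∀ p, ((‖∑ m, conj (x m) * response κ ξ k m p‖ ^ 2 : ℝ) : ℂ) =
          ∑ m, ∑ n, conj (x m) * x n *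
            (response κ ξ k m p * conj (response κ ξ k n p)) := by
        intro p
        rw [Complex.ofReal_pow, ← Complex.mul_conj', map_sum, Finset.sum_mul_sum]
        refine Finset.sum_congr rfl fun m _ => Finset.sum_congr rfl fun n _ => ?_
        simp only [map_mul, Complex.conj_conj]; ring
      simp_rw [e]
      rw [integral_finsetSum _ fun m _ => integrable_finsetSum _ fun n _ => (hi m n).const_mul _]
      simp_rw [integral_finsetSum _ fun n _ => (hi _ n).const_mul _, integral_const_mul,
        integral_response_mul_conj]
      simp only [dotProduct, mulVec, Finset.mul_sum]
      refine Finset.sum_congr rfl fun m _ => Finset.sum_congr rfl fun n _ => ?_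
      simp only [Pi.star_apply, RCLike.star_def]; ring
    rw [this, integral_complex_ofReal]
    exact_mod_cast integral_nonneg fun p => sq_nonneg _

lemma posDef_covR (hξ : ξ ∈ paramSpace K) :
    (covR κ ξ : Matrix (Antenna Mx My) (Antenna Mx My) ℂ).PosDef := by
  obtain ⟨-, -, -, -, hp, hn⟩ := hξ
  unfold covR
  refine Matrix.PosDef.posSemidef_add ?_ ?_
  · exact Matrix.posSemidef_sum _ fun k _ => (posSemidef_userCov κ ξ k).smul
      (by exact_mod_cast (hp k).le)
  · exact Matrix.PosDef.one.smul (by exact_mod_cast hn)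

end Response

end ArrayCRB

end

noncomputable section

namespace ArrayCRB

/-! ### Partial derivatives of the covariance matrix -/

section Partials
variable {Mx My K : ℕ} (κ : ℝ) (ξ : Param K)

lemma covR_apply (m n : Antenna Mx My) :
    covR κ ξ m n = ∑ k, (power ξ k : ℂ) * userCov κ ξ k m n +
      (noisePower ξ : ℂ) * (1 : Matrix (Antenna Mx My) (Antenna Mx My) ℂ) m n := by
  simp only [covR, userCov, Matrix.add_apply, Matrix.sum_apply, Matrix.smul_apply, smul_eq_mul]

/-- Writing an entry as a single exponential makes each of its derivatives the entry times the
derivative of the exponent, which is where the Hadamard products come from. -/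
lemma userCov_eq_exp (k : Fin K) (m n : Antenna Mx My) :
    userCov κ ξ k m n = Complex.exp (((-(
      elevSpread ξ k ^ 2 * Real.cos (elev ξ k) ^ 2 * axialDiff (azim ξ k) m n ^ 2 +
      azimSpread ξ k ^ 2 * Real.sin (elev ξ k) ^ 2 * transverseDiff (azim ξ k) m n ^ 2)
    * (1 / 2 * κ ^ 2) : ℝ) : ℂ) +
    Complex.I * ((κ * Real.sin (elev ξ k) * axialDiff (azim ξ k) m n : ℝ) : ℂ)) := by
  rw [userCov_apply, manifold, manifold, matB, Matrix.of_apply, Complex.ofReal_exp,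
    ← Complex.exp_conj, ← Complex.exp_add, ← Complex.exp_add]
  congr 1
  simp only [map_mul, Complex.conj_I, Complex.conj_ofReal, axialDiff, axial]
  push_cast
  ring

lemma hasDerivAt_axial {θ : ℝ → ℝ} {θ' r : ℝ} (hθ : HasDerivAt θ θ' r) (a b : ℝ) :
    HasDerivAt (fun r => axial (θ r) a b) (θ' * transverse (θ r) a b) r := by
  unfold axial transverse
  refine ((hθ.cos.const_mul a).add (hθ.sin.const_mul b)).congr_deriv ?_
  ring

lemma hasDerivAt_transverse {θ : ℝ → ℝ} {θ' r : ℝ} (hθ : HasDerivAt θ θ' r) (a b : ℝ) :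
    HasDerivAt (fun r => transverse (θ r) a b) (-(θ' * axial (θ r) a b)) r := by
  unfold axial transverse
  refine ((hθ.sin.const_mul (-a)).add (hθ.cos.const_mul b)).congr_deriv ?_
  ring

/-- Derivative of the covariance contribution of a user along a curve of parameters. -/
lemma hasDerivAt_userCov {X : ℝ → Param K} {X' : Param K} {r : ℝ} (hX : HasDerivAt X X' r)
    (k : Fin K) (m n : Antenna Mx My) :
    HasDerivAt (fun r => userCov κ (X r) k m n)
      (userCov κ (X r) k m n *
        ((azim X' k : ℂ) * (matBAzim κ (X r) k m n + Complex.I *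
          ((κ * Real.sin (elev (X r) k) * transverseDiff (azim (X r) k) m n : ℝ) : ℂ)) +
        (elev X' k : ℂ) * (matBElev κ (X r) k m n + Complex.I *
          ((κ * Real.cos (elev (X r) k) * axialDiff (azim (X r) k) m n : ℝ) : ℂ)) +
        (azimSpread X' k : ℂ) * matBAzimSpread κ (X r) k m n +
        (elevSpread X' k : ℂ) * matBElevSpread κ (X r) k m n)) r := by
  have hc := hasDerivAt_pi.1 hX
  have hθ : HasDerivAt (fun r => azim (X r) k) (azim X' k) r := hc _
  have hφ : HasDerivAt (fun r => elev (X r) k) (elev X' k) r := hc _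
  have hσ : HasDerivAt (fun r => azimSpread (X r) k) (azimSpread X' k) r := hc _
  have hτ : HasDerivAt (fun r => elevSpread (X r) k) (elevSpread X' k) r := hc _
  have ha := hasDerivAt_axial hθ (posX m - posX n) (posY m - posY n)
  have ht := hasDerivAt_transverse hθ (posX m - posX n) (posY m - posY n)
  have h1 := ((((hτ.pow 2).mul (hφ.cos.pow 2)).mul (ha.pow 2)).add
    (((hσ.pow 2).mul (hφ.sin.pow 2)).mul (ht.pow 2))).neg.mul_const (1 / 2 * κ ^ 2)
  have h2 := (hφ.sin.const_mul κ).mul ha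
  have h3 := (h1.ofReal_comp.add (h2.ofReal_comp.const_mul Complex.I)).cexp
  have h4 : HasDerivAt (fun r => userCov κ (X r) k m n) _ r :=
    h3.congr_of_eventuallyEq (Eventually.of_forall fun r => userCov_eq_exp κ (X r) k m n)
  refine h4.congr_deriv ?_
  rw [userCov_eq_exp]
  congr 1
  simp only [matBAzim, matBElev, matBAzimSpread, matBElevSpread, Matrix.of_apply, axialDiff,
    transverseDiff, Real.sin_two_mul, Real.cos_two_mul', axial, transverse, Pi.pow_apply,
    Pi.mul_apply]
  push_cast
  ring

lemma hasDerivAt_covR {X : ℝ → Param K} {X' : Param K} {r : ℝ} (hX : HasDerivAt X X' r)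
    (m n : Antenna Mx My) :
    HasDerivAt (fun r => covR κ (X r) m n)
      (∑ k, ((power X' k : ℂ) * userCov κ (X r) k m n + (power (X r) k : ℂ) *
      (userCov κ (X r) k m n *
        ((azim X' k : ℂ) * (matBAzim κ (X r) k m n + Complex.I *
          ((κ * Real.sin (elev (X r) k) * transverseDiff (azim (X r) k) m n : ℝ) : ℂ)) +
        (elev X' k : ℂ) * (matBElev κ (X r) k m n + Complex.I *
          ((κ * Real.cos (elev (X r) k) * axialDiff (azim (X r) k) m n : ℝ) : ℂ)) +
        (azimSpread X' k : ℂ) * matBAzimSpread κ (X r) k m n +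
        (elevSpread X' k : ℂ) * matBElevSpread κ (X r) k m n))) +
      (noisePower X' : ℂ) * (1 : Matrix (Antenna Mx My) (Antenna Mx My) ℂ) m n) r := by
  have hc := hasDerivAt_pi.1 hX
  have hp : ∀ k, HasDerivAt (fun r => power (X r) k) (power X' k) r := fun k => hc _
  have hn : HasDerivAt (fun r => noisePower (X r)) (noisePower X') r := hc _
  simp_rw [covR_apply]
  exact (HasDerivAt.fun_sum fun k _ => (hp k).ofReal_comp.mul
    (hasDerivAt_userCov κ hX k m n)).add (hn.ofReal_comp.mul_const _)

lemma hasDerivAt_covR_update (q : ParamIdx K) (m n : Antenna Mx My) :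
    HasDerivAt (fun r : ℝ => covR κ (Function.update ξ q r) m n) (covPartial κ ξ q m n) (ξ q) := by
  -- The velocity of this curve is the `q`-th unit vector, so only one term of the general
  -- derivative survives. Multiplying by a diagonal matrix on the left and on the right, with
  -- opposite signs, yields the difference of the values at `m` and `n`.
  have h := hasDerivAt_covR κ (hasDerivAt_update ξ q (ξ q)) m n
  refine h.congr_deriv ?_
  rw [Function.update_eq_self]
  have hd : ∀ (k : Fin K) (M : Matrix (Antenna Mx My) (Antenna Mx My) ℂ),
      (matD κ ξ k * (matB κ ξ k ⊙ M) * (matD κ ξ k)ᴴ :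
        Matrix (Antenna Mx My) (Antenna Mx My) ℂ) m n = userCov κ ξ k m n * M m n := by
    intro k M
    rw [userCov_apply, matD, diagonal_conjTranspose, mul_diagonal, diagonal_mul,
      Matrix.hadamard_apply]
    simp only [Pi.star_apply, RCLike.star_def]
    ring
  have hl : ∀ (k : Fin K) (v : Antenna Mx My → ℂ),
      (diagonal v * matD κ ξ k * matB κ ξ k * (matD κ ξ k)ᴴ :
        Matrix (Antenna Mx My) (Antenna Mx My) ℂ) m n = v m * userCov κ ξ k m n := by
    intro k v
    rw [Matrix.mul_assoc (diagonal v), Matrix.mul_assoc (diagonal v), diagonal_mul, userCov]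
  have hr : ∀ (k : Fin K) (v : Antenna Mx My → ℂ),
      (matD κ ξ k * matB κ ξ k * (matD κ ξ k)ᴴ * diagonal v :
        Matrix (Antenna Mx My) (Antenna Mx My) ℂ) m n = userCov κ ξ k m n * v n := by
    intro k v
    rw [mul_diagonal, userCov]
  rcases q with (k | k | k | k) | k | k
  all_goals
    simp only [azim, elev, azimSpread, elevSpread, power, noisePower, Pi.single_apply]
    simp [covPartial, hd, matDAzim, matDElev, hl, hr, apply_ite]
  · rw [power]
    simp only [transverseDiff, transverse, azim, elev]
    push_cast
    ring
  · rw [power]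
    simp only [axialDiff, axial, azim, elev]
    push_cast
    ring
  · exact Or.inl rfl
  · exact Or.inl rfl
  · rfl

end Partials

end ArrayCRB

end

noncomputable section

namespace ArrayCRB

/-! ### Differentiating determinants, inverses and Gaussian log-densities -/

section MatrixCurve
variable {ι : Type*} [Fintype ι]

lemma abs_quadForm_le (A : Matrix ι ι ℂ) (x : ι → ℂ) :
    |quadForm A x| ≤ (∑ m, ∑ n, ‖A m n‖) * ∑ i, ‖x i‖ ^ 2 := by
  refine (Complex.abs_re_le_norm _).trans ?_
  have e : star x ⬝ᵥ (A *ᵥ x) = ∑ m, ∑ n, star (x m) * (A m n * x n) := by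
    simp only [dotProduct, mulVec, Finset.mul_sum, Pi.star_apply]
  rw [e, Finset.sum_mul]
  refine (norm_sum_le _ _).trans (Finset.sum_le_sum fun m _ => ?_)
  rw [Finset.sum_mul]
  refine (norm_sum_le _ _).trans (Finset.sum_le_sum fun n _ => ?_)
  have h : ∀ i, ‖x i‖ ^ 2 ≤ ∑ i, ‖x i‖ ^ 2 := fun i =>
    Finset.single_le_sum (f := fun i => ‖x i‖ ^ 2) (fun _ _ => by positivity) (Finset.mem_univ i)
  rw [norm_mul, norm_mul, norm_star]
  have : ‖x m‖ * ‖x n‖ ≤ ∑ i, ‖x i‖ ^ 2 := by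
    nlinarith [h m, h n, sq_nonneg (‖x m‖ - ‖x n‖)]
  nlinarith [norm_nonneg (A m n)]

variable [DecidableEq ι]

lemma det_updateCol_eq_sum (A : Matrix ι ι ℂ) (i : ι) (v : ι → ℂ) :
    (A.updateCol i v).det = ∑ σ : Equiv.Perm ι, ((Equiv.Perm.sign σ : ℤ) : ℂ) *
      ((∏ j ∈ Finset.univ.erase i, A (σ j) j) * v (σ i)) := by
  rw [det_apply']
  refine Finset.sum_congr rfl fun σ _ => ?_
  rw [← Finset.prod_erase_mul _ _ (Finset.mem_univ i), updateCol_self]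
  congr 2
  refine Finset.prod_congr rfl fun j hj => ?_
  rw [updateCol_ne (Finset.ne_of_mem_erase hj)]

variable {C : ℝ → Matrix ι ι ℂ} {C' : Matrix ι ι ℂ} {r₀ : ℝ}

/-- Jacobi's formula: differentiating the Leibniz expansion column by column gives determinants with
one column replaced by that of `C'`, which Cramer's rule expresses by the adjugate. -/
lemma hasDerivAt_det (hC : ∀ m n, HasDerivAt (fun r => C r m n) (C' m n) r₀) :
    HasDerivAt (fun r => (C r).det) ((adjugate (C r₀) * C').trace) r₀ := by
  simp_rw [det_apply']
  have h := HasDerivAt.fun_sum (u := Finset.univ) fun (σ : Equiv.Perm ι) _ =>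
    (HasDerivAt.fun_finsetProd (u := Finset.univ) fun (j : ι) _ => hC (σ j) j).const_mul
      ((Equiv.Perm.sign σ : ℤ) : ℂ)
  refine h.congr_deriv ?_
  simp_rw [Finset.mul_sum]
  rw [Finset.sum_comm]
  refine Finset.sum_congr rfl fun i _ => ?_
  have := det_updateCol_eq_sum (C r₀) i (fun j => C' j i)
  simp only [smul_eq_mul]
  rw [← this, ← cramer_apply, cramer_eq_adjugate_mulVec]
  rfl

lemma hasDerivAt_det_of_isUnit (hC : ∀ m n, HasDerivAt (fun r => C r m n) (C' m n) r₀)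
    (hu : IsUnit (C r₀).det) :
    HasDerivAt (fun r => (C r).det) ((C r₀).det * ((C r₀)⁻¹ * C').trace) r₀ := by
  refine (hasDerivAt_det hC).congr_deriv ?_
  rw [inv_def, Ring.inverse_eq_inv', smul_mul, trace_smul, smul_eq_mul, ← mul_assoc,
    mul_inv_cancel₀ hu.ne_zero, one_mul]

lemma eventually_det_ne_zero (hC : ∀ m n, HasDerivAt (fun r => C r m n) (C' m n) r₀)
    (hu : IsUnit (C r₀).det) : ∀ᶠ r in 𝓝 r₀, (C r).det ≠ 0 :=
  (hasDerivAt_det hC).continuousAt.eventually_ne hu.ne_zero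

lemma differentiableAt_inv (hC : ∀ m n, HasDerivAt (fun r => C r m n) (C' m n) r₀)
    (hu : IsUnit (C r₀).det) (m n : ι) : DifferentiableAt ℝ (fun r => (C r)⁻¹ m n) r₀ := by
  have hadj : DifferentiableAt ℝ (fun r => adjugate (C r) m n) r₀ := by
    simp_rw [adjugate_apply]
    -- An entry of the adjugate is the determinant after replacing row `n` by a constant row, whose
    -- derivative is zero.
    refine (hasDerivAt_det (C' := C'.updateRow n 0) fun a b => ?_).differentiableAt
    by_cases h : a = n
    · subst h; simpa using hasDerivAt_const _ _
    · simpa [updateRow_ne h] using hC a b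
  have : (fun r => (C r)⁻¹ m n) = fun r => (C r).det⁻¹ * adjugate (C r) m n := by
    funext r; rw [inv_def, Ring.inverse_eq_inv', Matrix.smul_apply, smul_eq_mul]
  rw [this]
  exact ((hasDerivAt_det hC).differentiableAt.fun_inv hu.ne_zero).fun_mul hadj

lemma hasDerivAt_inv (hC : ∀ m n, HasDerivAt (fun r => C r m n) (C' m n) r₀)
    (hu : IsUnit (C r₀).det) (m n : ι) :
    HasDerivAt (fun r => (C r)⁻¹ m n) (-((C r₀)⁻¹ * C' * (C r₀)⁻¹) m n) r₀ := by
  set D : Matrix ι ι ℂ := Matrix.of fun m n => deriv (fun r => (C r)⁻¹ m n) r₀ with hD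
  have hd : ∀ m n, HasDerivAt (fun r => (C r)⁻¹ m n) (D m n) r₀ := fun m n =>
    (differentiableAt_inv hC hu m n).hasDerivAt
  -- Once differentiability is known, the value of the derivative follows by differentiating `C *
  -- C⁻¹ = 1`, valid near `r₀`.
  have h0 : C' * (C r₀)⁻¹ + C r₀ * D = 0 := by
    ext a b
    have h1 : HasDerivAt (fun r => (C r * (C r)⁻¹) a b) ((C' * (C r₀)⁻¹ + C r₀ * D) a b) r₀ := by
      simp_rw [Matrix.add_apply, Matrix.mul_apply, ← Finset.sum_add_distrib]
      exact HasDerivAt.fun_sum fun j _ => (hC a j).mul (hd j b)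
    have h2 : HasDerivAt (fun r => (C r * (C r)⁻¹) a b) 0 r₀ := by
      refine (hasDerivAt_const r₀ ((1 : Matrix ι ι ℂ) a b)).congr_of_eventuallyEq ?_
      filter_upwards [eventually_det_ne_zero hC hu] with r hr
      rw [Matrix.mul_nonsing_inv _ (isUnit_iff_ne_zero.2 hr)]
    exact h1.unique h2
  have h3 : D = -((C r₀)⁻¹ * C' * (C r₀)⁻¹) := by
    calc D = (C r₀)⁻¹ * (C r₀ * D) := by rw [← Matrix.mul_assoc, nonsing_inv_mul _ hu, Matrix.one_mul]
      _ = _ := by rw [eq_neg_of_add_eq_zero_right h0, Matrix.mul_neg, Matrix.mul_assoc]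
  rw [← Matrix.neg_apply, ← h3]
  exact hd m n

/-- Logarithm of the density of a complex Gaussian vector. -/
def cgLogDensity (R : Matrix ι ι ℂ) (x : ι → ℂ) : ℝ :=
  -quadForm R⁻¹ x - Real.log (Real.pi ^ Fintype.card ι) - Real.log R.det.re

lemma cgDensity_eq_exp {R : Matrix ι ι ℂ} (hR : 0 < R.det.re) (x : ι → ℂ) :
    cgDensity R x = Real.exp (cgLogDensity R x) := by
  have : 0 < Real.pi ^ Fintype.card ι := by positivity
  rw [cgLogDensity, sub_sub, ← Real.log_mul this.ne' hR.ne', Real.exp_sub,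
    Real.exp_log (mul_pos this hR)]
  rfl

lemma det_re_pos {R : Matrix ι ι ℂ} (hR : R.PosDef) : 0 < R.det.re :=
  (Complex.pos_iff.1 hR.det_pos).1

lemma det_im_eq_zero {R : Matrix ι ι ℂ} (hR : R.PosDef) : R.det.im = 0 :=
  (Complex.pos_iff.1 hR.det_pos).2.symm

lemma isUnit_det_of_posDef {R : Matrix ι ι ℂ} (hR : R.PosDef) : IsUnit R.det :=
  (Matrix.isUnit_iff_isUnit_det _).1 hR.isUnit

variable (hC : ∀ m n, HasDerivAt (fun r => C r m n) (C' m n) r₀) (hR : (C r₀).PosDef)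
include hC hR

lemma hasDerivAt_log_det_re :
    HasDerivAt (fun r => Real.log (C r).det.re) ((C r₀)⁻¹ * C').trace.re r₀ := by
  have h := hasDerivAt_det_of_isUnit hC (isUnit_det_of_posDef hR)
  have h2 : HasDerivAt (fun r => (C r).det.re) ((C r₀).det * ((C r₀)⁻¹ * C').trace).re r₀ :=
    Complex.reCLM.hasFDerivAt.comp_hasDerivAt r₀ h
  refine (h2.log (det_re_pos hR).ne').congr_deriv ?_
  -- Since `det (C r₀)` is real, it factors out of the real part and cancels.
  rw [Complex.mul_re, det_im_eq_zero hR, zero_mul, sub_zero, mul_div_cancel_left₀ _ (det_re_pos hR).ne']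

lemma hasDerivAt_cgLogDensity (x : ι → ℂ) :
    HasDerivAt (fun r => cgLogDensity (C r) x)
      (quadForm ((C r₀)⁻¹ * C' * (C r₀)⁻¹) x - ((C r₀)⁻¹ * C').trace.re) r₀ := by
  have h1 : HasDerivAt (fun r => star x ⬝ᵥ ((C r)⁻¹ *ᵥ x))
      (star x ⬝ᵥ ((-((C r₀)⁻¹ * C' * (C r₀)⁻¹)) *ᵥ x)) r₀ := by
    simp only [dotProduct, mulVec]
    exact HasDerivAt.fun_sum fun m _ => (HasDerivAt.fun_sum fun n _ =>
      (hasDerivAt_inv hC (isUnit_det_of_posDef hR) m n).mul_const _).const_mul _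
  have h2 : HasDerivAt (fun r => quadForm (C r)⁻¹ x)
      (star x ⬝ᵥ ((-((C r₀)⁻¹ * C' * (C r₀)⁻¹)) *ᵥ x)).re r₀ :=
    Complex.reCLM.hasFDerivAt.comp_hasDerivAt r₀ h1
  refine ((h2.neg.sub_const _).sub (hasDerivAt_log_det_re hC hR)).congr_deriv ?_
  rw [neg_mulVec, dotProduct_neg, Complex.neg_re, neg_neg]
  rfl

lemma eventually_det_re_pos : ∀ᶠ r in 𝓝 r₀, 0 < (C r).det.re := by
  have h : ContinuousAt (fun r => (C r).det.re) r₀ :=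
    Complex.continuous_re.continuousAt.comp (hasDerivAt_det hC).continuousAt
  exact h.eventually (lt_mem_nhds (det_re_pos hR))

/-- Only the inverse and the log-determinant depend on `r`, and differentiability makes both
Lipschitz at `r₀`. The constant and the neighborhood are therefore uniform in `x`, as domination
requires. -/
lemma eventually_abs_cgLogDensity_sub_le :
    ∃ B > 0, ∀ᶠ r in 𝓝 r₀, ∀ x, |cgLogDensity (C r) x - cgLogDensity (C r₀) x| ≤
      B * |r - r₀| * (1 + ∑ i, ‖x i‖ ^ 2) := by
  have h1 : (fun r => ∑ m, ∑ n, ‖((C r)⁻¹ - (C r₀)⁻¹) m n‖) =O[𝓝 r₀] fun r => r - r₀ :=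
    IsBigO.fun_sum fun m _ => IsBigO.fun_sum fun n _ =>
      (hasDerivAt_inv hC (isUnit_det_of_posDef hR) m n).isBigO_sub.norm_left
  have h2 := (hasDerivAt_log_det_re hC hR).isBigO_sub
  obtain ⟨B₁, hB₁, h1⟩ := h1.exists_pos
  obtain ⟨B₂, hB₂, h2⟩ := h2.exists_pos
  refine ⟨B₁ + B₂, by positivity, ?_⟩
  filter_upwards [h1.bound, h2.bound] with r hr1 hr2 x
  have e : cgLogDensity (C r) x - cgLogDensity (C r₀) x =
      -quadForm ((C r)⁻¹ - (C r₀)⁻¹) x - (Real.log (C r).det.re - Real.log (C r₀).det.re) := by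
    simp only [cgLogDensity, quadForm, sub_mulVec, dotProduct_sub, Complex.sub_re]
    ring
  rw [Real.norm_eq_abs, Real.norm_eq_abs] at hr1 hr2
  have hq := abs_quadForm_le ((C r)⁻¹ - (C r₀)⁻¹) x
  have hs : 0 ≤ ∑ i, ‖x i‖ ^ 2 := Finset.sum_nonneg fun _ _ => by positivity
  have ha := abs_nonneg (r - r₀)
  calc |cgLogDensity (C r) x - cgLogDensity (C r₀) x|
      ≤ |quadForm ((C r)⁻¹ - (C r₀)⁻¹) x| + |Real.log (C r).det.re - Real.log (C r₀).det.re| := by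
        rw [e]; exact (abs_sub _ _).trans (by rw [abs_neg])
    _ ≤ B₁ * |r - r₀| * (∑ i, ‖x i‖ ^ 2) + B₂ * |r - r₀| := by
        refine add_le_add (hq.trans ?_) hr2
        exact mul_le_mul_of_nonneg_right ((le_abs_self _).trans hr1) hs
    _ ≤ _ := by nlinarith [mul_nonneg hB₁.le ha, mul_nonneg (mul_nonneg hB₂.le ha) hs]

end MatrixCurve

end ArrayCRB

end

noncomputable section

namespace ArrayCRB

/-! ### Covariance of sums of Hermitian forms over independent snapshots -/

section FormSum
variable {ι : Type*} [Fintype ι] {T : ℕ}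

/-- The sum over the snapshots of `xᴴ A x`, centered under `CN(0, R)`. -/
def centeredFormSum (R A : Matrix ι ι ℂ) (y : Fin T → ι → ℂ) : ℝ :=
  ∑ t, (quadForm A (y t) - (A * R).trace.re)

lemma centeredFormSum_add (R A B : Matrix ι ι ℂ) (y : Fin T → ι → ℂ) :
    centeredFormSum R (A + B) y = centeredFormSum R A y + centeredFormSum R B y := by
  simp only [centeredFormSum, ← Finset.sum_add_distrib, quadForm_add, Matrix.add_mul, trace_add,
    Complex.add_re]
  exact Finset.sum_congr rfl fun t _ => by ring

lemma trace_mul_im_eq_zero {R A B : Matrix ι ι ℂ} (hR : R.IsHermitian) (hA : A.IsHermitian)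
    (hB : B.IsHermitian) : (A * R * B * R).trace.im = 0 := by
  rw [← Complex.conj_eq_iff_im]
  change star _ = _
  rw [← trace_conjTranspose]
  simp only [conjTranspose_mul, hR.eq, hA.eq, hB.eq]
  rw [← Matrix.mul_assoc, ← Matrix.mul_assoc, Matrix.trace_mul_comm]
  simp only [← Matrix.mul_assoc]

variable [DecidableEq ι] {R : Matrix ι ι ℂ} (hR : R.PosDef)
include hR

lemma centeredFormSum_moments {A : Matrix ι ι ℂ} (hA : A.IsHermitian) :
    MemLp (centeredFormSum (T := T) R A) 2 (Measure.pi fun _ => complexGaussian R) ∧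
    ∫ y, centeredFormSum (T := T) R A y ∂(Measure.pi fun _ => complexGaussian R) = 0 ∧
    ∫ y, centeredFormSum (T := T) R A y ^ 2 ∂(Measure.pi fun _ => complexGaussian R) =
      T * (A * R * A * R).trace.re := by
  have := isProbabilityMeasure_complexGaussian hR
  obtain ⟨h1, h2, h3⟩ := quadForm_complexGaussian hR hA
  have hm : MemLp (fun x => quadForm A x - (A * R).trace.re) 2 (complexGaussian R) :=
    h1.sub (memLp_const _)
  have e : centeredFormSum (T := T) R A =
      ∑ t, fun y : Fin T → ι → ℂ => (quadForm A (y t) - (A * R).trace.re) := by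
    funext y; rw [Finset.sum_apply]; rfl
  have hm' : ∀ t, MemLp (fun y : Fin T → ι → ℂ => (quadForm A (y t) - (A * R).trace.re)) 2
      (Measure.pi fun _ => complexGaussian R) := fun t =>
    hm.comp_measurePreserving (measurePreserving_eval (fun _ => complexGaussian R) t)
  have hL : MemLp (centeredFormSum (T := T) R A) 2 (Measure.pi fun _ => complexGaussian R) := by
    rw [e]; exact memLp_finsetSum' _ fun t _ => hm' t
  have hI : ∫ y, centeredFormSum (T := T) R A y ∂(Measure.pi fun _ => complexGaussian R) = 0 := by
    rw [e]
    simp only [Finset.sum_apply]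
    rw [integral_finsetSum _ fun t _ => (hm' t).integrable (by norm_num)]
    refine Finset.sum_eq_zero fun t _ => ?_
    rw [integral_comp_eval (μ := fun _ : Fin T => complexGaussian R)
      (f := fun x => quadForm A x - (A * R).trace.re) hm.aestronglyMeasurable,
      integral_sub (h1.integrable (by norm_num)) (integrable_const _), h2]
    simp
  refine ⟨hL, hI, ?_⟩
  rw [← variance_of_integral_eq_zero hL.aemeasurable hI, e,
    variance_sum_pi (X := fun _ x => quadForm A x - (A * R).trace.re) fun _ => hm]
  rw [Finset.sum_const, Finset.card_univ, Fintype.card_fin, nsmul_eq_mul,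
    variance_sub_const h1.aestronglyMeasurable, h3]

/-- Polarization: the second moments for `A`, `B` and `A + B` are known, and the two mixed traces
agree by cyclicity. -/
lemma integral_centeredFormSum_mul {A B : Matrix ι ι ℂ} (hA : A.IsHermitian)
    (hB : B.IsHermitian) :
    ∫ y, centeredFormSum (T := T) R A y * centeredFormSum R B y
      ∂(Measure.pi fun _ => complexGaussian R) = T * (A * R * B * R).trace.re := by
  obtain ⟨a1, -, a3⟩ := centeredFormSum_moments (T := T) hR hA
  obtain ⟨b1, -, b3⟩ := centeredFormSum_moments (T := T) hR hB
  obtain ⟨-, -, c3⟩ := centeredFormSum_moments (T := T) hR (hA.add hB)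
  have e : ∀ y, centeredFormSum (T := T) R (A + B) y ^ 2 = centeredFormSum R A y ^ 2 +
      centeredFormSum R B y ^ 2 + 2 * (centeredFormSum R A y * centeredFormSum R B y) := by
    intro y; rw [centeredFormSum_add]; ring
  simp_rw [e] at c3
  have hab : Integrable (fun y => centeredFormSum (T := T) R A y * centeredFormSum R B y)
    (Measure.pi fun _ => complexGaussian R) := a1.integrable_mul b1
  have hs : Integrable (fun y => centeredFormSum (T := T) R A y ^ 2 + centeredFormSum R B y ^ 2)
    (Measure.pi fun _ => complexGaussian R) := a1.integrable_sq.add b1.integrable_sq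
  rw [integral_add hs (hab.const_mul 2), integral_add a1.integrable_sq b1.integrable_sq, integral_const_mul, a3, b3] at c3
  have ht : (B * R * A * R).trace = (A * R * B * R).trace := by
    rw [Matrix.mul_assoc (B * R), Matrix.trace_mul_comm, ← Matrix.mul_assoc]
  have : ((A + B) * R * (A + B) * R).trace = (A * R * A * R).trace + (B * R * B * R).trace +
      2 * (A * R * B * R).trace := by
    simp only [Matrix.add_mul, Matrix.mul_add, trace_add, ht]
    ring
  rw [this] at c3
  simp only [Complex.add_re, Complex.mul_re, Complex.re_ofNat, Complex.im_ofNat, zero_mul,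
    sub_zero] at c3
  linarith

end FormSum

/-! ### Scores and the Fisher information -/

section Fisher
variable {Mx My K T : ℕ} (κ : ℝ) (ξ : Param K)

lemma isHermitian_userCov (k : Fin K) :
    (userCov κ ξ k : Matrix (Antenna Mx My) (Antenna Mx My) ℂ).IsHermitian :=
  (posSemidef_userCov κ ξ k).isHermitian

lemma isHermitian_covR :
    (covR κ ξ : Matrix (Antenna Mx My) (Antenna Mx My) ℂ).IsHermitian := by
  ext m n
  rw [conjTranspose_apply, covR_apply, covR_apply, star_add, star_sum]
  congr 1
  · refine Finset.sum_congr rfl fun k _ => ?_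
    rw [star_mul', (isHermitian_userCov κ ξ k).apply, RCLike.star_def, Complex.conj_ofReal]
  · rw [star_mul', Matrix.isHermitian_one.apply, RCLike.star_def, Complex.conj_ofReal]

/-- The covariance is Hermitian for every parameter vector, so uniqueness of the derivative
transfers the symmetry to its partial derivatives. -/
lemma isHermitian_covPartial (q : ParamIdx K) :
    (covPartial κ ξ q : Matrix (Antenna Mx My) (Antenna Mx My) ℂ).IsHermitian := by
  ext m n
  rw [conjTranspose_apply]
  have h1 := (hasDerivAt_covR_update κ ξ q n m).star
  have h2 := hasDerivAt_covR_update κ ξ q m n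
  simp_rw [(isHermitian_covR κ _).apply] at h1
  exact h1.unique h2

/-- The matrix `𝐑⁻¹ (∂𝐑 / ∂[ξ]_q) 𝐑⁻¹` of the quadratic part of the score. -/
def scoreMatrix (q : ParamIdx K) : Matrix (Antenna Mx My) (Antenna Mx My) ℂ :=
  (covR κ ξ)⁻¹ * covPartial κ ξ q * (covR κ ξ)⁻¹

lemma isHermitian_scoreMatrix (q : ParamIdx K) :
    (scoreMatrix κ ξ q : Matrix (Antenna Mx My) (Antenna Mx My) ℂ).IsHermitian := by
  unfold scoreMatrix
  have h := isHermitian_conjTranspose_mul_mul (covR κ ξ : Matrix (Antenna Mx My) _ ℂ)⁻¹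
    (isHermitian_covPartial (Mx := Mx) (My := My) κ ξ q)
  rwa [(isHermitian_covR κ ξ).inv.eq] at h

variable {ξ} (hξ : ξ ∈ paramSpace K)
include hξ

lemma isUnit_det_covR : IsUnit (covR κ ξ : Matrix (Antenna Mx My) (Antenna Mx My) ℂ).det :=
  isUnit_det_of_posDef (posDef_covR κ ξ hξ)

lemma posDef_covR_update_self (q : ParamIdx K) :
    (covR κ (Function.update ξ q (ξ q)) : Matrix (Antenna Mx My) (Antenna Mx My) ℂ).PosDef := by
  rw [Function.update_eq_self]; exact posDef_covR κ ξ hξ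

lemma scoreMatrix_mul_covR (q : ParamIdx K) :
    (scoreMatrix κ ξ q * covR κ ξ : Matrix (Antenna Mx My) (Antenna Mx My) ℂ) =
      (covR κ ξ)⁻¹ * covPartial κ ξ q := by
  rw [scoreMatrix, Matrix.mul_assoc _ _ (covR κ ξ), nonsing_inv_mul _ (isUnit_det_covR κ hξ),
    Matrix.mul_one]

/-- The log-determinant contributes exactly the mean of the quadratic part, since `scoreMatrix *
covR = 𝐑⁻¹ ∂_q 𝐑`. The score is thus centered without differentiating the total mass. -/
lemma hasDerivAt_logLikAlong (q : ParamIdx K) (y : Data Mx My T) :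
    HasDerivAt (logLikAlong κ ξ q y)
      (centeredFormSum (covR κ ξ) (scoreMatrix κ ξ q) y) (ξ q) := by
  have hC := hasDerivAt_covR_update (Mx := Mx) (My := My) κ ξ q
  have hR := posDef_covR_update_self (Mx := Mx) (My := My) κ hξ q
  have h : HasDerivAt (fun r => ∑ t, cgLogDensity (covR κ (Function.update ξ q r)) (y t)) _ (ξ q) :=
    HasDerivAt.fun_sum fun t (_ : t ∈ Finset.univ) => hasDerivAt_cgLogDensity hC hR (y t)
  rw [Function.update_eq_self] at h
  refine (h.congr_of_eventuallyEq ?_).congr_deriv ?_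
  · filter_upwards [eventually_det_re_pos hC hR] with r hr
    rw [logLikAlong, likelihood, Finset.prod_congr rfl fun t _ => cgDensity_eq_exp hr (y t),
      ← Real.exp_sum, Real.log_exp]
  · rw [centeredFormSum, scoreMatrix_mul_covR κ hξ]
    rfl

lemma score_eq (q : ParamIdx K) :
    score (Mx := Mx) (My := My) (T := T) κ ξ q =
      centeredFormSum (covR κ ξ) (scoreMatrix κ ξ q) := by
  funext y
  exact (hasDerivAt_logLikAlong κ hξ q y).deriv

lemma memLp_score (q : ParamIdx K) :
    MemLp (score (Mx := Mx) (My := My) (T := T) κ ξ q) 2 (snapshotLaw κ ξ) := by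
  rw [score_eq κ hξ]
  exact (centeredFormSum_moments (posDef_covR κ ξ hξ) (isHermitian_scoreMatrix κ ξ q)).1

lemma integral_score (q : ParamIdx K) :
    ∫ y, score (Mx := Mx) (My := My) (T := T) κ ξ q y ∂(snapshotLaw κ ξ) = 0 := by
  rw [score_eq κ hξ]
  exact (centeredFormSum_moments (posDef_covR κ ξ hξ) (isHermitian_scoreMatrix κ ξ q)).2.1

lemma fisherInformation_eq (q q' : ParamIdx K) :
    ((fisherInformation Mx My T κ ξ q q' : ℝ) : ℂ) =
      (T : ℂ) * Matrix.trace
        ((covR (Mx := Mx) (My := My) κ ξ)⁻¹ * covPartial κ ξ q *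
          (covR κ ξ)⁻¹ * covPartial κ ξ q') := by
  rw [fisherInformation, Matrix.of_apply, score_eq κ hξ, score_eq κ hξ, snapshotLaw,
    integral_centeredFormSum_mul (posDef_covR κ ξ hξ) (isHermitian_scoreMatrix κ ξ q)
      (isHermitian_scoreMatrix κ ξ q')]
  have him := trace_mul_im_eq_zero (isHermitian_covR (Mx := Mx) (My := My) κ ξ)
    (isHermitian_scoreMatrix κ ξ q) (isHermitian_scoreMatrix κ ξ q')
  have e : (scoreMatrix κ ξ q * covR κ ξ * scoreMatrix κ ξ q' * covR κ ξ :
      Matrix (Antenna Mx My) (Antenna Mx My) ℂ) =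
      (covR κ ξ)⁻¹ * covPartial κ ξ q * (covR κ ξ)⁻¹ * covPartial κ ξ q' := by
    rw [Matrix.mul_assoc _ (scoreMatrix κ ξ q'), scoreMatrix_mul_covR κ hξ,
      scoreMatrix_mul_covR κ hξ, Matrix.mul_assoc _ _ (covPartial κ ξ q')]
  rw [← e]
  push_cast
  congr 1
  -- The moment formula supplies only the real part of the trace; its imaginary part vanishes
  -- because all the matrices are Hermitian.
  exact Complex.ext (by simp) (by simp [him])

lemma isProbabilityMeasure_snapshotLaw :
    IsProbabilityMeasure (snapshotLaw (Mx := Mx) (My := My) (T := T) κ ξ) := by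
  have := isProbabilityMeasure_complexGaussian (posDef_covR (Mx := Mx) (My := My) κ ξ hξ)
  unfold snapshotLaw
  infer_instance

end Fisher

end ArrayCRB

end

noncomputable section

namespace ArrayCRB

/-! ### Differentiating expectations in the parameter -/

lemma abs_exp_sub_one_le (x : ℝ) : |Real.exp x - 1| ≤ |x| * Real.exp |x| := by
  have h1 := Real.add_one_le_exp x
  have h2 := Real.add_one_le_exp (-x)
  rcases le_total 0 x with hx | hx
  · rw [abs_of_nonneg hx, abs_of_nonneg (by linarith)]
    have := mul_le_mul_of_nonneg_right h2 (Real.exp_pos x).le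
    rw [← Real.exp_add, neg_add_cancel, Real.exp_zero] at this
    linarith
  · rw [abs_of_nonpos hx, abs_of_nonpos (by linarith [Real.exp_le_one_iff.2 hx])]
    have := Real.one_le_exp (neg_nonneg.2 hx)
    nlinarith

section Derivative
variable {Mx My K T : ℕ} (κ : ℝ) {ξ : Param K}

/-- Range of a coordinate of the parameter space. -/
def coordRange : ParamIdx K → Set ℝ
  | Sum.inl (Sum.inl _) => Set.Ico 0 Real.pi
  | Sum.inl (Sum.inr (Sum.inl _)) => Set.Ico 0 (Real.pi / 2)
  | Sum.inl (Sum.inr (Sum.inr _)) => Set.Ioi 0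
  | Sum.inr _ => Set.Ioi 0

lemma mem_paramSpace_iff : ξ ∈ paramSpace K ↔ ∀ i, ξ i ∈ coordRange i := by
  simp only [paramSpace, Sum.forall, coordRange, Set.mem_Ico, Set.mem_Ioi, azim, elev, azimSpread,
    elevSpread, power, noisePower, Set.mem_ofPred_eq]
  tauto

/-- A parameter may lie on the boundary, but only at a left endpoint. Moving to the right stays in
the parameter space, which is why the expectations below are differentiated from the right. -/
lemma coordRange_mem_nhdsGT {q : ParamIdx K} {r : ℝ} (hr : r ∈ coordRange q) :
    ∀ᶠ s in 𝓝[>] r, s ∈ coordRange q := by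
  rcases q with (k | k | k | k) | k | k
  · exact mem_of_superset (Ico_mem_nhdsGT hr.2) fun s hs => ⟨hr.1.trans hs.1, hs.2⟩
  · exact mem_of_superset (Ico_mem_nhdsGT hr.2) fun s hs => ⟨hr.1.trans hs.1, hs.2⟩
  all_goals
    exact mem_of_superset self_mem_nhdsWithin fun s hs => lt_trans (show (0 : ℝ) < r from hr) hs

lemma eventually_update_mem_paramSpace (hξ : ξ ∈ paramSpace K) (q : ParamIdx K) :
    ∀ᶠ r in 𝓝[>] (ξ q), Function.update ξ q r ∈ paramSpace K := by
  have h := mem_paramSpace_iff.1 hξ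
  filter_upwards [coordRange_mem_nhdsGT (h q)] with r hr
  refine mem_paramSpace_iff.2 fun i => ?_
  by_cases hi : i = q
  · subst hi; simpa using hr
  · simpa [hi] using h i

/-- The log-likelihood ratio of two parameters. -/
def logLikRatio (ξ' ξ : Param K) (y : Data Mx My T) : ℝ :=
  ∑ t, (cgLogDensity (covR κ ξ') (y t) - cgLogDensity (covR κ ξ) (y t))

lemma continuous_cgLogDensity {ι : Type*} [Fintype ι] [DecidableEq ι] (R : Matrix ι ι ℂ) :
    Continuous (cgLogDensity R) := by
  unfold cgLogDensity; fun_prop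

lemma continuous_logLikRatio (ξ' ξ : Param K) :
    Continuous (logLikRatio (Mx := Mx) (My := My) (T := T) κ ξ' ξ) := by
  unfold logLikRatio
  exact continuous_finsetSum _ fun t _ =>
    ((continuous_cgLogDensity _).comp (continuous_apply t)).sub
      ((continuous_cgLogDensity _).comp (continuous_apply t))

lemma complexGaussian_eq_withDensity {ι : Type*} [Fintype ι] [DecidableEq ι]
    {R R' : Matrix ι ι ℂ} (hR : R.PosDef) (hR' : R'.PosDef) :
    complexGaussian R' = (complexGaussian R).withDensity fun x =>
      ENNReal.ofReal (Real.exp (cgLogDensity R' x - cgLogDensity R x)) := by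
  have hm : ∀ R : Matrix ι ι ℂ, Measurable (cgLogDensity R) := fun R =>
    (continuous_cgLogDensity R).measurable
  have hm1 := hm R
  have hm2 := hm R'
  unfold complexGaussian
  rw [← withDensity_mul _ (by fun_prop) (by fun_prop)]
  congr 1
  funext x
  rw [Pi.mul_apply, cgDensity_eq_exp (det_re_pos hR), cgDensity_eq_exp (det_re_pos hR'),
    ← ENNReal.ofReal_mul (Real.exp_pos _).le, ← Real.exp_add]
  congr 2; ring

/-- Transporting all laws to the fixed law at `ξ` reduces the dependence on the parameter to a
likelihood ratio inside the integral. -/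
lemma snapshotLaw_eq_withDensity {ξ' : Param K} (hξ : ξ ∈ paramSpace K)
    (hξ' : ξ' ∈ paramSpace K) :
    snapshotLaw (Mx := Mx) (My := My) (T := T) κ ξ' =
      (snapshotLaw κ ξ).withDensity fun y => ENNReal.ofReal (Real.exp (logLikRatio κ ξ' ξ y)) := by
  have hR := posDef_covR (Mx := Mx) (My := My) κ ξ hξ
  have hR' := posDef_covR (Mx := Mx) (My := My) κ ξ' hξ'
  have := isProbabilityMeasure_complexGaussian hR
  have := isProbabilityMeasure_complexGaussian hR'
  have hm : Measurable fun x => Real.exp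
      (cgLogDensity (covR (Mx := Mx) (My := My) κ ξ') x - cgLogDensity (covR κ ξ) x) :=
    (Real.continuous_exp.comp ((continuous_cgLogDensity _).sub (continuous_cgLogDensity _))).measurable
  unfold snapshotLaw
  rw [complexGaussian_eq_withDensity hR hR', pi_withDensity_ofReal]
  · simp_rw [← Real.exp_sum]; rfl
  · refine ⟨hm.aestronglyMeasurable, ?_⟩
    rw [hasFiniteIntegral_iff_ofReal (ae_of_all _ fun x => (Real.exp_pos _).le),
      ← setLIntegral_univ, ← withDensity_apply _ MeasurableSet.univ,
      ← complexGaussian_eq_withDensity hR hR']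
    exact measure_lt_top _ _
  · exact fun x => (Real.exp_pos _).le

/-- The quantity `∑_t (1 + ‖y_t‖²)`, which controls log-likelihood ratios. -/
def dataSize (y : Data Mx My T) : ℝ := ∑ t, (1 + ∑ m, ‖y t m‖ ^ 2)

lemma dataSize_nonneg (y : Data Mx My T) : 0 ≤ dataSize y := by unfold dataSize; positivity

lemma continuous_dataSize : Continuous (dataSize (Mx := Mx) (My := My) (T := T)) := by
  unfold dataSize; fun_prop

lemma integrable_exp_dataSize (hξ : ξ ∈ paramSpace K) :
    ∃ ε > 0, Integrable (fun y : Data Mx My T => Real.exp (ε * dataSize y)) (snapshotLaw κ ξ) := by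
  have hR := posDef_covR (Mx := Mx) (My := My) κ ξ hξ
  have := isProbabilityMeasure_complexGaussian hR
  obtain ⟨ε, hε, hi⟩ := integrable_exp_complexGaussian hR
  refine ⟨ε, hε, ?_⟩
  have h1 : Integrable (fun x : Antenna Mx My → ℂ => Real.exp (ε * (1 + ∑ m, ‖x m‖ ^ 2)))
      (complexGaussian (covR κ ξ)) := by
    refine (hi.const_mul (Real.exp ε)).congr (ae_of_all _ fun x => ?_)
    simp only
    rw [← Real.exp_add]; congr 1; ring
  have h2 := Integrable.fintype_prod (ι := Fin T) fun _ => h1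
  refine h2.congr (ae_of_all _ fun y => ?_)
  simp only
  rw [← Real.exp_sum, dataSize, Finset.mul_sum]

lemma eventually_abs_logLikRatio_le (hξ : ξ ∈ paramSpace K) (q : ParamIdx K) :
    ∃ B > 0, ∀ᶠ r in 𝓝 (ξ q), ∀ y : Data Mx My T,
      |logLikRatio κ (Function.update ξ q r) ξ y| ≤ B * |r - ξ q| * dataSize y := by
  obtain ⟨B, hB, h⟩ := eventually_abs_cgLogDensity_sub_le
    (hasDerivAt_covR_update (Mx := Mx) (My := My) κ ξ q) (posDef_covR_update_self κ hξ q)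
  refine ⟨B, hB, ?_⟩
  filter_upwards [h] with r hr y
  rw [Function.update_eq_self] at hr
  rw [logLikRatio, dataSize, Finset.mul_sum]
  exact (Finset.abs_sum_le_sum_abs _ _).trans (Finset.sum_le_sum fun t _ => hr (y t))

lemma hasDerivAt_exp_logLikRatio (hξ : ξ ∈ paramSpace K) (q : ParamIdx K) (y : Data Mx My T) :
    HasDerivAt (fun r => Real.exp (logLikRatio κ (Function.update ξ q r) ξ y))
      (score κ ξ q y) (ξ q) := by
  have hC := hasDerivAt_covR_update (Mx := Mx) (My := My) κ ξ q
  have hR := posDef_covR_update_self (Mx := Mx) (My := My) κ hξ q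
  have h : HasDerivAt (fun r => logLikRatio κ (Function.update ξ q r) ξ y) _ (ξ q) :=
    HasDerivAt.fun_sum fun t (_ : t ∈ Finset.univ) =>
      (hasDerivAt_cgLogDensity hC hR (y t)).sub_const _
  have h0 : logLikRatio κ ξ ξ y = 0 := by simp [logLikRatio]
  refine h.exp.congr_deriv ?_
  rw [Function.update_eq_self, h0, Real.exp_zero, one_mul, score_eq κ hξ, centeredFormSum,
    scoreMatrix_mul_covR κ hξ]
  rfl

/-- One-sided differentiation of an expectation under the integral sign. -/
lemma tendsto_slope_expectation (hξ : ξ ∈ paramSpace K) (q : ParamIdx K)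
    {f : Data Mx My T → ℝ} (hf : MemLp f 2 (snapshotLaw κ ξ)) :
    Tendsto (fun r => (r - ξ q)⁻¹ * ((∫ y, f y ∂(snapshotLaw κ (Function.update ξ q r))) -
        ∫ y, f y ∂(snapshotLaw κ ξ))) (𝓝[>] (ξ q))
      (𝓝 (∫ y, score κ ξ q y * f y ∂(snapshotLaw κ ξ))) := by
  have := isProbabilityMeasure_snapshotLaw (Mx := Mx) (My := My) (T := T) κ hξ
  obtain ⟨ε, hε, hexp⟩ := integrable_exp_dataSize (Mx := Mx) (My := My) (T := T) κ hξ
  obtain ⟨B, hB, hratio⟩ := eventually_abs_logLikRatio_le (Mx := Mx) (My := My) (T := T) κ hξ q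
  -- The dominating function `G` has exponent `2 η`, so its square has exponent `4 η = ε`, for which
  -- integrability is known.
  set η := ε / 4 with hη
  have hη0 : 0 < η := by positivity
  set G : Data Mx My T → ℝ := fun y => B / η * Real.exp (2 * η * dataSize y) with hG
  have hGm : MemLp G 2 (snapshotLaw κ ξ) := by
    refine MemLp.const_mul ?_ _
    have hc : Continuous fun y : Data Mx My T => Real.exp (2 * η * dataSize y) :=
      Real.continuous_exp.comp (continuous_const.mul continuous_dataSize)
    rw [memLp_two_iff_integrable_sq hc.aestronglyMeasurable]
    refine hexp.congr (ae_of_all _ fun y => ?_)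
    simp only
    rw [← Real.exp_nat_mul]; congr 1; rw [hη]; push_cast; ring
  -- By Cauchy–Schwarz, a finite second moment of `f` at the single parameter `ξ` suffices for
  -- domination.
  have hGf : Integrable (fun y => G y * |f y|) (snapshotLaw κ ξ) := hGm.integrable_mul hf.abs
  have hbound : ∀ᶠ r in 𝓝[>] (ξ q), ∀ y : Data Mx My T,
      |(r - ξ q)⁻¹ * (Real.exp (logLikRatio κ (Function.update ξ q r) ξ y) - 1)| ≤ G y := by
    have hsmall : ∀ᶠ r in 𝓝 (ξ q), B * |r - ξ q| < η := by
      have : Tendsto (fun r => B * |r - ξ q|) (𝓝 (ξ q)) (𝓝 0) := by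
        have hc : Continuous fun r => B * |r - ξ q| := by fun_prop
        simpa using hc.tendsto (ξ q)
      exact this.eventually_lt_const hη0
    filter_upwards [hratio.filter_mono nhdsWithin_le_nhds, hsmall.filter_mono nhdsWithin_le_nhds,
      self_mem_nhdsWithin] with r h1 h2 h3 y
    have h3' : 0 < r - ξ q := sub_pos.2 h3
    have hW := dataSize_nonneg y
    have hl := h1 y
    set ℓ := logLikRatio κ (Function.update ξ q r) ξ y
    set W := dataSize y
    have hl2 : |ℓ| ≤ η * W := hl.trans (mul_le_mul_of_nonneg_right h2.le hW)
    -- The linear factor `W` of the bound `B W exp(η W)` is absorbed into a second exponential at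
    -- the cost of `1 / η`.
    have hWe : η * W ≤ Real.exp (η * W) := by linarith [Real.add_one_le_exp (η * W)]
    rw [abs_mul, abs_inv, abs_of_pos h3']
    calc (r - ξ q)⁻¹ * |Real.exp ℓ - 1|
        ≤ (r - ξ q)⁻¹ * ((B * (r - ξ q) * W) * Real.exp (η * W)) := by
          rw [abs_of_pos h3'] at hl
          refine mul_le_mul_of_nonneg_left ((abs_exp_sub_one_le ℓ).trans ?_) (inv_pos.2 h3').le
          exact mul_le_mul hl (Real.exp_le_exp.2 hl2) (Real.exp_pos _).le (by positivity)
      _ = B / η * ((η * W) * Real.exp (η * W)) := by field_simp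
      _ ≤ B / η * (Real.exp (η * W) * Real.exp (η * W)) := by gcongr
      _ = G y := by rw [hG, ← Real.exp_add]; congr 2; ring
  have hfi : Integrable f (snapshotLaw κ ξ) := hf.integrable (by norm_num)
  have hms : ∀ r, AEStronglyMeasurable (fun y : Data Mx My T =>
      (r - ξ q)⁻¹ * (Real.exp (logLikRatio κ (Function.update ξ q r) ξ y) - 1) * f y)
      (snapshotLaw κ ξ) := fun r =>
    (continuous_const.mul ((Real.continuous_exp.comp
      (continuous_logLikRatio κ _ _)).sub continuous_const)).aestronglyMeasurable.mul
      hf.aestronglyMeasurable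
  have hlim : Tendsto (fun r => ∫ y, (r - ξ q)⁻¹ *
      (Real.exp (logLikRatio κ (Function.update ξ q r) ξ y) - 1) * f y ∂(snapshotLaw κ ξ))
      (𝓝[>] (ξ q)) (𝓝 (∫ y, score κ ξ q y * f y ∂(snapshotLaw κ ξ))) := by
    refine tendsto_integral_filter_of_dominated_convergence (fun y => G y * |f y|)
      (Eventually.of_forall hms) ?_ hGf (ae_of_all _ fun y => ?_)
    · filter_upwards [hbound] with r hr
      refine ae_of_all _ fun y => ?_
      rw [Real.norm_eq_abs, abs_mul]
      exact mul_le_mul_of_nonneg_right (hr y) (abs_nonneg _)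
    · refine Tendsto.mul_const _ ?_
      have h := (hasDerivAt_iff_tendsto_slope.1 (hasDerivAt_exp_logLikRatio κ hξ q y)).mono_left
        (nhdsWithin_mono _ fun r (hr : ξ q < r) => hr.ne')
      refine h.congr fun r => ?_
      rw [slope_def_field, Function.update_eq_self]
      simp [logLikRatio, div_eq_inv_mul]
  refine hlim.congr' ?_
  filter_upwards [eventually_update_mem_paramSpace hξ q, hbound, self_mem_nhdsWithin]
    with r hr hb h3
  have h3' : 0 < r - ξ q := sub_pos.2 h3
  have hint : Integrable (fun y => (r - ξ q)⁻¹ *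
      (Real.exp (logLikRatio κ (Function.update ξ q r) ξ y) - 1) * f y) (snapshotLaw κ ξ) := by
    refine hGf.mono' (hms r) (ae_of_all _ fun y => ?_)
    rw [Real.norm_eq_abs, abs_mul]
    exact mul_le_mul_of_nonneg_right (hb y) (abs_nonneg _)
  -- This is integrability of `f` under the nearby law, so the expectation there is a genuine one
  -- and not the default value.
  have hint2 : Integrable (fun y => Real.exp (logLikRatio κ (Function.update ξ q r) ξ y) * f y)
      (snapshotLaw κ ξ) := by
    refine ((hint.const_mul (r - ξ q)).add hfi).congr (ae_of_all _ fun y => ?_)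
    simp only [Pi.add_apply]
    rw [← mul_assoc, ← mul_assoc, mul_inv_cancel₀ h3'.ne']
    ring
  have hmr : Measurable fun y : Data Mx My T =>
      ENNReal.ofReal (Real.exp (logLikRatio κ (Function.update ξ q r) ξ y)) :=
    ((Real.continuous_exp.comp (continuous_logLikRatio κ _ _)).measurable).ennreal_ofReal
  rw [snapshotLaw_eq_withDensity κ hξ hr, integral_withDensity_eq_integral_toReal_smul hmr
    (by simp)]
  simp only [ENNReal.toReal_ofReal (Real.exp_pos _).le, smul_eq_mul]
  rw [← integral_sub hint2 hfi, ← integral_const_mul]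
  exact integral_congr_ae (ae_of_all _ fun y => by ring)

/-- The covariance of a locally unbiased estimator with the score. -/
lemma integral_score_mul_of_locallyUnbiased (hξ : ξ ∈ paramSpace K)
    {uHat : Data Mx My T → AngIdx K → ℝ} (hu : IsLocallyUnbiasedAt κ uHat ξ) (i : AngIdx K)
    (hf : MemLp (fun y => uHat y i) 2 (snapshotLaw κ ξ)) (q : ParamIdx K) :
    (∫ y, uHat y i ∂(snapshotLaw κ ξ)) = ξ (Sum.inl i) ∧
    ∫ y, score κ ξ q y * uHat y i ∂(snapshotLaw κ ξ) = if Sum.inl i = q then 1 else 0 := by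
  have ho := hu.2 i
  -- The little-o bound also holds at `ξ` itself, where its right side is zero.
  have h0 : (∫ y, uHat y i ∂(snapshotLaw κ ξ)) - ξ (Sum.inl i) = 0 := by
    have := (ho.bound one_pos).self_of_nhdsWithin hξ
    simpa using this
  refine ⟨sub_eq_zero.1 h0, ?_⟩
  have hX : Tendsto (fun r => Function.update ξ q r) (𝓝[>] (ξ q)) (𝓝[paramSpace K] ξ) := by
    refine tendsto_nhdsWithin_iff.2 ⟨?_, eventually_update_mem_paramSpace hξ q⟩
    have hc : Continuous fun r => Function.update ξ q r := continuous_const.update q continuous_id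
    exact (hc.tendsto' (ξ q) ξ (Function.update_eq_self q ξ)).mono_left nhdsWithin_le_nhds
  have h1 := ho.comp_tendsto hX
  have hn : ∀ r, ‖Function.update ξ q r - ξ‖ = ‖r - ξ q‖ := by
    intro r
    have : Function.update ξ q r - ξ = Pi.single q (r - ξ q) := by
      funext j
      by_cases hj : j = q
      · subst hj; simp
      · simp [hj]
    rw [this, Pi.norm_single]
  have h2 : (fun r => (∫ y, uHat y i ∂(snapshotLaw κ (Function.update ξ q r))) -
      Function.update ξ q r (Sum.inl i)) =o[𝓝[>] (ξ q)] fun r => r - ξ q := by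
    rw [← isLittleO_norm_right] at h1 ⊢
    refine h1.congr_right fun r => ?_
    exact hn r
  have h3 := h2.tendsto_div_nhds_zero
  have h4 := tendsto_slope_expectation κ hξ q hf
  refine tendsto_nhds_unique h4 ?_
  -- The slope of the expectation is that of the bias, which tends to zero, plus that of the
  -- coordinate `ξ (Sum.inl i)` along the `q`-th axis, which is `1` or `0`.
  have h5 : Tendsto (fun r => ((∫ y, uHat y i ∂(snapshotLaw κ (Function.update ξ q r))) -
      Function.update ξ q r (Sum.inl i)) / (r - ξ q) + if Sum.inl i = q then 1 else 0)
      (𝓝[>] (ξ q)) (𝓝 (0 + if Sum.inl i = q then 1 else 0)) := h3.add_const _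
  rw [zero_add] at h5
  refine h5.congr' ?_
  filter_upwards [self_mem_nhdsWithin] with r hr
  have hr' : r - ξ q ≠ 0 := (sub_pos.2 hr).ne'
  rw [sub_eq_zero.1 h0]
  by_cases hq : Sum.inl i = q
  · subst hq
    simp only [Function.update_self, if_true]
    field_simp
    ring
  · simp only [Function.update_of_ne hq, if_neg hq]
    field_simp
    ring

end Derivative

end ArrayCRB

end

noncomputable section

namespace ArrayCRB

/-! ### Gram matrices, Schur complements and the Cramér–Rao bound -/

/-- The quadratic form at `c` is the second moment of `∑ c_a Z_a`. It serves both for the Fisher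
information and for the joint matrix of errors and scores. -/
lemma posSemidef_gram {α Y : Type*} [Fintype α] [MeasurableSpace Y] {μ : Measure Y}
    {Z : α → Y → ℝ} (hZ : ∀ a, MemLp (Z a) 2 μ) :
    (Matrix.of fun a b => ∫ y, Z a y * Z b y ∂μ).PosSemidef := by
  have hi : ∀ a b, Integrable (fun y => Z a y * Z b y) μ := fun a b => (hZ a).integrable_mul (hZ b)
  refine Matrix.PosSemidef.of_dotProduct_mulVec_nonneg ?_ fun c => ?_
  · ext a b
    simp only [conjTranspose_apply, Matrix.of_apply, star_trivial]
    exact integral_congr_ae (ae_of_all _ fun y => mul_comm _ _)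
  · have : star c ⬝ᵥ ((Matrix.of fun a b => ∫ y, Z a y * Z b y ∂μ) *ᵥ c) =
        ∫ y, (∑ a, c a * Z a y) ^ 2 ∂μ := by
      have e : ∀ y, (∑ a, c a * Z a y) ^ 2 = ∑ a, ∑ b, c a * c b * (Z a y * Z b y) := by
        intro y
        rw [sq, Finset.sum_mul_sum]
        exact Finset.sum_congr rfl fun a _ => Finset.sum_congr rfl fun b _ => by ring
      simp_rw [e]
      rw [integral_finsetSum _ fun a _ => integrable_finsetSum _ fun b _ => (hi a b).const_mul _]
      simp_rw [integral_finsetSum _ fun b _ => (hi _ b).const_mul _, integral_const_mul]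
      simp only [dotProduct, mulVec, Finset.mul_sum, Matrix.of_apply, star_trivial]
      exact Finset.sum_congr rfl fun a _ => Finset.sum_congr rfl fun b _ => by ring
    rw [this]
    exact integral_nonneg fun y => sq_nonneg _

section Schur
variable {K : ℕ} {J : Matrix (ParamIdx K) (ParamIdx K) ℝ}

lemma toBlocks₂₁_eq_transpose (hJ : J.IsHermitian) : J.toBlocks₂₁ = (J.toBlocks₁₂)ᵀ := by
  ext i j
  exact (hJ.apply (Sum.inr i) (Sum.inl j)).symm

lemma isUnit_det_toBlocks₂₂ (hJ : J.PosDef) : IsUnit (J.toBlocks₂₂).det :=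
  (Matrix.isUnit_iff_isUnit_det _).1
    (hJ.submatrix (e := Sum.inr) Sum.inr_injective : (J.toBlocks₂₂).PosDef).isUnit

/-- The Schur complement inverts the upper left block of the inverse. -/
lemma schurCompl_mul_inv_toBlocks₁₁ (hJ : J.PosDef) : schurCompl J * (J⁻¹).toBlocks₁₁ = 1 := by
  have hD := isUnit_det_toBlocks₂₂ hJ
  have hu : J * J⁻¹ = 1 := mul_nonsing_inv _ ((Matrix.isUnit_iff_isUnit_det _).1 hJ.isUnit)
  rw [← fromBlocks_toBlocks J, ← fromBlocks_toBlocks (fromBlocks _ _ _ _)⁻¹, fromBlocks_multiply,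
    ← fromBlocks_one, fromBlocks_inj, fromBlocks_toBlocks] at hu
  obtain ⟨h1, -, h2, -⟩ := hu
  rw [toBlocks₂₁_eq_transpose hJ.isHermitian] at h2
  have hY : (J⁻¹).toBlocks₂₁ = -((J.toBlocks₂₂)⁻¹ * ((J.toBlocks₁₂)ᵀ * (J⁻¹).toBlocks₁₁)) := by
    rw [← Matrix.mul_neg, ← eq_neg_of_add_eq_zero_right h2, ← Matrix.mul_assoc,
      nonsing_inv_mul _ hD, Matrix.one_mul]
  rw [hY] at h1
  rw [schurCompl, Matrix.sub_mul, ← h1, Matrix.mul_neg, ← sub_eq_add_neg]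
  simp only [Matrix.mul_assoc]

lemma isUnit_det_schurCompl (hJ : J.PosDef) : IsUnit (schurCompl J).det := by
  have h := congrArg Matrix.det (schurCompl_mul_inv_toBlocks₁₁ hJ)
  rw [det_mul, det_one] at h
  exact IsUnit.of_mul_eq_one _ h

lemma crb_eq (hJ : J.PosDef) : crb J = (J⁻¹).toBlocks₁₁ :=
  Matrix.inv_eq_right_inv (schurCompl_mul_inv_toBlocks₁₁ hJ)

end Schur

lemma IsUnbiased.isLocallyUnbiasedAt {Mx My K T : ℕ} (κ : ℝ)
    {uHat : Data Mx My T → AngIdx K → ℝ}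
    (hu : IsUnbiased κ uHat) (ξ : Param K) : IsLocallyUnbiasedAt κ uHat ξ := by
  refine ⟨hu.1, fun i => ?_⟩
  refine (isLittleO_zero _ _).congr' ?_ EventuallyEq.rfl
  filter_upwards [self_mem_nhdsWithin] with ξ' hξ'
  rw [(hu.2 ξ' hξ' i).2, sub_self]

section Bound
variable {Mx My K T : ℕ} (κ : ℝ) {ξ : Param K} (hξ : ξ ∈ paramSpace K)
include hξ

lemma posSemidef_fisherInformation : (fisherInformation Mx My T κ ξ).PosSemidef :=
  posSemidef_gram fun q => memLp_score κ hξ q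

/-- The Cramér–Rao bound for locally unbiased estimators. -/
lemma cramerRao_of_locallyUnbiased (hJ : IsUnit (fisherInformation Mx My T κ ξ).det)
    {uHat : Data Mx My T → AngIdx K → ℝ} (hu : IsLocallyUnbiasedAt κ uHat ξ)
    (hf : ∀ i, MemLp (fun y => uHat y i) 2 (snapshotLaw κ ξ)) :
    (errorCov κ uHat ξ - crb (fisherInformation Mx My T κ ξ)).PosSemidef := by
  have := isProbabilityMeasure_snapshotLaw (Mx := Mx) (My := My) (T := T) κ hξ
  set J := fisherInformation Mx My T κ ξ with hJdef
  have hpd : J.PosDef := (posSemidef_fisherInformation κ hξ).posDef_iff_det_ne_zero.2 hJ.ne_zero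
  -- Stacking errors and scores puts the error covariance, the cross-covariance `S = [I 0]` and `J`
  -- into one Gram matrix.
  let Z : AngIdx K ⊕ ParamIdx K → Data Mx My T → ℝ :=
    Sum.elim (fun i y => uHat y i - ξ (Sum.inl i)) (fun q y => score κ ξ q y)
  have hZ : ∀ a, MemLp (Z a) 2 (snapshotLaw κ ξ) := by
    rintro (i | q)
    · exact (hf i).sub (memLp_const _)
    · exact memLp_score κ hξ q
  let S : Matrix (AngIdx K) (ParamIdx K) ℝ := Matrix.of fun i q => if Sum.inl i = q then 1 else 0
  have hcross : ∀ i q, ∫ y, (uHat y i - ξ (Sum.inl i)) * score κ ξ q y ∂(snapshotLaw κ ξ) =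
      S i q := by
    intro i q
    have h1 := (integral_score_mul_of_locallyUnbiased κ hξ hu i (hf i) q).2
    have e : ∀ y, (uHat y i - ξ (Sum.inl i)) * score κ ξ q y =
        score κ ξ q y * uHat y i - ξ (Sum.inl i) * score κ ξ q y := fun y => by ring
    simp_rw [e]
    have hi : Integrable (fun y => score κ ξ q y * uHat y i) (snapshotLaw κ ξ) :=
      (memLp_score κ hξ q).integrable_mul (hf i)
    rw [integral_sub hi (((memLp_score κ hξ q).integrable (by norm_num)).const_mul _), h1,
      integral_const_mul, integral_score κ hξ, mul_zero, sub_zero]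
    rfl
  have hG := posSemidef_gram hZ
  have hblocks : (Matrix.of fun a b => ∫ y, Z a y * Z b y ∂(snapshotLaw κ ξ)) =
      fromBlocks (errorCov κ uHat ξ) S Sᴴ J := by
    ext (i | q) (j | q')
    · rfl
    · exact hcross i q'
    · simp only [Matrix.of_apply, fromBlocks_apply₂₁, conjTranspose_apply, star_trivial, ← hcross]
      exact integral_congr_ae (ae_of_all _ fun y => mul_comm _ _)
    · rfl
  have : Invertible J := J.invertibleOfIsUnitDet hJ
  -- Since `J` is positive definite, positivity of the Gram matrix amounts to positivity of
  -- `errorCov - S J⁻¹ Sᴴ`, and `S` selects the upper left block of `J⁻¹`.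
  rw [hblocks, Matrix.PosDef.fromBlocks₂₂ _ _ hpd] at hG
  have hS : S * J⁻¹ * Sᴴ = crb J := by
    rw [crb_eq hpd]
    ext i j
    simp [S, Matrix.mul_apply, toBlocks₁₁]
  rwa [hS] at hG

end Bound

end ArrayCRB

end

noncomputable section

namespace ArrayCRB

/-! ### Moments of the received signal -/

section Paths
variable {Mx My K T : ℕ} {Ω : Type*} (κ : ℝ) (ξ : Param K)

/-- Gain and angular deviations of a path. -/
def pathVec (g : Fin K → ℕ → Fin T → Ω → ℂ) (dθ dφ : Fin K → ℕ → Fin T → Ω → ℝ)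
    (p : Fin K × ℕ × Fin T) (ω : Ω) : ℂ × ℝ × ℝ :=
  (g p.1 p.2.1 p.2.2 ω, dθ p.1 p.2.1 p.2.2 ω, dφ p.1 p.2.1 p.2.2 ω)

/-- Signal of a path of user `k` at antenna `m`, per unit of transmitted signal. -/
def pathSignal (k : Fin K) (m : Antenna Mx My) (v : ℂ × ℝ × ℝ) : ℂ :=
  v.1 * response κ ξ k m v.2

@[fun_prop]
lemma continuous_pathSignal (k : Fin K) (m : Antenna Mx My) :
    Continuous (pathSignal κ ξ k m) := by
  unfold pathSignal; fun_prop

lemma receivedSignal_eq (s : Fin K → Fin T → ℂ)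
    (g : Fin K → ℕ → Fin T → Ω → ℂ) (dθ dφ : Fin K → ℕ → Fin T → Ω → ℝ)
    (noise : Fin T → Ω → Antenna Mx My → ℂ) (N : Fin K → ℕ) (t : Fin T) (ω : Ω)
    (m : Antenna Mx My) :
    receivedSignal (fun k => manifoldApprox κ (azim ξ k) (elev ξ k)) s g dθ dφ noise N t ω m =
      ∑ p ∈ Finset.univ.sigma fun k => Finset.range (N k),
        s p.1 t / ((Real.sqrt (N p.1) : ℝ) : ℂ) *
          pathSignal κ ξ p.1 m (pathVec g dθ dφ (p.1, p.2, t) ω) + noise t ω m := by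
  rw [receivedSignal, Finset.sum_sigma]
  congr 1
  refine Finset.sum_congr rfl fun k _ => ?_
  rw [Finset.mul_sum]
  refine Finset.sum_congr rfl fun j _ => ?_
  simp only [pathSignal, pathVec, response]
  ring

end Paths

/-- The ring homomorphism `τ` allows one computation to cover the covariance (`τ` conjugation) and
the pseudo-covariance (`τ` the identity). -/
lemma integral_sum_mul_ringHom_sum {Ω α β : Type*} [MeasurableSpace Ω] {P : Measure Ω}
    (τ : ℂ →+* ℂ) (s : Finset α) (s' : Finset β) {X : α → Ω → ℂ} {Y : β → Ω → ℂ}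
    (h : ∀ a b, Integrable (fun ω => X a ω * τ (Y b ω)) P) :
    ∫ ω, (∑ a ∈ s, X a ω) * τ (∑ b ∈ s', Y b ω) ∂P =
      ∑ a ∈ s, ∑ b ∈ s', ∫ ω, X a ω * τ (Y b ω) ∂P := by
  simp_rw [map_sum, Finset.sum_mul_sum]
  rw [integral_finsetSum _ fun a _ => integrable_finsetSum _ fun b _ => h a b]
  exact Finset.sum_congr rfl fun a _ => integral_finsetSum _ fun b _ => h a b

lemma posDef_noiseCov {Mx My K : ℕ} {ξ : Param K} (hξ : ξ ∈ paramSpace K) :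
    (((noisePower ξ : ℝ) : ℂ) • (1 : Matrix (Antenna Mx My) (Antenna Mx My) ℂ)).PosDef :=
  Matrix.PosDef.one.smul (by exact_mod_cast hξ.2.2.2.2.2)

section Model
variable {Mx My K T : ℕ} {Ω : Type*} [MeasurableSpace Ω] {P : Measure Ω}
  (κ : ℝ) {ξ : Param K} {S σγ : Fin K → ℝ} {s : Fin K → Fin T → ℂ}
  {g : Fin K → ℕ → Fin T → Ω → ℂ} {dθ dφ : Fin K → ℕ → Fin T → Ω → ℝ}
  {noise : Fin T → Ω → Antenna Mx My → ℂ} (hM : IsScatteringModel P ξ S σγ s g dθ dφ noise)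
include hM

lemma measurable_pathVec (p : Fin K × ℕ × Fin T) : Measurable (pathVec g dθ dφ p) :=
  (hM.measurable_gain _ _ _).prodMk ((hM.measurable_azim _ _ _).prodMk (hM.measurable_elev _ _ _))

lemma map_pathVec (p : Fin K × ℕ × Fin T) :
    P.map (pathVec g dθ dφ p) = (P.map (g p.1 p.2.1 p.2.2)).prod (devLaw ξ p.1) :=
  hM.path_law _ _ _

lemma indepFun_pathVec {p p' : Fin K × ℕ × Fin T} (h : p ≠ p') :
    IndepFun (pathVec g dθ dφ p) (pathVec g dθ dφ p') P :=
  hM.path_indep.indepFun h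

lemma integral_noise (t : Fin T) {f : (Antenna Mx My → ℂ) → ℂ}
    (hf : Continuous f) : ∫ ω, f (noise t ω) ∂P = ∫ x, f x ∂(complexGaussian
      (((noisePower ξ : ℝ) : ℂ) • (1 : Matrix (Antenna Mx My) (Antenna Mx My) ℂ))) := by
  rw [← hM.noise_law t, integral_map (hM.measurable_noise t).aemeasurable hf.aestronglyMeasurable]

lemma map_pathVec_eq (k : Fin K) (j j' : ℕ) (t t' : Fin T) :
    P.map (pathVec g dθ dφ (k, j, t)) = P.map (pathVec g dθ dφ (k, j', t')) := by
  rw [map_pathVec hM, map_pathVec hM, (hM.gain_ident k j t j' t').map_eq]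

lemma memLp_pathSignal (p : Fin K × ℕ × Fin T) (m : Antenna Mx My) :
    MemLp (fun ω => pathSignal κ ξ p.1 m (pathVec g dθ dφ p ω)) 2 P := by
  refine (hM.gain_memLp p.1 p.2.1 p.2.2).of_le
    ((continuous_pathSignal κ ξ p.1 m).measurable.comp
      (measurable_pathVec hM p)).aestronglyMeasurable (ae_of_all _ fun ω => ?_)
  rw [pathSignal, norm_mul, norm_response, mul_one]
  rfl

lemma indepFun_pathVec_noise (p : Fin K × ℕ × Fin T) (t : Fin T) :
    IndepFun (pathVec g dθ dφ p) (noise t) P :=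
  hM.path_noise_indep.comp
    (φ := fun (v : Fin K × ℕ × Fin T → ℂ × ℝ × ℝ) => v p)
    (ψ := fun (v : Fin T → Antenna Mx My → ℂ) => v t)
    (by exact measurable_pi_apply p) (by exact measurable_pi_apply t)

lemma memLp_noise (hξ : ξ ∈ paramSpace K) (t : Fin T) (m : Antenna Mx My) :
    MemLp (fun ω => noise t ω m) 2 P := by
  have h := memLp_eval_complexGaussian (posDef_noiseCov hξ) m
  rw [← hM.noise_law t] at h
  exact h.comp_of_map (hM.measurable_noise t).aemeasurable

lemma integral_noise_eval (hξ : ξ ∈ paramSpace K) (t : Fin T) (m : Antenna Mx My) :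
    ∫ ω, noise t ω m ∂P = 0 := by
  rw [integral_noise hM t (f := fun x => x m) (continuous_apply m),
    integral_eval_complexGaussian (posDef_noiseCov hξ)]

lemma memLp_receivedSignal (hξ : ξ ∈ paramSpace K) (N : Fin K → ℕ) (t : Fin T)
    (m : Antenna Mx My) :
    MemLp (fun ω => receivedSignal (fun k => manifoldApprox κ (azim ξ k) (elev ξ k)) s g dθ dφ
      noise N t ω m) 2 P := by
  simp_rw [receivedSignal_eq]
  exact (memLp_finsetSum _ fun p _ => (memLp_pathSignal κ hM (p.1, p.2, t) m).const_mul _).add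
    (memLp_noise hM hξ t m)

variable [IsProbabilityMeasure P]

lemma integral_gain_mul (p : Fin K × ℕ × Fin T) {a : ℂ → ℂ} {b : ℝ × ℝ → ℂ} (ha : Continuous a)
    (hb : Continuous b) :
    ∫ ω, a (pathVec g dθ dφ p ω).1 * b (pathVec g dθ dφ p ω).2 ∂P =
      (∫ ω, a (g p.1 p.2.1 p.2.2 ω) ∂P) * ∫ v, b v ∂(devLaw ξ p.1) := by
  have hm := hM.measurable_gain p.1 p.2.1 p.2.2
  have := Measure.isProbabilityMeasure_map (μ := P) hm.aemeasurable
  have hc : Continuous fun v : ℂ × ℝ × ℝ => a v.1 * b v.2 := by fun_prop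
  rw [← integral_map (μ := P) (measurable_pathVec hM p).aemeasurable
    (f := fun v : ℂ × ℝ × ℝ => a v.1 * b v.2) hc.aestronglyMeasurable, map_pathVec hM,
    integral_prod_mul, integral_map hm.aemeasurable ha.aestronglyMeasurable]

lemma integral_pathSignal (p : Fin K × ℕ × Fin T) (m : Antenna Mx My) :
    ∫ ω, pathSignal κ ξ p.1 m (pathVec g dθ dφ p ω) ∂P = 0 := by
  have h := integral_gain_mul hM p (a := fun z => z) continuous_id
    (continuous_response κ ξ p.1 m)
  rw [hM.gain_mean, zero_mul] at h
  exact h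

lemma integral_pathSignal_mul_conj (p : Fin K × ℕ × Fin T) (m n : Antenna Mx My) :
    ∫ ω, pathSignal κ ξ p.1 m (pathVec g dθ dφ p ω) *
      conj (pathSignal κ ξ p.1 n (pathVec g dθ dφ p ω)) ∂P =
      (σγ p.1 : ℂ) ^ 2 * userCov κ ξ p.1 m n := by
  have h := integral_gain_mul hM p (a := fun z => ((‖z‖ ^ 2 : ℝ) : ℂ)) (by fun_prop)
    (b := fun v => response κ ξ p.1 m v * conj (response κ ξ p.1 n v)) (by fun_prop)
  rw [integral_complex_ofReal, hM.gain_var, integral_response_mul_conj] at h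
  rw [Complex.ofReal_pow] at h
  rw [← h]
  refine integral_congr_ae (ae_of_all _ fun ω => ?_)
  simp only [pathSignal, map_mul, Complex.ofReal_pow, ← Complex.mul_conj']
  ring

lemma integral_pathSignal_mul (p : Fin K × ℕ × Fin T) (m n : Antenna Mx My) :
    ∫ ω, pathSignal κ ξ p.1 m (pathVec g dθ dφ p ω) *
      pathSignal κ ξ p.1 n (pathVec g dθ dφ p ω) ∂P = 0 := by
  have h := integral_gain_mul hM p (a := fun z => z ^ 2) (by fun_prop)
    (b := fun v => response κ ξ p.1 m v * response κ ξ p.1 n v) (by fun_prop)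
  rw [hM.gain_circular, zero_mul] at h
  rw [← h]
  refine integral_congr_ae (ae_of_all _ fun ω => ?_)
  simp only [pathSignal]
  ring

lemma integral_receivedSignal (hξ : ξ ∈ paramSpace K) (N : Fin K → ℕ) (t : Fin T)
    (m : Antenna Mx My) :
    ∫ ω, receivedSignal (fun k => manifoldApprox κ (azim ξ k) (elev ξ k)) s g dθ dφ
      noise N t ω m ∂P = 0 := by
  have h1 : ∀ p : (_ : Fin K) × ℕ, Integrable (fun ω => s p.1 t / ((Real.sqrt (N p.1) : ℝ) : ℂ) *
      pathSignal κ ξ p.1 m (pathVec g dθ dφ (p.1, p.2, t) ω)) P := fun p =>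
    ((memLp_pathSignal κ hM (p.1, p.2, t) m).integrable (by norm_num)).const_mul _
  simp_rw [receivedSignal_eq]
  rw [integral_add (integrable_finsetSum _ fun p _ => h1 p)
    ((memLp_noise hM hξ t m).integrable (by norm_num)), integral_noise_eval hM hξ,
    integral_finsetSum _ fun p _ => h1 p, add_zero]
  refine Finset.sum_eq_zero fun p _ => ?_
  rw [integral_const_mul, integral_pathSignal κ hM (p.1, p.2, t), mul_zero]

/-- Second moments of the received signal: conjugate (`τ = conj`) or plain (`τ = id`). -/
lemma integral_receivedSignal_mul (hξ : ξ ∈ paramSpace K) (N : Fin K → ℕ) (t t' : Fin T)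
    (m n : Antenna Mx My) (τ : ℂ →+* ℂ) (hτ : Continuous τ) (hn : ∀ z, ‖τ z‖ = ‖z‖)
    (V : Fin K → ℂ) (hV : ∀ p : Fin K × ℕ × Fin T,
      ∫ ω, pathSignal κ ξ p.1 m (pathVec g dθ dφ p ω) *
        τ (pathSignal κ ξ p.1 n (pathVec g dθ dφ p ω)) ∂P = V p.1)
    (W : ℂ) (hW : ∀ t, ∫ ω, noise t ω m * τ (noise t ω n) ∂P = W) :
    ∫ ω, receivedSignal (fun k => manifoldApprox κ (azim ξ k) (elev ξ k)) s g dθ dφ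
        noise N t ω m *
      τ (receivedSignal (fun k => manifoldApprox κ (azim ξ k) (elev ξ k)) s g dθ dφ
        noise N t' ω n) ∂P =
      if t = t' then ∑ k, (N k : ℂ) * (s k t / ((Real.sqrt (N k) : ℝ) : ℂ) *
        τ (s k t / ((Real.sqrt (N k) : ℝ) : ℂ)) * V k) + W else 0 := by
  have hLτ : ∀ {f : Ω → ℂ}, MemLp f 2 P → MemLp (fun ω => τ (f ω)) 2 P := fun hf =>
    hf.of_le (hτ.comp_aestronglyMeasurable hf.aestronglyMeasurable)
      (ae_of_all _ fun ω => (hn _).le)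
  have hmul : ∀ {f h : Ω → ℂ}, MemLp f 2 P → MemLp h 2 P →
      Integrable (fun ω => f ω * τ (h ω)) P := fun hf hh => hf.integrable_mul (hLτ hh)
  set c : Fin T → (_ : Fin K) × ℕ → ℂ := fun t p => s p.1 t / ((Real.sqrt (N p.1) : ℝ) : ℂ)
    with hc
  set X : Fin T → Antenna Mx My → (_ : Fin K) × ℕ → Ω → ℂ := fun t m p ω =>
    c t p * pathSignal κ ξ p.1 m (pathVec g dθ dφ (p.1, p.2, t) ω) with hX
  have hXL : ∀ t m p, MemLp (X t m p) 2 P := fun t m p =>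
    (memLp_pathSignal κ hM (p.1, p.2, t) m).const_mul _
  have hnL := memLp_noise hM hξ
  set F := Finset.univ.sigma fun k => Finset.range (N k) with hF
  have hAL : ∀ t m, MemLp (fun ω => ∑ p ∈ F, X t m p ω) 2 P := fun t m =>
    memLp_finsetSum _ fun p _ => hXL t m p
  have hmeas : ∀ p : Fin K × ℕ × Fin T, AEMeasurable (pathVec g dθ dφ p) P := fun p =>
    (measurable_pathVec hM p).aemeasurable
  have hmeasn : ∀ t, AEMeasurable (noise t) P := fun t => (hM.measurable_noise t).aemeasurable
  have cX : ∀ p p' : (_ : Fin K) × ℕ, ∫ ω, X t m p ω * τ (X t' n p' ω) ∂P =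
      if p = p' then (if t = t' then c t p * τ (c t p) * V p.1 else 0) else 0 := by
    intro p p'
    have e : ∀ ω, X t m p ω * τ (X t' n p' ω) = c t p * τ (c t' p') *
        (pathSignal κ ξ p.1 m (pathVec g dθ dφ (p.1, p.2, t) ω) *
          τ (pathSignal κ ξ p'.1 n (pathVec g dθ dφ (p'.1, p'.2, t') ω))) := by
      intro ω; simp only [hX, map_mul]; ring
    simp_rw [e]
    rw [integral_const_mul]
    by_cases hp : p = p' ∧ t = t'
    · obtain ⟨rfl, rfl⟩ := hp
      rw [hV (p.1, p.2, t), if_pos rfl, if_pos rfl]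
    -- Different paths, or one path at different snapshots, are independent and centered, so only
    -- diagonal terms contribute.
    · have hne : ((p.1, p.2, t) : Fin K × ℕ × Fin T) ≠ (p'.1, p'.2, t') := by
        rintro h
        simp only [Prod.mk.injEq] at h
        exact hp ⟨Sigma.ext h.1 (heq_of_eq h.2.1), h.2.2⟩
      have hz : ∫ ω, pathSignal κ ξ p.1 m (pathVec g dθ dφ (p.1, p.2, t) ω) *
          τ (pathSignal κ ξ p'.1 n (pathVec g dθ dφ (p'.1, p'.2, t') ω)) ∂P = 0 := by
        rw [(indepFun_pathVec hM hne).integral_fun_comp_mul_comp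
          (f := pathSignal κ ξ p.1 m) (g := fun v => τ (pathSignal κ ξ p'.1 n v))
          (hmeas _) (hmeas _) (by fun_prop) (by fun_prop),
          integral_pathSignal κ hM (p.1, p.2, t), zero_mul]
      rw [hz, mul_zero]
      split_ifs with h1 h2
      · exact absurd ⟨h1, h2⟩ hp
      · rfl
      · rfl
  have cXn : ∀ p : (_ : Fin K) × ℕ, ∫ ω, X t m p ω * τ (noise t' ω n) ∂P = 0 := by
    intro p
    have e : ∀ ω, X t m p ω * τ (noise t' ω n) = c t p *
        (pathSignal κ ξ p.1 m (pathVec g dθ dφ (p.1, p.2, t) ω) * τ (noise t' ω n)) := by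
      intro ω; simp only [hX]; ring
    simp_rw [e]
    rw [integral_const_mul, (indepFun_pathVec_noise hM (p.1, p.2, t) t').integral_fun_comp_mul_comp
      (f := pathSignal κ ξ p.1 m) (g := fun x => τ (x n)) (hmeas _) (hmeasn _) (by fun_prop)
      (by exact (hτ.comp (continuous_apply n)).aestronglyMeasurable),
      integral_pathSignal κ hM (p.1, p.2, t), zero_mul, mul_zero]
  have cnX : ∀ p : (_ : Fin K) × ℕ, ∫ ω, noise t ω m * τ (X t' n p ω) ∂P = 0 := by
    intro p
    rw [(indepFun_pathVec_noise hM (p.1, p.2, t') t).symm.integral_fun_comp_mul_comp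
      (f := fun x => x m) (g := fun v => τ (c t' p * pathSignal κ ξ p.1 n v)) (hmeasn _) (hmeas _)
      (by exact (continuous_apply m).aestronglyMeasurable) (by fun_prop),
      integral_noise_eval hM hξ, zero_mul]
  have cn : ∫ ω, noise t ω m * τ (noise t' ω n) ∂P = if t = t' then W else 0 := by
    split_ifs with h
    · subst h; exact hW t
    · rw [(hM.noise_indep.indepFun h).integral_fun_comp_mul_comp
        (f := fun x => x m) (g := fun x => τ (x n)) (hmeasn _) (hmeasn _)
        (by exact (continuous_apply m).aestronglyMeasurable)
        (by exact (hτ.comp (continuous_apply n)).aestronglyMeasurable),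
        integral_noise_eval hM hξ, zero_mul]
  have hexp : ∀ ω, receivedSignal (fun k => manifoldApprox κ (azim ξ k) (elev ξ k)) s g dθ dφ
        noise N t ω m *
      τ (receivedSignal (fun k => manifoldApprox κ (azim ξ k) (elev ξ k)) s g dθ dφ
        noise N t' ω n) =
      (∑ p ∈ F, X t m p ω) * τ (∑ p ∈ F, X t' n p ω) + (∑ p ∈ F, X t m p ω) * τ (noise t' ω n) +
      noise t ω m * τ (∑ p ∈ F, X t' n p ω) + noise t ω m * τ (noise t' ω n) := by
    intro ω
    rw [receivedSignal_eq, receivedSignal_eq, map_add]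
    simp only [hX, hc, hF]
    ring
  have i1 := hmul (hAL t m) (hAL t' n)
  have i2 := hmul (hAL t m) (hnL t' n)
  have i3 := hmul (hnL t m) (hAL t' n)
  have i4 := hmul (hnL t m) (hnL t' n)
  have s1 : ∫ ω, (∑ p ∈ F, X t m p ω) * τ (noise t' ω n) ∂P = 0 := by
    simp_rw [Finset.sum_mul]
    rw [integral_finsetSum _ fun p _ => hmul (hXL t m p) (hnL t' n)]
    exact Finset.sum_eq_zero fun p _ => cXn p
  have s2 : ∫ ω, noise t ω m * τ (∑ p ∈ F, X t' n p ω) ∂P = 0 := by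
    simp_rw [map_sum, Finset.mul_sum]
    rw [integral_finsetSum _ fun p _ => hmul (hnL t m) (hXL t' n p)]
    exact Finset.sum_eq_zero fun p _ => cnX p
  simp_rw [hexp]
  have i12 : Integrable (fun ω => (∑ p ∈ F, X t m p ω) * τ (∑ p ∈ F, X t' n p ω) +
    (∑ p ∈ F, X t m p ω) * τ (noise t' ω n)) P := i1.add i2
  have i123 : Integrable (fun ω => (∑ p ∈ F, X t m p ω) * τ (∑ p ∈ F, X t' n p ω) +
    (∑ p ∈ F, X t m p ω) * τ (noise t' ω n) + noise t ω m * τ (∑ p ∈ F, X t' n p ω)) P :=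
    i12.add i3
  rw [integral_add i123 i4, integral_add i12 i3, integral_add i1 i2, s1, s2, cn,
    integral_sum_mul_ringHom_sum τ F F fun p p' => hmul (hXL t m p) (hXL t' n p')]
  simp_rw [cX]
  by_cases h : t = t'
  · subst h
    simp only [if_true, Finset.sum_ite_eq, add_zero]
    congr 1
    rw [Finset.sum_congr rfl fun p hp => if_pos hp, hF, Finset.sum_sigma]
    refine Finset.sum_congr rfl fun k _ => ?_
    simp [hc]
  · simp [h]

lemma integral_receivedSignal_mul_conj (hξ : ξ ∈ paramSpace K) (N : Fin K → ℕ)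
    (hN : ∀ k, 1 ≤ N k) (t t' : Fin T) (m n : Antenna Mx My) :
    ∫ ω, receivedSignal (fun k => manifoldApprox κ (azim ξ k) (elev ξ k)) s g dθ dφ
        noise N t ω m *
      conj (receivedSignal (fun k => manifoldApprox κ (azim ξ k) (elev ξ k)) s g dθ dφ
        noise N t' ω n) ∂P = if t = t' then covR κ ξ m n else 0 := by
  rw [integral_receivedSignal_mul κ hM hξ N t t' m n (starRingEnd ℂ) (by fun_prop) (by simp)
    (fun k => (σγ k : ℂ) ^ 2 * userCov κ ξ k m n)
    (fun p => integral_pathSignal_mul_conj κ hM p m n)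
    ((noisePower ξ : ℂ) * (1 : Matrix (Antenna Mx My) (Antenna Mx My) ℂ) m n) ?_]
  · refine if_congr Iff.rfl ?_ rfl
    rw [covR_apply]
    congr 1
    refine Finset.sum_congr rfl fun k _ => ?_
    -- The `N_k` equal contributions cancel the squared normalization `1 / √N_k`; this needs at
    -- least one path.
    have hNk : (0 : ℝ) < N k := by exact_mod_cast hN k
    rw [Complex.mul_conj, Complex.normSq_eq_norm_sq, norm_div, div_pow, hM.signal k t,
      Complex.norm_real, Real.norm_eq_abs, sq_abs, Real.sq_sqrt hNk.le, hM.power_eq k]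
    have : (N k : ℂ) ≠ 0 := by exact_mod_cast hNk.ne'
    push_cast
    field_simp
  · intro t
    rw [integral_noise hM t (f := fun x => x m * conj (x n)) (by fun_prop),
      integral_mul_conj_complexGaussian (posDef_noiseCov hξ)]
    rfl

lemma integral_receivedSignal_mul_self (hξ : ξ ∈ paramSpace K) (N : Fin K → ℕ) (t t' : Fin T)
    (m n : Antenna Mx My) :
    ∫ ω, receivedSignal (fun k => manifoldApprox κ (azim ξ k) (elev ξ k)) s g dθ dφ
        noise N t ω m *
      receivedSignal (fun k => manifoldApprox κ (azim ξ k) (elev ξ k)) s g dθ dφ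
        noise N t' ω n ∂P = 0 := by
  have h := integral_receivedSignal_mul κ hM hξ N t t' m n (RingHom.id ℂ) continuous_id
    (fun _ => rfl) (fun _ => 0) (fun p => integral_pathSignal_mul κ hM p m n) 0 ?_
  · simpa using h
  · intro t
    rw [← integral_mul_complexGaussian (posDef_noiseCov hξ) m n,
      ← integral_noise hM t (f := fun x => x m * x n) (by fun_prop)]
    rfl

end Model

end ArrayCRB

end

noncomputable section

namespace ArrayCRB

/-! ### Gaussian limit of the received signal -/

/-- The central limit theorem at the level of characteristic functions. Dividing by the standard
deviation reduces to unit variance; if the variance is zero, `U` vanishes almost surely and every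
term equals `1`. -/
lemma tendsto_integral_exp_inv_sqrt_mul_pow {Ω : Type*} [MeasurableSpace Ω] {P : Measure Ω}
    [IsProbabilityMeasure P] {U : Ω → ℝ} (hU : MemLp U 2 P) (h0 : ∫ ω, U ω ∂P = 0) :
    Tendsto (fun n : ℕ =>
      (∫ ω, Complex.exp (Complex.I * (((Real.sqrt n)⁻¹ * U ω : ℝ) : ℂ)) ∂P) ^ n) atTop
      (𝓝 (Complex.exp (-(((∫ ω, U ω ^ 2 ∂P) / 2 : ℝ) : ℂ)))) := by
  set v := ∫ ω, U ω ^ 2 ∂P with hv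
  have hv0 : 0 ≤ v := integral_nonneg fun ω => sq_nonneg _
  rcases hv0.eq_or_lt with hv0 | hv0
  · have hz : U =ᵐ[P] 0 := by
      filter_upwards [(integral_eq_zero_iff_of_nonneg (fun ω => sq_nonneg (U ω))
        hU.integrable_sq).1 hv0.symm] with ω hω
      exact pow_eq_zero_iff two_ne_zero |>.1 hω
    have : ∀ n : ℕ, ∫ ω, Complex.exp (Complex.I * (((Real.sqrt n)⁻¹ * U ω : ℝ) : ℂ)) ∂P = 1 := by
      intro n
      have h : (fun ω => Complex.exp (Complex.I * (((Real.sqrt n)⁻¹ * U ω : ℝ) : ℂ))) =ᵐ[P]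
          fun _ => 1 := by
        filter_upwards [hz] with ω hω
        simp [hω]
      rw [integral_congr_ae h]
      simp
    simp_rw [this]
    simp [← hv0]
  · have hs : Real.sqrt v ≠ 0 := (Real.sqrt_pos.2 hv0).ne'
    have h := tendsto_charFun_inv_sqrt_mul_pow (P := P) (X := fun ω => (Real.sqrt v)⁻¹ * U ω)
      (hU.aestronglyMeasurable.aemeasurable.const_mul _)
      (by rw [integral_const_mul, h0, mul_zero])
      (by
        simp only [Pi.pow_apply, mul_pow]
        rw [integral_const_mul, ← hv, inv_pow, Real.sq_sqrt hv0.le, inv_mul_cancel₀ hv0.ne'])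
      (Real.sqrt v)
    have e : Complex.exp (-((Real.sqrt v : ℝ) : ℂ) ^ 2 / 2) =
        Complex.exp (-((v / 2 : ℝ) : ℂ)) := by
      rw [← Complex.ofReal_pow, Real.sq_sqrt hv0.le]
      push_cast
      ring_nf
    rw [e] at h
    refine h.congr fun n => ?_
    congr 1
    rw [charFun_apply_real, integral_map (hU.aestronglyMeasurable.aemeasurable.const_mul _)
      (by fun_prop)]
    refine integral_congr_ae (ae_of_all _ fun ω => ?_)
    have hs' : ((Real.sqrt v : ℝ) : ℂ) ≠ 0 := by exact_mod_cast hs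
    simp only
    congr 1
    push_cast
    field_simp

/-- The real linear functional `y ↦ ∑_t Re (w_tᴴ y_t)` on records of snapshots. -/
def dataFunctional {Mx My T : ℕ} (w y : Data Mx My T) : ℝ := ∑ t, (star (w t) ⬝ᵥ y t).re

lemma continuous_dataFunctional {Mx My T : ℕ} (w : Data Mx My T) :
    Continuous (dataFunctional w) := by
  unfold dataFunctional dotProduct
  fun_prop

lemma integral_exp_snapshotLaw {Mx My K T : ℕ} (κ : ℝ) {ξ : Param K} (hξ : ξ ∈ paramSpace K)
    (w : Data Mx My T) :
    ∫ y, Complex.exp (Complex.I * (dataFunctional w y : ℂ)) ∂(snapshotLaw κ ξ) =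
      ∏ t, Complex.exp (-(((star (w t) ⬝ᵥ (covR κ ξ *ᵥ w t)).re / 4 : ℝ) : ℂ)) := by
  have hR := posDef_covR (Mx := Mx) (My := My) κ ξ hξ
  have := isProbabilityMeasure_complexGaussian hR
  simp_rw [dataFunctional, Complex.ofReal_sum, Finset.mul_sum, Complex.exp_sum]
  rw [snapshotLaw, integral_fintype_prod_eq_prod
    (f := fun t x => Complex.exp (Complex.I * ((star (w t) ⬝ᵥ x).re : ℂ)))]
  exact Finset.prod_congr rfl fun t _ => integral_exp_complexGaussian hR (w t)

/-- Contribution of a path of user `k` in snapshot `t`, per unit of `1 / √N_k`, to the functional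
`dataFunctional w` of the received signal. -/
def pathFunctional {Mx My K T : ℕ} (κ : ℝ) (ξ : Param K) (s : Fin K → Fin T → ℂ)
    (w : Data Mx My T) (k : Fin K) (t : Fin T) (v : ℂ × ℝ × ℝ) : ℝ :=
  (s k t * ∑ m, conj (w t m) * pathSignal κ ξ k m v).re

@[fun_prop]
lemma continuous_pathFunctional {Mx My K T : ℕ} (κ : ℝ) (ξ : Param K) (s : Fin K → Fin T → ℂ)
    (w : Data Mx My T) (k : Fin K) (t : Fin T) :
    Continuous (pathFunctional κ ξ s w k t) := by
  unfold pathFunctional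
  fun_prop

lemma dataFunctional_receivedSignal {Mx My K T : ℕ} {Ω : Type*} (κ : ℝ) (ξ : Param K)
    (s : Fin K → Fin T → ℂ) (g : Fin K → ℕ → Fin T → Ω → ℂ) (dθ dφ : Fin K → ℕ → Fin T → Ω → ℝ)
    (noise : Fin T → Ω → Antenna Mx My → ℂ) (N : Fin K → ℕ) (w : Data Mx My T) (ω : Ω) :
    dataFunctional w (fun t => receivedSignal
      (fun k => manifoldApprox κ (azim ξ k) (elev ξ k)) s g dθ dφ noise N t ω) =
      ∑ k, ∑ j ∈ Finset.range (N k), ∑ t, (Real.sqrt (N k))⁻¹ *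
          pathFunctional κ ξ s w k t (pathVec g dθ dφ (k, j, t) ω) +
      dataFunctional w (fun t => noise t ω) := by
  have h : ∀ t, (star (w t) ⬝ᵥ receivedSignal
      (fun k => manifoldApprox κ (azim ξ k) (elev ξ k)) s g dθ dφ noise N t ω).re =
      ∑ k, ∑ j ∈ Finset.range (N k), (Real.sqrt (N k))⁻¹ *
        pathFunctional κ ξ s w k t (pathVec g dθ dφ (k, j, t) ω) +
      (star (w t) ⬝ᵥ noise t ω).re := by
    intro t
    simp only [dotProduct, receivedSignal_eq, mul_add, Finset.sum_add_distrib, Complex.add_re]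
    congr 1
    simp only [Finset.mul_sum]
    rw [Finset.sum_comm, Finset.sum_sigma, Complex.re_sum]
    refine Finset.sum_congr rfl fun k _ => ?_
    rw [Complex.re_sum]
    refine Finset.sum_congr rfl fun j _ => ?_
    rw [pathFunctional, ← Complex.re_ofReal_mul, Finset.mul_sum, Finset.mul_sum]
    congr 1
    refine Finset.sum_congr rfl fun m _ => ?_
    simp only [Pi.star_apply, RCLike.star_def]
    push_cast
    ring
  simp only [dataFunctional, h, Finset.sum_add_distrib]
  congr 1
  rw [Finset.sum_comm]
  exact Finset.sum_congr rfl fun k _ => Finset.sum_comm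

section Model
variable {Mx My K T : ℕ} {Ω : Type*} [MeasurableSpace Ω] {P : Measure Ω}
  (κ : ℝ) {ξ : Param K} {S σγ : Fin K → ℝ} {s : Fin K → Fin T → ℂ}
  {g : Fin K → ℕ → Fin T → Ω → ℂ} {dθ dφ : Fin K → ℕ → Fin T → Ω → ℝ}
  {noise : Fin T → Ω → Antenna Mx My → ℂ} (hM : IsScatteringModel P ξ S σγ s g dθ dφ noise)
include hM

lemma measurable_receivedSignal (N : Fin K → ℕ) :
    Measurable fun ω t => receivedSignal
      (fun k => manifoldApprox κ (azim ξ k) (elev ξ k)) s g dθ dφ noise N t ω := by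
  refine measurable_pi_iff.2 fun t => measurable_pi_iff.2 fun m => ?_
  simp_rw [receivedSignal_eq]
  exact (Finset.measurable_fun_sum _ fun p _ => ((continuous_pathSignal κ ξ p.1 m).measurable.comp
    (measurable_pathVec hM (p.1, p.2, t))).const_mul _).add
    ((measurable_pi_apply m).comp (hM.measurable_noise t))

variable (w : Data Mx My T)

lemma memLp_pathFunctional (k : Fin K) (j : ℕ) (t : Fin T) :
    MemLp (fun ω => pathFunctional κ ξ s w k t (pathVec g dθ dφ (k, j, t) ω)) 2 P :=
  ((memLp_finsetSum _ fun m _ =>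
    (memLp_pathSignal κ hM (k, j, t) m).const_mul (conj (w t m))).const_mul (s k t)).re

/-- Independence splits the characteristic function over users, paths and snapshots. Paths of one
user are identically distributed, so path `0` represents them and the product over `j` is a power;
snapshots stay separate since `s` and `w` vary with `t`. -/
lemma integral_exp_paths (N : Fin K → ℕ) :
    ∫ ω, Complex.exp (Complex.I * ((∑ k, ∑ j ∈ Finset.range (N k), ∑ t, (Real.sqrt (N k))⁻¹ *
        pathFunctional κ ξ s w k t (pathVec g dθ dφ (k, j, t) ω) : ℝ) : ℂ)) ∂P =
      ∏ k, ∏ t, (∫ ω, Complex.exp (Complex.I * (((Real.sqrt (N k))⁻¹ *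
        pathFunctional κ ξ s w k t (pathVec g dθ dφ (k, 0, t) ω) : ℝ) : ℂ)) ∂P) ^ N k := by
  have hmeas : ∀ p : Fin K × ℕ × Fin T, AEMeasurable (pathVec g dθ dφ p) P := fun p =>
    (measurable_pathVec hM p).aemeasurable
  set F : Finset ((_ : Fin K) × ℕ × Fin T) :=
    Finset.univ.sigma fun k => Finset.range (N k) ×ˢ Finset.univ with hF
  have hindF : iIndepFun (fun (p : F) => pathVec g dθ dφ (p.1.1, p.1.2)) P :=
    iIndepFun.precomp (g := fun p : F => (p.1.1, p.1.2)) (fun p p' h => by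
      simp only [Prod.mk.injEq] at h
      exact Subtype.ext (Sigma.ext h.1 (heq_of_eq h.2))) hM.path_indep
  have h := hindF.integral_fun_prod_comp
    (f := fun p v => Complex.exp (Complex.I * (((Real.sqrt (N p.1.1))⁻¹ *
      pathFunctional κ ξ s w p.1.1 p.1.2.2 v : ℝ) : ℂ))) (fun p => hmeas _)
    (fun p => by fun_prop)
  have e : ∀ ω, Complex.exp (Complex.I * ((∑ k, ∑ j ∈ Finset.range (N k), ∑ t,
      (Real.sqrt (N k))⁻¹ * pathFunctional κ ξ s w k t (pathVec g dθ dφ (k, j, t) ω) : ℝ) : ℂ)) =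
      ∏ p : F, Complex.exp (Complex.I * (((Real.sqrt (N p.1.1))⁻¹ *
        pathFunctional κ ξ s w p.1.1 p.1.2.2 (pathVec g dθ dφ (p.1.1, p.1.2) ω) : ℝ) : ℂ)) := by
    intro ω
    rw [← Complex.exp_sum, ← Finset.mul_sum, ← Complex.ofReal_sum,
      Finset.sum_coe_sort F fun p => (Real.sqrt (N p.1))⁻¹ *
        pathFunctional κ ξ s w p.1 p.2.2 (pathVec g dθ dφ (p.1, p.2) ω), hF, Finset.sum_sigma]
    simp_rw [Finset.sum_product]
  have e' : ∀ k (p : ℕ × Fin T), ∫ ω, Complex.exp (Complex.I * (((Real.sqrt (N k))⁻¹ *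
        pathFunctional κ ξ s w k p.2 (pathVec g dθ dφ (k, p) ω) : ℝ) : ℂ)) ∂P =
      ∫ ω, Complex.exp (Complex.I * (((Real.sqrt (N k))⁻¹ *
        pathFunctional κ ξ s w k p.2 (pathVec g dθ dφ (k, 0, p.2) ω) : ℝ) : ℂ)) ∂P := by
    intro k p
    have hc : Continuous fun v => Complex.exp (Complex.I * (((Real.sqrt (N k))⁻¹ *
        pathFunctional κ ξ s w k p.2 v : ℝ) : ℂ)) := by fun_prop
    rw [← integral_map (μ := P) (hmeas (k, p)) hc.aestronglyMeasurable,
      ← integral_map (μ := P) (hmeas (k, 0, p.2)) hc.aestronglyMeasurable,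
      show (k, p) = (k, p.1, p.2) from rfl, map_pathVec_eq hM k p.1 0 p.2 p.2]
  simp_rw [e]
  rw [h, Finset.prod_coe_sort F fun p => ∫ ω, Complex.exp (Complex.I * (((Real.sqrt (N p.1))⁻¹ *
        pathFunctional κ ξ s w p.1 p.2.2 (pathVec g dθ dφ (p.1, p.2) ω) : ℝ) : ℂ)) ∂P, hF,
    Finset.prod_sigma]
  refine Finset.prod_congr rfl fun k _ => ?_
  simp_rw [e', Finset.prod_product_right, Finset.prod_const, Finset.card_range]

lemma integral_exp_noise (hξ : ξ ∈ paramSpace K) :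
    ∫ ω, Complex.exp (Complex.I * (dataFunctional w (fun t => noise t ω) : ℂ)) ∂P =
      ∏ t, Complex.exp (-((noisePower ξ * (star (w t) ⬝ᵥ w t).re / 4 : ℝ) : ℂ)) := by
  have hmeasn : ∀ t, AEMeasurable (noise t) P := fun t => (hM.measurable_noise t).aemeasurable
  have h := hM.noise_indep.integral_fun_prod_comp
    (f := fun t x => Complex.exp (Complex.I * ((star (w t) ⬝ᵥ x).re : ℂ))) hmeasn
    (fun t => by
      refine Continuous.aestronglyMeasurable ?_
      unfold dotProduct
      fun_prop)
  simp_rw [dataFunctional, Complex.ofReal_sum, Finset.mul_sum, Complex.exp_sum]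
  rw [h]
  refine Finset.prod_congr rfl fun t _ => ?_
  rw [integral_noise hM t (f := fun x => Complex.exp (Complex.I * ((star (w t) ⬝ᵥ x).re : ℂ)))
    (by unfold dotProduct; fun_prop), integral_exp_complexGaussian (posDef_noiseCov hξ),
    Matrix.smul_mulVec, one_mulVec, dotProduct_smul, smul_eq_mul, Complex.re_ofReal_mul]

/-- Factorization of the characteristic function of the received signal. -/
lemma integral_exp_receivedSignal (hξ : ξ ∈ paramSpace K) (N : Fin K → ℕ) :
    ∫ ω, Complex.exp (Complex.I * (dataFunctional w (fun t => receivedSignal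
      (fun k => manifoldApprox κ (azim ξ k) (elev ξ k)) s g dθ dφ noise N t ω) : ℂ)) ∂P =
      (∏ k, ∏ t, (∫ ω, Complex.exp (Complex.I * (((Real.sqrt (N k))⁻¹ *
        pathFunctional κ ξ s w k t (pathVec g dθ dφ (k, 0, t) ω) : ℝ) : ℂ)) ∂P) ^ N k) *
      ∏ t, Complex.exp (-((noisePower ξ * (star (w t) ⬝ᵥ w t).re / 4 : ℝ) : ℂ)) := by
  have hmeas : ∀ p : Fin K × ℕ × Fin T, AEMeasurable (pathVec g dθ dφ p) P := fun p =>
    (measurable_pathVec hM p).aemeasurable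
  have hmeasn : ∀ t, AEMeasurable (noise t) P := fun t => (hM.measurable_noise t).aemeasurable
  have hf : Continuous fun v : Fin K × ℕ × Fin T → ℂ × ℝ × ℝ =>
      Complex.exp (Complex.I * ((∑ k, ∑ j ∈ Finset.range (N k), ∑ t, (Real.sqrt (N k))⁻¹ *
        pathFunctional κ ξ s w k t (v (k, j, t)) : ℝ) : ℂ)) := by
    fun_prop
  have hg : Continuous fun y : Data Mx My T =>
      Complex.exp (Complex.I * (dataFunctional w y : ℂ)) :=
    Complex.continuous_exp.comp (continuous_const.mul
      (Complex.continuous_ofReal.comp (continuous_dataFunctional w)))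
  have hind : IndepFun (fun ω p => pathVec g dθ dφ p ω) (fun ω t => noise t ω) P :=
    hM.path_noise_indep
  rw [← integral_exp_paths κ hM w N, ← integral_exp_noise hM w hξ]
  have h := hind.integral_fun_comp_mul_comp (aemeasurable_pi_iff.2 hmeas)
    (aemeasurable_pi_iff.2 hmeasn) hf.aestronglyMeasurable hg.aestronglyMeasurable
  refine Eq.trans (integral_congr_ae (ae_of_all _ fun ω => ?_)) h
  simp only
  rw [dataFunctional_receivedSignal, Complex.ofReal_add, mul_add, Complex.exp_add]

variable [IsProbabilityMeasure P]

lemma integral_pathFunctional (k : Fin K) (j : ℕ) (t : Fin T) :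
    ∫ ω, pathFunctional κ ξ s w k t (pathVec g dθ dφ (k, j, t) ω) ∂P = 0 := by
  have hi : ∀ m, Integrable (fun ω =>
      conj (w t m) * pathSignal κ ξ k m (pathVec g dθ dφ (k, j, t) ω)) P := fun m =>
    ((memLp_pathSignal κ hM (k, j, t) m).integrable (by norm_num)).const_mul _
  have h : ∫ ω, s k t * ∑ m, conj (w t m) *
      pathSignal κ ξ k m (pathVec g dθ dφ (k, j, t) ω) ∂P = 0 := by
    rw [integral_const_mul, integral_finsetSum _ fun m _ => hi m,
      Finset.sum_eq_zero fun m _ => ?_, mul_zero]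
    rw [integral_const_mul, integral_pathSignal κ hM (k, j, t), mul_zero]
  have hre := integral_re (𝕜 := ℂ) ((integrable_finsetSum Finset.univ fun m _ => hi m).const_mul
    (s k t))
  rw [h] at hre
  exact hre.trans (by simp)

/-- From `(Re (s Y))² = |s|² |Y|² / 2 + Re (s² Y²) / 2`: circularity of the gain removes the second
term, which leaves half of the conjugate second moment. -/
lemma integral_pathFunctional_sq (k : Fin K) (j : ℕ) (t : Fin T) :
    ∫ ω, pathFunctional κ ξ s w k t (pathVec g dθ dφ (k, j, t) ω) ^ 2 ∂P =
      power ξ k * (star (w t) ⬝ᵥ (userCov κ ξ k *ᵥ w t)).re / 2 := by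
  set X : Antenna Mx My → Ω → ℂ := fun m ω =>
    pathSignal κ ξ k m (pathVec g dθ dφ (k, j, t) ω) with hX
  have hL : ∀ m, MemLp (X m) 2 P := memLp_pathSignal κ hM (k, j, t)
  set Y : Ω → ℂ := fun ω => ∑ m, conj (w t m) * X m ω with hY
  have hYL : MemLp Y 2 P := memLp_finsetSum _ fun m _ => (hL m).const_mul _
  have hLc : ∀ {f : Ω → ℂ}, MemLp f 2 P → MemLp (fun ω => conj (f ω)) 2 P := fun hf =>
    hf.star
  have h1 : ∫ ω, Y ω * Y ω ∂P = 0 := by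
    have h := integral_sum_mul_ringHom_sum (P := P) (RingHom.id ℂ) Finset.univ Finset.univ
      (X := fun m ω => conj (w t m) * X m ω) (Y := fun m ω => conj (w t m) * X m ω)
      fun m n => ((hL m).const_mul _).integrable_mul ((hL n).const_mul _)
    refine h.trans (Finset.sum_eq_zero fun m _ => Finset.sum_eq_zero fun n _ => ?_)
    have e : ∀ ω, conj (w t m) * X m ω * (RingHom.id ℂ) (conj (w t n) * X n ω) =
        conj (w t m) * conj (w t n) * (X m ω * X n ω) := fun ω => by
      simp only [RingHom.id_apply]; ring
    simp_rw [e]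
    rw [integral_const_mul, integral_pathSignal_mul κ hM (k, j, t), mul_zero]
  have h2 : ∫ ω, Y ω * conj (Y ω) ∂P =
      (σγ k : ℂ) ^ 2 * (star (w t) ⬝ᵥ (userCov κ ξ k *ᵥ w t)) := by
    have h := integral_sum_mul_ringHom_sum (P := P) (starRingEnd ℂ) Finset.univ Finset.univ
      (X := fun m ω => conj (w t m) * X m ω) (Y := fun m ω => conj (w t m) * X m ω)
      fun m n => ((hL m).const_mul _).integrable_mul (hLc ((hL n).const_mul _))
    refine h.trans ?_
    simp only [dotProduct, mulVec, Finset.mul_sum]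
    refine Finset.sum_congr rfl fun m _ => Finset.sum_congr rfl fun n _ => ?_
    have e : ∀ ω, conj (w t m) * X m ω * conj (conj (w t n) * X n ω) =
        conj (w t m) * w t n * (X m ω * conj (X n ω)) := fun ω => by
      simp only [map_mul, Complex.conj_conj]; ring
    simp_rw [e]
    rw [integral_const_mul, integral_pathSignal_mul_conj κ hM (k, j, t)]
    simp only [Pi.star_apply, RCLike.star_def]
    ring
  have e : ∀ ω, pathFunctional κ ξ s w k t (pathVec g dθ dφ (k, j, t) ω) ^ 2 =
      (((‖s k t‖ ^ 2 : ℝ) : ℂ) / 2 * (Y ω * conj (Y ω)) + s k t ^ 2 / 2 * (Y ω * Y ω)).re := by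
    intro ω
    have : pathFunctional κ ξ s w k t (pathVec g dθ dφ (k, j, t) ω) = (s k t * Y ω).re := rfl
    rw [this]
    generalize Y ω = y
    rw [Complex.sq_norm, Complex.normSq_apply]
    simp only [Complex.mul_re, Complex.add_re, Complex.conj_re, Complex.conj_im, Complex.mul_im,
      pow_two, Complex.div_ofNat_re, Complex.div_ofNat_im, Complex.ofReal_re, Complex.ofReal_im]
    ring
  simp_rw [e]
  have i1 : Integrable (fun ω => ((‖s k t‖ ^ 2 : ℝ) : ℂ) / 2 * (Y ω * conj (Y ω))) P :=
    (hYL.integrable_mul (hLc hYL)).const_mul _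
  have i2 : Integrable (fun ω => s k t ^ 2 / 2 * (Y ω * Y ω)) P :=
    (hYL.integrable_mul hYL).const_mul _
  have hre := integral_re (𝕜 := ℂ) (i1.add i2)
  refine hre.trans ?_
  simp only [Pi.add_apply]
  rw [integral_add i1 i2, integral_const_mul, integral_const_mul, h1, h2, mul_zero, add_zero,
    hM.signal, hM.power_eq]
  simp only [RCLike.re_to_complex]
  rw [← mul_assoc, ← Complex.ofReal_ofNat, ← Complex.ofReal_pow, ← Complex.ofReal_div,
    ← Complex.ofReal_mul, Complex.re_ofReal_mul]
  ring

lemma tendsto_integral_exp_receivedSignal (hξ : ξ ∈ paramSpace K) :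
    Tendsto (fun N : Fin K → ℕ => ∫ ω, Complex.exp (Complex.I * (dataFunctional w (fun t =>
      receivedSignal (fun k => manifoldApprox κ (azim ξ k) (elev ξ k)) s g dθ dφ
        noise N t ω) : ℂ)) ∂P) atTop
      (𝓝 (∫ y, Complex.exp (Complex.I * (dataFunctional w y : ℂ)) ∂(snapshotLaw κ ξ))) := by
  -- In the product order `atTop` sends every `N_k` to infinity, so the limit can be taken factor by
  -- factor.
  have hN : ∀ k, Tendsto (fun N : Fin K → ℕ => N k) atTop atTop := fun k =>
    tendsto_atTop_atTop.2 fun b => ⟨fun _ => b, fun N hN => hN k⟩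
  simp_rw [integral_exp_receivedSignal κ hM w hξ]
  have h := (tendsto_finsetProd Finset.univ fun k _ => tendsto_finsetProd Finset.univ fun t _ =>
    (tendsto_integral_exp_inv_sqrt_mul_pow (memLp_pathFunctional κ hM w k 0 t)
      (integral_pathFunctional κ hM w k 0 t)).comp (hN k)).mul_const
    (∏ t, Complex.exp (-((noisePower ξ * (star (w t) ⬝ᵥ w t).re / 4 : ℝ) : ℂ)))
  refine (?_ : _ = ∫ y, Complex.exp (Complex.I * (dataFunctional w y : ℂ)) ∂(snapshotLaw κ ξ)) ▸ h
  rw [integral_exp_snapshotLaw κ hξ, Finset.prod_comm, ← Finset.prod_mul_distrib]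
  refine Finset.prod_congr rfl fun t _ => ?_
  rw [← Complex.exp_sum, ← Complex.exp_add]
  congr 1
  rw [Finset.sum_neg_distrib, ← neg_add, ← Complex.ofReal_sum, ← Complex.ofReal_add]
  congr 2
  have hR : covR κ ξ = ∑ k, (power ξ k : ℂ) • userCov κ ξ k +
      (noisePower ξ : ℂ) • (1 : Matrix (Antenna Mx My) (Antenna Mx My) ℂ) := rfl
  rw [hR, Matrix.add_mulVec, Matrix.sum_mulVec, dotProduct_add, dotProduct_sum,
    Matrix.smul_mulVec, one_mulVec, dotProduct_smul, smul_eq_mul, Complex.add_re, Complex.re_sum,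
    Complex.re_ofReal_mul, add_div, Finset.sum_div]
  congr 1
  refine Finset.sum_congr rfl fun k _ => ?_
  rw [Matrix.smul_mulVec, dotProduct_smul, smul_eq_mul, Complex.re_ofReal_mul,
    integral_pathFunctional_sq κ hM]
  ring

end Model

/-- Records of snapshots as a Euclidean space. -/
abbrev EuclideanData (Mx My T : ℕ) : Type := PiLp 2 fun _ : Fin T × Antenna Mx My => ℂ

/-- Lévy's continuity theorem for laws of records of snapshots. -/
lemma tendsto_integral_of_tendsto_charFun {Mx My T : ℕ} {Ω : Type*} [MeasurableSpace Ω]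
    {P : Measure Ω} [IsProbabilityMeasure P] {μ : Measure (Data Mx My T)} [IsProbabilityMeasure μ]
    {X : ℕ → Ω → Data Mx My T} (hX : ∀ n, Measurable (X n))
    (h : ∀ w, Tendsto (fun n => ∫ ω, Complex.exp (Complex.I * (dataFunctional w (X n ω) : ℂ)) ∂P)
      atTop (𝓝 (∫ y, Complex.exp (Complex.I * (dataFunctional w y : ℂ)) ∂μ)))
    (f : Data Mx My T →ᵇ ℝ) :
    Tendsto (fun n => ∫ ω, f (X n ω) ∂P) atTop (𝓝 (∫ y, f y ∂μ)) := by
  -- Lévy's theorem is applied in an inner product space, so records are moved to a Euclidean space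
  -- where `dataFunctional` becomes the real inner product.
  let e : Data Mx My T → EuclideanData Mx My T := fun y => WithLp.toLp 2 fun p => y p.1 p.2
  let e' : EuclideanData Mx My T → Data Mx My T := fun z t m => z (t, m)
  have he : Continuous e := (PiLp.continuous_toLp 2 _).comp (by fun_prop)
  have he' : Continuous e' := by fun_prop
  have hin : ∀ y z, (inner ℝ (e y) z : ℝ) = dataFunctional (e' z) y := by
    intro y z
    rw [PiLp.inner_apply, Fintype.sum_prod_type]
    simp only [dataFunctional, dotProduct, Complex.re_sum]
    refine Finset.sum_congr rfl fun t _ => Finset.sum_congr rfl fun m _ => ?_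
    simp [e, e', Complex.inner]
  have hXe : ∀ n, AEMeasurable (fun ω => e (X n ω)) P := fun n =>
    (he.measurable.comp (hX n)).aemeasurable
  let ν : ℕ → ProbabilityMeasure (EuclideanData Mx My T) := fun n =>
    ⟨P.map fun ω => e (X n ω), Measure.isProbabilityMeasure_map (hXe n)⟩
  let ν₀ : ProbabilityMeasure (EuclideanData Mx My T) :=
    ⟨μ.map e, Measure.isProbabilityMeasure_map he.measurable.aemeasurable⟩
  have hν : Tendsto ν atTop (𝓝 ν₀) := by
    refine ProbabilityMeasure.tendsto_iff_tendsto_charFun.2 fun z => ?_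
    have hc : Continuous fun x : EuclideanData Mx My T => Complex.exp (((inner ℝ x z : ℝ) : ℂ) * Complex.I) := by
      fun_prop
    have h1 : ∀ n, charFun (ν n : Measure (EuclideanData Mx My T)) z =
        ∫ ω, Complex.exp (Complex.I * (dataFunctional (e' z) (X n ω) : ℂ)) ∂P := by
      intro n
      rw [charFun_apply]
      refine (integral_map (hXe n) hc.aestronglyMeasurable).trans ?_
      simp_rw [hin, mul_comm]
    have h2 : charFun (ν₀ : Measure (EuclideanData Mx My T)) z =
        ∫ y, Complex.exp (Complex.I * (dataFunctional (e' z) y : ℂ)) ∂μ := by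
      rw [charFun_apply]
      refine (integral_map he.measurable.aemeasurable hc.aestronglyMeasurable).trans ?_
      simp_rw [hin, mul_comm]
    simp_rw [h1, h2]
    exact h _
  have hf := ProbabilityMeasure.tendsto_iff_forall_integral_tendsto.1 hν
    (f.compContinuous ⟨e', he'⟩)
  have hcf : Continuous fun x : EuclideanData Mx My T => f (e' x) := f.continuous.comp he'
  have h1 : ∀ n, ∫ x, (f.compContinuous ⟨e', he'⟩) x ∂(ν n : Measure (EuclideanData Mx My T)) = ∫ ω, f (X n ω) ∂P :=
    fun n => integral_map (hXe n) hcf.aestronglyMeasurable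
  have h2 : ∫ x, (f.compContinuous ⟨e', he'⟩) x ∂(ν₀ : Measure (EuclideanData Mx My T)) = ∫ y, f y ∂μ :=
    integral_map he.measurable.aemeasurable hcf.aestronglyMeasurable
  simp_rw [h1, h2] at hf
  exact hf

/-- Gaussianity of the received signal in the limit of many paths. -/
lemma tendsto_integral_receivedSignal {Mx My K T : ℕ} {Ω : Type*} [MeasurableSpace Ω]
    {P : Measure Ω} [IsProbabilityMeasure P] (κ : ℝ) {ξ : Param K} {S σγ : Fin K → ℝ}
    {s : Fin K → Fin T → ℂ} {g : Fin K → ℕ → Fin T → Ω → ℂ}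
    {dθ dφ : Fin K → ℕ → Fin T → Ω → ℝ} {noise : Fin T → Ω → Antenna Mx My → ℂ}
    (hM : IsScatteringModel P ξ S σγ s g dθ dφ noise) (hξ : ξ ∈ paramSpace K)
    (f : Data Mx My T →ᵇ ℝ) :
    Tendsto (fun N : Fin K → ℕ => ∫ ω, f (fun t => receivedSignal
      (fun k => manifoldApprox κ (azim ξ k) (elev ξ k)) s g dθ dφ noise N t ω) ∂P) atTop
      (𝓝 (∫ y, f y ∂(snapshotLaw κ ξ))) := by
  have := isProbabilityMeasure_snapshotLaw (Mx := Mx) (My := My) (T := T) κ hξ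
  -- The filter `atTop` on `Fin K → ℕ` is countably generated, so it suffices to follow sequences of
  -- path numbers.
  refine tendsto_of_seq_tendsto fun N hN => ?_
  exact tendsto_integral_of_tendsto_charFun (fun n => measurable_receivedSignal κ hM (N n))
    (fun w => (tendsto_integral_exp_receivedSignal κ hM w hξ).comp hN) f

end ArrayCRB

end

/-! ### Assembly of the main theorem -/

theorem mainTheorem2
    {Mx My K T : ℕ} (d lam : ℝ) (hd : 0 < d) (hlam : 0 < lam)
    (ξ : Param K) (hξ : ξ ∈ paramSpace K)
    {Ω : Type*} [MeasurableSpace Ω] (P : Measure Ω) [IsProbabilityMeasure P] :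
    -- the approximated manifold has a second-order error in the deviations
    (∀ (θ φ : ℝ) (m : Antenna Mx My),
      (fun δ : ℝ × ℝ => manifold (waveFactor d lam) (θ + δ.1) (φ + δ.2) m -
          manifoldApprox (waveFactor d lam) θ φ δ.1 δ.2 m)
        =O[𝓝 0] (fun δ => ‖δ‖ ^ 2)) ∧
    -- the received signal with the approximated manifold: mean, covariance, circularity for any
    -- numbers of paths, and Gaussianity in the limit of many paths
    (∀ (S σγ : Fin K → ℝ) (s : Fin K → Fin T → ℂ) (g : Fin K → ℕ → Fin T → Ω → ℂ)
        (dθ dφ : Fin K → ℕ → Fin T → Ω → ℝ) (noise : Fin T → Ω → Antenna Mx My → ℂ)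
        (x : (Fin K → ℕ) → Fin T → Ω → Antenna Mx My → ℂ),
      IsScatteringModel P ξ S σγ s g dθ dφ noise →
      x = receivedSignal
        (fun k => manifoldApprox (waveFactor d lam) (azim ξ k) (elev ξ k)) s g dθ dφ noise →
      (∀ N : Fin K → ℕ, (∀ k, 1 ≤ N k) →
        (∀ t m, MemLp (fun ω => x N t ω m) 2 P ∧ ∫ ω, x N t ω m ∂P = 0) ∧
        (∀ t t' m n, ∫ ω, x N t ω m * conj (x N t' ω n) ∂P =
          if t = t' then covR (waveFactor d lam) ξ m n else 0) ∧
        (∀ t t' m n, ∫ ω, x N t ω m * x N t' ω n ∂P = 0)) ∧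
      (∀ f : Data Mx My T →ᵇ ℝ,
        Tendsto (fun N : Fin K → ℕ => ∫ ω, f (fun t => x N t ω) ∂P) atTop
          (𝓝 (∫ y, f y ∂(snapshotLaw (waveFactor d lam) ξ))))) ∧
    -- the Gaussian model is well defined
    (covR (Mx := Mx) (My := My) (waveFactor d lam) ξ).PosDef ∧
    IsProbabilityMeasure (snapshotLaw (Mx := Mx) (My := My) (T := T) (waveFactor d lam) ξ) ∧
    -- the explicit partial derivatives of the covariance matrix
    (∀ (q : ParamIdx K) (m n : Antenna Mx My),
      HasDerivAt (fun r : ℝ => covR (waveFactor d lam) (Function.update ξ q r) m n)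
        (covPartial (waveFactor d lam) ξ q m n) (ξ q)) ∧
    -- the Fisher information of the `T` snapshots
    (∀ (q : ParamIdx K) (y : Data Mx My T),
      DifferentiableAt ℝ (logLikAlong (waveFactor d lam) ξ q y) (ξ q)) ∧
    (∀ q q' : ParamIdx K,
      Integrable (fun y : Data Mx My T =>
        score (waveFactor d lam) ξ q y * score (waveFactor d lam) ξ q' y)
        (snapshotLaw (waveFactor d lam) ξ) ∧
      ((fisherInformation Mx My T (waveFactor d lam) ξ q q' : ℝ) : ℂ) =
        (T : ℂ) * Matrix.trace
          ((covR (Mx := Mx) (My := My) (waveFactor d lam) ξ)⁻¹ * covPartial (waveFactor d lam) ξ q *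
            (covR (waveFactor d lam) ξ)⁻¹ * covPartial (waveFactor d lam) ξ q')) ∧
    -- the Cramér-Rao bound for the angular parameters
    (∀ J : Matrix (ParamIdx K) (ParamIdx K) ℝ,
      J = fisherInformation Mx My T (waveFactor d lam) ξ → IsUnit J.det →
      J = Matrix.fromBlocks J.toBlocks₁₁ J.toBlocks₁₂ (J.toBlocks₁₂)ᵀ J.toBlocks₂₂ ∧
      IsUnit (J.toBlocks₂₂).det ∧ IsUnit (schurCompl J).det ∧ crb J = (J⁻¹).toBlocks₁₁ ∧
      (∀ uHat : Data Mx My T → AngIdx K → ℝ,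
        IsUnbiased (waveFactor d lam) uHat →
        (∀ i, MemLp (fun y => uHat y i) 2 (snapshotLaw (waveFactor d lam) ξ)) →
        (errorCov (waveFactor d lam) uHat ξ - crb J).PosSemidef) ∧
      (∀ uHat : Data Mx My T → AngIdx K → ℝ,
        IsLocallyUnbiasedAt (waveFactor d lam) uHat ξ →
        (∀ i, MemLp (fun y => uHat y i) 2 (snapshotLaw (waveFactor d lam) ξ)) →
        (errorCov (waveFactor d lam) uHat ξ - crb J).PosSemidef)) := by
  have hR := posDef_covR (Mx := Mx) (My := My) (waveFactor d lam) ξ hξ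
  refine ⟨isBigO_manifold_sub_approx _, ?_, hR, isProbabilityMeasure_snapshotLaw _ hξ,
    hasDerivAt_covR_update _ ξ, fun q y => (hasDerivAt_logLikAlong _ hξ q y).differentiableAt,
    fun q q' => ⟨(memLp_score _ hξ q).integrable_mul (memLp_score _ hξ q'),
      fisherInformation_eq _ hξ q q'⟩, ?_⟩
  · intro S σγ s g dθ dφ noise x hM hx
    subst hx
    exact ⟨fun N hN => ⟨fun t m => ⟨memLp_receivedSignal _ hM hξ N t m,
      integral_receivedSignal _ hM hξ N t m⟩, integral_receivedSignal_mul_conj _ hM hξ N hN,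
      integral_receivedSignal_mul_self _ hM hξ N⟩, tendsto_integral_receivedSignal _ hM hξ⟩
  · intro J hJ hdet
    subst hJ
    -- As a Gram matrix of scores, `J` is positive semidefinite, so invertibility upgrades it to
    -- positive definite; this makes its lower right block and Schur complement invertible.
    have hP := (posSemidef_fisherInformation (Mx := Mx) (My := My) (T := T)
      (waveFactor d lam) hξ).posDef_iff_det_ne_zero.2 hdet.ne_zero
    refine ⟨?_, isUnit_det_toBlocks₂₂ hP, isUnit_det_schurCompl hP, crb_eq hP, ?_, ?_⟩
    · rw [← toBlocks₂₁_eq_transpose hP.isHermitian, Matrix.fromBlocks_toBlocks]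
    · exact fun uHat hu hf =>
        cramerRao_of_locallyUnbiased _ hξ hdet (hu.isLocallyUnbiasedAt _ ξ) hf
    · exact fun uHat hu hf => cramerRao_of_locallyUnbiased _ hξ hdet hu hf
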